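/- Let $K$ be a field of characteristic $0$, $\Gamma$ a finite abelian group and $H=K[\Gamma]$. Let $W=\bigoplus_{i=1}^{\theta}Kx_i$ be a quantum linear space over $H$: $x_i$ has degree $g_i\in\Gamma$ and character $\chi_i:\Gamma\to K^{\times}$, $\chi_i(g_j)\chi_j(g_i)=1$ for $i\neq j$, and $\chi_i(g_i)$ is a primitive $r_i$-th root of unity with $r_i\geq 2$. Let $A=\mathcal B(W)\#H$ be the Radford biproduct of the Nichols algebra of $W$ with $H$, where $hx_i=\chi_i(h)x_ih$ and $\Delta(x_i)=x_i\otimes 1+g_i\otimes x_i$; it has the basis $x_1^{n_1}\cdots x_\theta^{n_\theta}h$ with $0\le n_k<r_k$, $h\in\Gamma$. Let $a_i$ ($1\le i\le\theta$) and $a_{ij}$ ($i\neq j$) be scalars, possibly zero, such that $a_{ji}=-\chi_i(g_j)a_{ij}$; if $a_i\neq 0$ then $g_i^{r_i}\neq 1$ and $\chi_i^{r_i}=\varepsilon$; if $a_{ij}\neq 0$ then $g_ig_j\neq 1$ and $\chi_i\chi_j=\varepsilon$. Let $B$ be the lifting of $A$ with these scalars, that is, the Hopf algebra generated by the grouplikes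 $h\in\Gamma$ and elements $x_1,\dots,x_\theta$ with $\Delta(x_i)=x_i\otimes 1+g_i\otimes x_i$ and relations (besides those of $\Gamma$) $$hx_i=\chi_i(h)x_ih,\qquad x_i^{r_i}=a_i(1-g_i^{r_i}),\qquad x_ix_j=\chi_j(g_i)x_jx_i+a_{ij}(1-g_ig_j)\quad(i\neq j).$$ A map $\gamma:A\otimes A\to K$ is $H$-bilinear if $\gamma(ha\otimes bh')=\varepsilon(h)\varepsilon(h')\gamma(a\otimes b)$ for $h,h'\in H$. Let $Z^2_H(A,K)$ be the set of $H$-bilinear, convolution invertible $\gamma$ with $\gamma(x\otimes 1)=\gamma(1\otimes x)=\varepsilon(x)$ and $$\gamma(y_{(1)}\otimes z_{(1)})\,\gamma(x\otimes y_{(2)}z_{(2)})=\gamma(x_{(1)}\otimes y_{(1)})\,\gamma(x_{(2)}y_{(2)}\otimes z).$$ For $\gamma\in Z^2_H(A,K)$, the twist $A^{\gamma}$ is the coalgebra $A$ with the unit of $A$ and the multiplication $\gamma * m_A * \gamma^{-1}$, where $*$ is convolution. Define $H$-bilinear maps $\gamma_i$, and $\gamma_{ij}$ for $i<j$, by their values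 on pairs of monomials $x_1^{n_1}\cdots x_\theta^{n_\theta}$, $0\le n_k<r_k$: $\gamma_i=\varepsilon\otimes\varepsilon$ except that $\gamma_i(x_i^m\otimes x_i^{r_i-m})=a_i$ for $0<m<r_i$; and $\gamma_{ij}=\varepsilon\otimes\varepsilon$ except that $\gamma_{ij}(x_j^m\otimes x_i^m)=(m)!_q\,a_{ji}^m$ for $0\le m<r_i$, with $q=\chi_i(g_i)$ and $(m)!_q=\prod_{k=1}^m(1+q+\cdots+q^{k-1})$. (These maps exist and are unique.) Consider the graph with vertices $1,\dots,\theta$ and an edge between $i\neq j$ if $a_{ij}\neq 0$, and let $C_\tau$, $\tau\in T$, be its connected components. Put $$\alpha_\tau=\Big(\prod_{i<j;\ i,j\in C_\tau}\gamma_{ij}\Big)*\Big(\prod_{i\in C_\tau}\gamma_i\Big)$$ (so $\alpha_\tau=\gamma_i$ if $C_\tau=\{i\}$, and $\alpha_\tau=\gamma_{ij}*\gamma_i*\gamma_j$ if $C_\tau=\{i,j\}$ with $i<j$), and $\alpha=\prod_{\tau\in T}\alpha_\tau$; all products are convolution products, and the factors inside each $\prod$ may be taken in any order. Then $\alpha_\tau\in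 Z^2_H(A,K)$ for every $\tau$, $\alpha\in Z^2_H(A,K)$, and $A^{\alpha}\cong B$ as bialgebras. -/

import Mathlib

open scoped TensorProduct

noncomputable section

/-! ### Generalities on bialgebras: convolution, 2-cocycles, twists -/

/-- `A ⊗ A → K`, regarded as elements of the convolution algebra `Hom(A ⊗ A, K)`. -/
abbrev BiForm (K A : Type*) [Field K] [Ring A] [Bialgebra K A] : Type _ :=
  WithConv (A ⊗[K] A →ₗ[K] K)

/-- Normalized 2-cocycles `γ : A ⊗ A → K` of a bialgebra. -/
structure IsTwoCocycle {K A : Type*} [Field K] [Ring A] [Bialgebra K A]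
    (γ : BiForm K A) : Prop where
  /-- `γ` is invertible for the convolution product. -/
  isUnit : IsUnit γ
  /-- `γ(y₁ ⊗ z₁) γ(x ⊗ y₂ z₂) = γ(x₁ ⊗ y₁) γ(x₂ y₂ ⊗ z)`, where `Rx, Ry, Rz` are
  expressions of `Δ x`, `Δ y`, `Δ z` as finite sums of elementary tensors. -/
  cocycle : ∀ (x y z : A) (Rx : Coalgebra.Repr K x (A × A)) (Ry : Coalgebra.Repr K y (A × A))
    (Rz : Coalgebra.Repr K z (A × A)),
    ∑ j ∈ Ry.index, ∑ k ∈ Rz.index,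
        γ (Ry.left j ⊗ₜ Rz.left k) * γ (x ⊗ₜ (Ry.right j * Rz.right k)) =
      ∑ i ∈ Rx.index, ∑ j ∈ Ry.index,
        γ (Rx.left i ⊗ₜ Ry.left j) * γ ((Rx.right i * Ry.right j) ⊗ₜ z)
  right_one : ∀ x : A, γ (x ⊗ₜ 1) = Coalgebra.counit x
  one_left : ∀ x : A, γ (1 ⊗ₜ x) = Coalgebra.counit x

/-- `γ(ha ⊗ bh') = ε(h) ε(h') γ(a ⊗ b)`, where `H` acts on `A` through `f : H → A`. -/
def IsHBilinear {K A H : Type*} [Field K] [Ring A] [Bialgebra K A] [Ring H] [Bialgebra K H]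
    (f : H →ₐ[K] A) (γ : BiForm K A) : Prop :=
  ∀ (h h' : H) (a b : A), γ ((f h * a) ⊗ₜ (b * f h')) =
    Coalgebra.counit (R := K) h * Coalgebra.counit (R := K) h' * γ (a ⊗ₜ b)

/-- Membership in `Z²_H(A, K)`. -/
def IsHBilinearCocycle {K A H : Type*} [Field K] [Ring A] [Bialgebra K A] [Ring H]
    [Bialgebra K H] (f : H →ₐ[K] A) (γ : BiForm K A) : Prop :=
  IsTwoCocycle γ ∧ IsHBilinear f γ

/-- The multiplication `γ * m_A * γ⁻¹ : A ⊗ A → A` of the twist `A^γ` (convolution products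
in `Hom(A ⊗ A, A)`); it is only used for convolution invertible `γ`. -/
def twistMul {K A : Type*} [Field K] [Ring A] [Bialgebra K A] (γ : BiForm K A) :
    A ⊗[K] A →ₗ[K] A :=
  (WithConv.toConv (Algebra.linearMap K A ∘ₗ γ.ofConv) *
    WithConv.toConv (LinearMap.mul' K A) *
    WithConv.toConv (Algebra.linearMap K A ∘ₗ (Ring.inverse γ).ofConv)).ofConv

/-- `A^γ ≅ B` as bialgebras: `A^γ` is the coalgebra `A`, with the unit of `A` and the
multiplication `twistMul γ`. -/
def TwistIso {K A : Type*} [Field K] [Ring A] [Bialgebra K A] (γ : BiForm K A)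
    (B : Type*) [Ring B] [Bialgebra K B] : Prop :=
  ∃ φ : A ≃ₗc[K] B, φ 1 = 1 ∧ ∀ a b : A, φ (twistMul γ (a ⊗ₜ b)) = φ a * φ b

/-- `p` is the product, in some order, of the elements `f k`, `k ∈ s`, each taken once. -/
def IsProductOver {κ M : Type*} [Monoid M] (s : Set κ) (f : κ → M) (p : M) : Prop :=
  ∃ l : List κ, l.Nodup ∧ (∀ k, k ∈ l ↔ k ∈ s) ∧ p = (l.map f).prod

/-! ### `q`-numbers -/

/-- `(n)_q = 1 + q + ⋯ + q^(n-1)`. -/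
def qNum {K : Type*} [Field K] (q : K) (n : ℕ) : K := ∑ k ∈ Finset.range n, q ^ k

/-- `(n)!_q = (1)_q (2)_q ⋯ (n)_q`. -/
def qFact {K : Type*} [Field K] (q : K) (n : ℕ) : K := ∏ k ∈ Finset.range n, qNum q (k + 1)

/-- Gaussian binomial coefficients, by the `q`-Pascal rule. -/
def qChoose {K : Type*} [Field K] (q : K) : ℕ → ℕ → K
  | _, 0 => 1
  | 0, _ + 1 => 0
  | n + 1, k + 1 => qChoose q n k + q ^ (k + 1) * qChoose q n (k + 1)

theorem qChoose_eq_zero {K : Type*} [Field K] (q : K) (n : ℕ) :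
    ∀ k, n < k → qChoose q n k = 0 := by
  induction n with
  | zero => intro k hk; cases k with
    | zero => omega
    | succ k => simp [qChoose]
  | succ n ih => intro k hk; cases k with
    | zero => omega
    | succ k => simp [qChoose, ih k (by omega), ih (k + 1) (by omega)]

theorem qNum_add {K : Type*} [Field K] (q : K) (a b : ℕ) :
    qNum q (a + b) = qNum q a + q ^ a * qNum q b := by
  simp [qNum, Finset.sum_range_add, pow_add, Finset.mul_sum]

theorem qFact_succ {K : Type*} [Field K] (q : K) (n : ℕ) :
    qFact q (n + 1) = qFact q n * qNum q (n + 1) := by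
  simp [qFact, Finset.prod_range_succ]

theorem qFact_mul_qChoose {K : Type*} [Field K] (q : K) (n : ℕ) :
    ∀ k l, k + l = n → qFact q k * qFact q l * qChoose q n k = qFact q n := by
  induction n with
  | zero =>
    intro k l h
    obtain ⟨rfl, rfl⟩ : k = 0 ∧ l = 0 := by omega
    simp [qFact, qChoose]
  | succ n ih =>
    intro k l h
    cases k with
    | zero =>
      obtain rfl : l = n + 1 := by omega
      simp [qFact, qChoose]
    | succ k =>
      cases l with
      | zero =>
        obtain rfl : k = n := by omega
        have h1 := ih k 0 (by omega)
        have h2 : qFact q 0 = 1 := by simp [qFact]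
        rw [h2, mul_one] at h1 ⊢
        rw [qFact_succ, qChoose, qChoose_eq_zero q k (k + 1) (by omega)]
        linear_combination qNum q (k + 1) * h1
      | succ l =>
        have h1 := ih k (l + 1) (by omega)
        have h2 := ih (k + 1) l (by omega)
        have h3 : qNum q (n + 1) = qNum q (k + 1) + q ^ (k + 1) * qNum q (l + 1) := by
          rw [← qNum_add]; congr 1; omega
        rw [qFact_succ q n, h3, qChoose]
        rw [qFact_succ] at h1 h2 ⊢
        rw [qFact_succ q l]
        linear_combination qNum q (k + 1) * h1 + q ^ (k + 1) * qNum q (l + 1) * h2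

theorem q_binomial {K E : Type*} [Field K] [Ring E] [Algebra K E] (q : K) (u v : E)
    (h : v * u = q • (u * v)) (n : ℕ) :
    (u + v) ^ n = ∑ k ∈ Finset.range (n + 1), qChoose q n k • (u ^ k * v ^ (n - k)) := by
  have hk : ∀ k, v * u ^ k = q ^ k • (u ^ k * v) := by
    intro k
    induction k with
    | zero => simp
    | succ k ih =>
      rw [pow_succ, ← mul_assoc, ih, smul_mul_assoc, mul_assoc, h, mul_smul_comm, smul_smul,
        pow_succ, mul_assoc]
  induction n with
  | zero => simp [qChoose]
  | succ n ih =>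
    rw [pow_succ', ih, add_mul, Finset.mul_sum, Finset.mul_sum, Finset.sum_range_succ' _ (n + 1)]
    have e1 : ∀ k ∈ Finset.range (n + 1),
        u * qChoose q n k • (u ^ k * v ^ (n - k)) =
          qChoose q n k • (u ^ (k + 1) * v ^ (n + 1 - (k + 1))) := by
      intro k _
      rw [mul_smul_comm, ← mul_assoc, ← pow_succ', Nat.add_sub_add_right]
    have e2 : ∀ k ∈ Finset.range (n + 1),
        v * qChoose q n k • (u ^ k * v ^ (n - k)) =
          (q ^ k * qChoose q n k) • (u ^ k * v ^ (n + 1 - k)) := by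
      intro k hk'
      have hk'' : n + 1 - k = (n - k) + 1 := by
        have := Finset.mem_range.1 hk'
        omega
      rw [mul_smul_comm, ← mul_assoc, hk, smul_mul_assoc, smul_smul, mul_assoc, ← pow_succ',
        hk'', mul_comm (q ^ k)]
    rw [Finset.sum_congr rfl e1, Finset.sum_congr rfl e2]
    have e3 : ∑ k ∈ Finset.range (n + 1),
          (q ^ k * qChoose q n k) • (u ^ k * v ^ (n + 1 - k)) =
        ∑ k ∈ Finset.range (n + 1),
          (q ^ (k + 1) * qChoose q n (k + 1)) • (u ^ (k + 1) * v ^ (n + 1 - (k + 1)))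
          + qChoose q n 0 • v ^ (n + 1) := by
      have := Finset.sum_range_succ'
        (fun k => (q ^ k * qChoose q n k) • (u ^ k * v ^ (n + 1 - k))) (n + 1)
      rw [Finset.sum_range_succ, qChoose_eq_zero q n (n + 1) (by omega)] at this
      simpa using this
    rw [e3, ← add_assoc, ← Finset.sum_add_distrib]
    congr 1
    · refine Finset.sum_congr rfl fun k _ => ?_
      rw [← add_smul, qChoose]
    · simp [qChoose]

theorem add_pow_of_q_comm {K E : Type*} [Field K] [Ring E] [Algebra K E] {q : K} {r : ℕ}
    (hq : IsPrimitiveRoot q r) (hr : 1 < r) (u v : E) (h : v * u = q • (u * v)) :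
    (u + v) ^ r = u ^ r + v ^ r := by
  have hq1 : q ≠ 1 := hq.ne_one hr
  have hne : ∀ m, 0 < m → m < r → qNum q m ≠ 0 := by
    intro m h0 hm hz
    have := geom_sum_mul q m
    rw [show ∑ i ∈ Finset.range m, q ^ i = qNum q m from rfl, hz, zero_mul] at this
    exact hq.pow_ne_one_of_pos_of_lt h0.ne' hm (sub_eq_zero.1 this.symm)
  have hfne : ∀ m, m < r → qFact q m ≠ 0 := fun m hm =>
    Finset.prod_ne_zero_iff.2 fun k hk => hne _ (by omega) (by have := Finset.mem_range.1 hk; omega)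
  have hf0 : qFact q r = 0 := by
    obtain ⟨m, rfl⟩ : ∃ m, r = m + 1 := ⟨r - 1, by omega⟩
    rw [qFact_succ]
    have := geom_sum_mul q (m + 1)
    rw [hq.pow_eq_one, sub_self] at this
    rw [show qNum q (m + 1) = 0 from (mul_eq_zero.1 this).resolve_right (sub_ne_zero.2 hq1),
      mul_zero]
  have hc : ∀ k, 0 < k → k < r → qChoose q r k = 0 := by
    intro k h0 hk
    have := qFact_mul_qChoose q r k (r - k) (by omega)
    rw [hf0] at this
    exact (mul_eq_zero.1 this).resolve_left (mul_ne_zero (hfne _ hk) (hfne _ (by omega)))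
  have hrr : qChoose q r r = 1 := by
    have : ∀ n, qChoose q n n = 1 := by
      intro n
      induction n with
      | zero => simp [qChoose]
      | succ n ih => simp [qChoose, ih, qChoose_eq_zero q n (n + 1) (by omega)]
    exact this r
  have h0 : qChoose q r 0 = 1 := by simp [qChoose]
  rw [q_binomial q u v h, Finset.sum_range_succ, hrr]
  obtain ⟨m, rfl⟩ : ∃ m, r = m + 1 := ⟨r - 1, by omega⟩
  rw [Finset.sum_range_succ', h0, Finset.sum_eq_zero]
  · simp [add_comm]
  · intro k hk
    have := Finset.mem_range.1 hk
    rw [hc (k + 1) (by omega) (by omega), zero_smul]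

/-! ### Quantum linear spaces -/

/-- A quantum linear space `W = ⊕ K xᵢ`, `xᵢ ∈ W_{gᵢ}^{χᵢ}`, in the category of Yetter–Drinfeld
modules over `K[Γ]`. -/
structure QuantumLinearSpace (K Γ : Type*) [Field K] [CommGroup Γ] (θ : ℕ) where
  g : Fin θ → Γ
  χ : Fin θ → (Γ →* Kˣ)
  r : Fin θ → ℕ
  one_lt_r : ∀ i, 1 < r i
  qls_one : ∀ i j, i ≠ j → χ i (g j) * χ j (g i) = 1
  qls_two : ∀ i, IsPrimitiveRoot (χ i (g i) : K) (r i)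

namespace QuantumLinearSpace

variable {K Γ : Type*} [Field K] [CommGroup Γ] {θ : ℕ} (W : QuantumLinearSpace K Γ θ)

/-- The relations of `T(W) # K[Γ]`: those of the group `Γ`, and `h xᵢ = χᵢ(h) xᵢ h`. -/
inductive TensorRel : FreeAlgebra K (Γ ⊕ Fin θ) → FreeAlgebra K (Γ ⊕ Fin θ) → Prop
  | one : TensorRel (FreeAlgebra.ι K (Sum.inl 1)) 1
  | mul (h k : Γ) : TensorRel (FreeAlgebra.ι K (Sum.inl (h * k)))
      (FreeAlgebra.ι K (Sum.inl h) * FreeAlgebra.ι K (Sum.inl k))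
  | cross (h : Γ) (i : Fin θ) :
      TensorRel (FreeAlgebra.ι K (Sum.inl h) * FreeAlgebra.ι K (Sum.inr i))
        ((W.χ i h : K) • (FreeAlgebra.ι K (Sum.inr i) * FreeAlgebra.ι K (Sum.inl h)))

/-- The biproduct `T(W) # K[Γ]` of the tensor algebra of `W` with `K[Γ]`. -/
def TensorBos : Type _ := RingQuot W.TensorRel

instance : Ring W.TensorBos := inferInstanceAs (Ring (RingQuot W.TensorRel))

instance : Algebra K W.TensorBos := inferInstanceAs (Algebra K (RingQuot W.TensorRel))

/-- The projection from the free algebra on `Γ` and the `xᵢ`. -/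
def tensorMk : FreeAlgebra K (Γ ⊕ Fin θ) →ₐ[K] W.TensorBos := RingQuot.mkAlgHom K W.TensorRel

/-- The element `h ∈ Γ` of `T(W) # K[Γ]`. -/
def tensorGrp (h : Γ) : W.TensorBos := W.tensorMk (FreeAlgebra.ι K (Sum.inl h))

/-- The element `xᵢ` of `T(W) # K[Γ]`. -/
def tensorX (i : Fin θ) : W.TensorBos := W.tensorMk (FreeAlgebra.ι K (Sum.inr i))

theorem tensorGrp_one : W.tensorGrp 1 = 1 := by
  rw [tensorGrp, ← map_one W.tensorMk]
  exact RingQuot.mkAlgHom_rel K TensorRel.one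

theorem tensorGrp_mul (h k : Γ) : W.tensorGrp (h * k) = W.tensorGrp h * W.tensorGrp k := by
  rw [tensorGrp, tensorGrp, tensorGrp, ← map_mul W.tensorMk]
  exact RingQuot.mkAlgHom_rel K (TensorRel.mul h k)

theorem tensorGrp_mul_X (h : Γ) (i : Fin θ) :
    W.tensorGrp h * W.tensorX i = (W.χ i h : K) • (W.tensorX i * W.tensorGrp h) := by
  rw [tensorGrp, tensorX, ← map_mul W.tensorMk, ← map_mul W.tensorMk, ← map_smul W.tensorMk]
  exact RingQuot.mkAlgHom_rel K (TensorRel.cross h i)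

/-- The universal property of `T(W) # K[Γ]`. -/
def tensorLift {E : Type*} [Ring E] [Algebra K E] (G : Γ → E) (X : Fin θ → E)
    (h1 : G 1 = 1) (hm : ∀ h k, G (h * k) = G h * G k)
    (hx : ∀ h i, G h * X i = (W.χ i h : K) • (X i * G h)) : W.TensorBos →ₐ[K] E :=
  RingQuot.liftAlgHom K ⟨FreeAlgebra.lift K (Sum.elim G X), by
    intro a b hab
    cases hab with
    | one => simpa using h1
    | mul h k => simpa using hm h k
    | cross h i => simpa using hx h i⟩

theorem tensorLift_grp {E : Type*} [Ring E] [Algebra K E] (G : Γ → E) (X : Fin θ → E)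
    (h1 : G 1 = 1) (hm : ∀ h k, G (h * k) = G h * G k)
    (hx : ∀ h i, G h * X i = (W.χ i h : K) • (X i * G h)) (h : Γ) :
    W.tensorLift G X h1 hm hx (W.tensorGrp h) = G h := by
  simp only [tensorLift, tensorGrp, tensorMk]
  erw [RingQuot.liftAlgHom_mkAlgHom_apply]
  simp

theorem tensorLift_X {E : Type*} [Ring E] [Algebra K E] (G : Γ → E) (X : Fin θ → E)
    (h1 : G 1 = 1) (hm : ∀ h k, G (h * k) = G h * G k)
    (hx : ∀ h i, G h * X i = (W.χ i h : K) • (X i * G h)) (i : Fin θ) :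
    W.tensorLift G X h1 hm hx (W.tensorX i) = X i := by
  simp only [tensorLift, tensorX, tensorMk]
  erw [RingQuot.liftAlgHom_mkAlgHom_apply]
  simp

theorem tensorBos_ext {E : Type*} [Ring E] [Algebra K E] {f f' : W.TensorBos →ₐ[K] E}
    (hg : ∀ h, f (W.tensorGrp h) = f' (W.tensorGrp h))
    (hx : ∀ i, f (W.tensorX i) = f' (W.tensorX i)) : f = f' := by
  refine RingQuot.ringQuot_ext' (S := K) (s := W.TensorRel) f f' ?_
  refine FreeAlgebra.hom_ext (funext fun s => ?_)
  cases s with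
  | inl h => exact hg h
  | inr i => exact hx i

/-- `Δ(h) = h ⊗ h` for `h ∈ Γ`, and `Δ(xᵢ) = xᵢ ⊗ 1 + gᵢ ⊗ xᵢ`. -/
def tensorComul : W.TensorBos →ₐ[K] W.TensorBos ⊗[K] W.TensorBos :=
  W.tensorLift (fun h => W.tensorGrp h ⊗ₜ W.tensorGrp h)
    (fun i => W.tensorX i ⊗ₜ 1 + W.tensorGrp (W.g i) ⊗ₜ W.tensorX i)
    (by rw [tensorGrp_one, Algebra.TensorProduct.one_def])
    (fun h k => by rw [tensorGrp_mul, Algebra.TensorProduct.tmul_mul_tmul])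
    (fun h i => by
      simp only [mul_add, add_mul, Algebra.TensorProduct.tmul_mul_tmul, mul_one, one_mul,
        tensorGrp_mul_X, smul_add, TensorProduct.smul_tmul', TensorProduct.tmul_smul]
      rw [← tensorGrp_mul, ← tensorGrp_mul, mul_comm h])

/-- `ε(h) = 1` for `h ∈ Γ`, and `ε(xᵢ) = 0`. -/
def tensorCounit : W.TensorBos →ₐ[K] K :=
  W.tensorLift (fun _ => 1) (fun _ => 0) rfl (by simp) (by simp)

theorem tensorComul_grp (h : Γ) :
    W.tensorComul (W.tensorGrp h) = W.tensorGrp h ⊗ₜ W.tensorGrp h :=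
  W.tensorLift_grp _ _ _ _ _ h

theorem tensorComul_X (i : Fin θ) :
    W.tensorComul (W.tensorX i) =
      W.tensorX i ⊗ₜ 1 + W.tensorGrp (W.g i) ⊗ₜ W.tensorX i :=
  W.tensorLift_X _ _ _ _ _ i

theorem tensorCounit_grp (h : Γ) : W.tensorCounit (W.tensorGrp h) = 1 :=
  W.tensorLift_grp _ _ _ _ _ h

theorem tensorCounit_X (i : Fin θ) : W.tensorCounit (W.tensorX i) = 0 :=
  W.tensorLift_X _ _ _ _ _ i

instance : Bialgebra K W.TensorBos :=
  Bialgebra.ofAlgHom W.tensorComul W.tensorCounit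
    (by
      apply W.tensorBos_ext
      · intro h
        simp [tensorComul_grp]
      · intro i
        simp [tensorComul_X, tensorComul_grp, TensorProduct.add_tmul, TensorProduct.tmul_add,
          Algebra.TensorProduct.one_def, add_assoc])
    (by
      apply W.tensorBos_ext
      · intro h
        simp [tensorComul_grp, tensorCounit_grp]
      · intro i
        simp [tensorComul_X, tensorCounit_grp, tensorCounit_X])
    (by
      apply W.tensorBos_ext
      · intro h
        simp [tensorComul_grp, tensorCounit_grp]
      · intro i
        simp [tensorComul_X, tensorCounit_X])

/-! ### The Radford biproduct `B(W) # K[Γ]` of the Nichols algebra -/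

/-- The part `⊕_{n ≥ 2} Wⁿ # K[Γ]` of `T(W) # K[Γ]`. -/
def degGeTwo : Submodule K W.TensorBos :=
  Submodule.span K {t | ∃ (a b c : W.TensorBos) (i j : Fin θ),
    t = a * W.tensorX i * b * W.tensorX j * c}

/-- The biideals of `T(W) # K[Γ]` that lie in degrees at least two. -/
def nicholsBiideals : Set (Ideal W.TensorBos) :=
  {I | I.IsTwoSided ∧ (I.restrictScalars K).IsCoideal ∧ I.restrictScalars K ≤ W.degGeTwo}

/-- The largest biideal of `T(W) # K[Γ]` that lies in degrees at least two. The Nichols algebra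
`B(W)` is the quotient of `T(W)` by its largest ideal and (braided) coideal in degrees at least
two, and `B(W) # K[Γ]` is the quotient of `T(W) # K[Γ]` by the present ideal. -/
def nicholsIdeal : Ideal W.TensorBos := ⨆ I : W.nicholsBiideals, I.1

instance : W.nicholsIdeal.IsTwoSided := by
  refine ⟨fun {a} b ha => ?_⟩
  refine Submodule.iSup_induction (fun I : W.nicholsBiideals => I.1)
    (motive := fun x => x * b ∈ W.nicholsIdeal) ha ?_ ?_ ?_
  · rintro ⟨I, hI⟩ x hx
    have := hI.1
    exact (le_iSup (fun I : W.nicholsBiideals => I.1) ⟨I, hI⟩ : I ≤ W.nicholsIdeal)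
      (I.mul_mem_right b hx)
  · simp
  · intro x y hx hy
    rw [add_mul]
    exact add_mem hx hy

instance : (W.nicholsIdeal.restrictScalars K).IsCoideal := by
  constructor
  · intro x hx
    refine Submodule.iSup_induction (fun I : W.nicholsBiideals => I.1)
      (motive := fun x => Coalgebra.counit (R := K) x = 0) hx ?_ ?_ ?_
    · rintro ⟨I, hI⟩ y hy
      exact hI.2.1.counit_eq_zero hy
    · simp
    · intro y z hy hz
      rw [map_add, hy, hz, add_zero]
  · intro x hx
    refine Submodule.iSup_induction (fun I : W.nicholsBiideals => I.1)
      (motive := fun x => TensorProduct.map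
      (W.nicholsIdeal.restrictScalars K).mkQ (W.nicholsIdeal.restrictScalars K).mkQ
        (Coalgebra.comul x) = 0) hx ?_ ?_ ?_
    · rintro ⟨I, hI⟩ y hy
      have hle : I ≤ W.nicholsIdeal :=
        le_iSup (fun I : W.nicholsBiideals => I.1) ⟨I, hI⟩
      have hle' : I.restrictScalars K ≤ (W.nicholsIdeal.restrictScalars K) := hle
      have h0 := hI.2.1.map_mkQ_comul_eq_zero hy
      have hf : (W.nicholsIdeal.restrictScalars K).mkQ =
          Submodule.factor hle' ∘ₗ (I.restrictScalars K).mkQ := by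
        ext; rfl
      rw [hf, TensorProduct.map_comp, LinearMap.comp_apply, h0, map_zero]
    · simp
    · intro y z hy hz
      rw [map_add, map_add, hy, hz, add_zero]

/-- `A = B(W) # K[Γ]`. -/
abbrev Biproduct : Type _ := W.TensorBos ⧸ W.nicholsIdeal

/-- The generator `xᵢ` of `A`. -/
def x (i : Fin θ) : W.Biproduct := Ideal.Quotient.mk _ (W.tensorX i)

/-- The inclusion of `H = K[Γ]` in `A`. -/
def incl : MonoidAlgebra K Γ →ₐ[K] W.Biproduct :=
  MonoidAlgebra.lift K W.Biproduct Γ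
    { toFun := fun h => Ideal.Quotient.mk _ (W.tensorGrp h)
      map_one' := by rw [tensorGrp_one, map_one]
      map_mul' := fun h k => by rw [tensorGrp_mul, map_mul] }

/-- The monomial `x₁^{n₁} ⋯ x_θ^{n_θ}` of `A`. -/
def mono (n : Fin θ → ℕ) : W.Biproduct := (List.ofFn fun i => W.x i ^ n i).prod

/-! ### Liftings -/

/-- The scalars `aᵢ` and `a_{ij}` (`i ≠ j`; the entries `a_{ii}` are not used) of a lifting of
`B(W) # K[Γ]`. -/
structure LiftingScalars where
  a : Fin θ → K
  aa : Fin θ → Fin θ → K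
  aa_swap : ∀ i j, i ≠ j → aa j i = -(W.χ i (W.g j) : K) * aa i j
  of_a_ne_zero : ∀ i, a i ≠ 0 → W.g i ^ W.r i ≠ 1 ∧ W.χ i ^ W.r i = 1
  of_aa_ne_zero : ∀ i j, i ≠ j → aa i j ≠ 0 → W.g i * W.g j ≠ 1 ∧ W.χ i * W.χ j = 1

namespace LiftingScalars

variable {W} (L : W.LiftingScalars)

/-- The defining relations of the lifting, written as elements of `T(W) # K[Γ]`:
`xᵢ^{rᵢ} - aᵢ (1 - gᵢ^{rᵢ})` and `xᵢ xⱼ - χⱼ(gᵢ) xⱼ xᵢ - a_{ij} (1 - gᵢ gⱼ)` for `i ≠ j`. -/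
def relators : Set W.TensorBos :=
  {t | (∃ i, t = W.tensorX i ^ W.r i - L.a i • (1 - W.tensorGrp (W.g i ^ W.r i))) ∨
    ∃ i j, i ≠ j ∧ t = W.tensorX i * W.tensorX j
      - (W.χ j (W.g i) : K) • (W.tensorX j * W.tensorX i)
      - L.aa i j • (1 - W.tensorGrp (W.g i * W.g j))}

/-- The two-sided ideal generated by the defining relations of the lifting. -/
def ideal : Ideal W.TensorBos := (TwoSidedIdeal.span L.relators).asIdeal

instance : L.ideal.IsTwoSided := inferInstanceAs (TwoSidedIdeal.asIdeal _).IsTwoSided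

theorem relators_subset : L.relators ⊆ L.ideal := fun _ ht =>
  TwoSidedIdeal.mem_asIdeal.2 (TwoSidedIdeal.subset_span ht)

theorem map_eq_zero {E : Type*} [Ring E] [Algebra K E] (f : W.TensorBos →ₐ[K] E)
    (hf : ∀ t ∈ L.relators, f t = 0) {t : W.TensorBos} (ht : t ∈ L.ideal) : f t = 0 := by
  have h : TwoSidedIdeal.span L.relators ≤ TwoSidedIdeal.ker f :=
    TwoSidedIdeal.span_le.2 fun _ ht => (TwoSidedIdeal.mem_ker f).2 (hf _ ht)
  exact (TwoSidedIdeal.mem_ker f).1 (h (TwoSidedIdeal.mem_asIdeal.1 ht))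

theorem grp_pow (h : Γ) (n : ℕ) : W.tensorGrp (h ^ n) = W.tensorGrp h ^ n := by
  induction n with
  | zero => simp [tensorGrp_one]
  | succ n ih => rw [pow_succ, tensorGrp_mul, ih, pow_succ]

theorem comul_relator {t : W.TensorBos} (ht : t ∈ L.relators) :
    ∃ h : W.TensorBos, W.tensorComul t = t ⊗ₜ 1 + h ⊗ₜ t := by
  rcases ht with ⟨i, rfl⟩ | ⟨i, j, hij, rfl⟩
  · refine ⟨W.tensorGrp (W.g i ^ W.r i), ?_⟩
    have hpow := add_pow_of_q_comm (W.qls_two i) (W.one_lt_r i)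
      (W.tensorX i ⊗ₜ[K] (1 : W.TensorBos)) (W.tensorGrp (W.g i) ⊗ₜ[K] W.tensorX i) (by
        rw [Algebra.TensorProduct.tmul_mul_tmul, Algebra.TensorProduct.tmul_mul_tmul,
          tensorGrp_mul_X, mul_one, one_mul, TensorProduct.smul_tmul'])
    rw [map_sub, map_pow, tensorComul_X, hpow, Algebra.TensorProduct.tmul_pow,
      Algebra.TensorProduct.tmul_pow, one_pow, map_smul, map_sub, map_one, tensorComul_grp,
      ← grp_pow, Algebra.TensorProduct.one_def]
    simp only [TensorProduct.sub_tmul, TensorProduct.tmul_sub, TensorProduct.tmul_smul,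
      ← TensorProduct.smul_tmul', smul_sub]
    abel
  · refine ⟨W.tensorGrp (W.g i * W.g j), ?_⟩
    have hc : (W.χ j (W.g i) : K) * (W.χ i (W.g j) : K) = 1 := by
      have := congrArg (Units.val) (W.qls_one i j hij)
      rw [mul_comm]
      simpa using this
    simp only [map_sub, map_mul, map_smul, map_one, tensorComul_X, tensorComul_grp, mul_add,
      add_mul, Algebra.TensorProduct.tmul_mul_tmul, mul_one, one_mul, tensorGrp_mul_X,
      TensorProduct.sub_tmul, TensorProduct.tmul_sub, TensorProduct.tmul_smul,
      ← TensorProduct.smul_tmul', smul_sub, smul_add, smul_smul, hc, one_smul,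
      Algebra.TensorProduct.one_def]
    rw [← tensorGrp_mul, ← tensorGrp_mul, mul_comm (W.g j)]
    abel

instance : (L.ideal.restrictScalars K).IsCoideal := by
  constructor
  · intro t ht
    refine L.map_eq_zero W.tensorCounit ?_ ht
    rintro t (⟨i, rfl⟩ | ⟨i, j, hij, rfl⟩)
    · have := W.one_lt_r i
      simp [tensorCounit_X, tensorCounit_grp, show W.r i ≠ 0 by omega]
    · simp [tensorCounit_X, tensorCounit_grp]
  · intro t ht
    refine L.map_eq_zero ((Algebra.TensorProduct.map (Ideal.Quotient.mkₐ K L.ideal)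
      (Ideal.Quotient.mkₐ K L.ideal)).comp W.tensorComul) ?_ ht
    intro t ht
    obtain ⟨h, hh⟩ := L.comul_relator ht
    have h0 : Ideal.Quotient.mkₐ K L.ideal t = 0 :=
      Ideal.Quotient.eq_zero_iff_mem.2 (L.relators_subset ht)
    rw [AlgHom.comp_apply, hh, map_add, Algebra.TensorProduct.map_tmul,
      Algebra.TensorProduct.map_tmul, h0, TensorProduct.zero_tmul, TensorProduct.tmul_zero,
      add_zero]

/-- The lifting `B = A(aᵢ, a_{ij})` of `B(W) # K[Γ]`: the bialgebra generated by the grouplikes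
`h ∈ Γ` and by `(1, gᵢ)`-primitive elements `xᵢ`, with the relations
`h xᵢ = χᵢ(h) xᵢ h`, `xᵢ^{rᵢ} = aᵢ (1 - gᵢ^{rᵢ})`, `xᵢ xⱼ = χⱼ(gᵢ) xⱼ xᵢ + a_{ij} (1 - gᵢ gⱼ)`. -/
abbrev Lifting : Type _ := W.TensorBos ⧸ L.ideal

/-- The graph on `{1, …, θ}` with an edge between `i ≠ j` if `a_{ij} ≠ 0`
(equivalently, `a_{ji} ≠ 0`). -/
def graph : SimpleGraph (Fin θ) := SimpleGraph.fromRel fun i j => L.aa i j ≠ 0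

/-- `γ = γᵢ`: the `H`-bilinear map with `γ(xᵢ^m ⊗ xᵢ^{rᵢ-m}) = aᵢ` for `0 < m < rᵢ`, equal to
`ε` on all the other pairs of monomials. -/
structure IsGamma (i : Fin θ) (γ : BiForm K W.Biproduct) : Prop where
  bilinear : IsHBilinear W.incl γ
  apply_pow : ∀ m, 0 < m → m < W.r i → γ ((W.x i ^ m) ⊗ₜ (W.x i ^ (W.r i - m))) = L.a i
  apply_mono : ∀ n n' : Fin θ → ℕ, (∀ k, n k < W.r k) → (∀ k, n' k < W.r k) →
    (¬ ∃ m, 0 < m ∧ m < W.r i ∧ n = Pi.single i m ∧ n' = Pi.single i (W.r i - m)) →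
    γ (W.mono n ⊗ₜ W.mono n') =
      Coalgebra.counit (R := K) (W.mono n) * Coalgebra.counit (R := K) (W.mono n')

/-- `γ = γ_{ij}`, for `i < j`: the `H`-bilinear map with
`γ(xⱼ^m ⊗ xᵢ^m) = (m)!_q a_{ji}^m` for `0 ≤ m < rᵢ`, where `q = χᵢ(gᵢ)`, equal to `ε` on all the
other pairs of monomials. -/
structure IsGammaPair (i j : Fin θ) (γ : BiForm K W.Biproduct) : Prop where
  bilinear : IsHBilinear W.incl γ
  apply_pow : ∀ m, m < W.r i →
    γ ((W.x j ^ m) ⊗ₜ (W.x i ^ m)) = qFact (W.χ i (W.g i) : K) m * L.aa j i ^ m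
  apply_mono : ∀ n n' : Fin θ → ℕ, (∀ k, n k < W.r k) → (∀ k, n' k < W.r k) →
    (¬ ∃ m, m < W.r i ∧ n = Pi.single j m ∧ n' = Pi.single i m) →
    γ (W.mono n ⊗ₜ W.mono n') =
      Coalgebra.counit (R := K) (W.mono n) * Coalgebra.counit (R := K) (W.mono n')

/-- `α` is the product `(∏_{i<j} γ_{ij}) * (∏_i γᵢ)` for the connected component `τ`, where `i`
and `j` run over `τ`. For `τ = {i}` this is `γᵢ`, for `τ = {i, j}` with `i < j` it is
`γ_{ij} * γᵢ * γⱼ` (up to the order of the last two factors). -/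
def IsComponentProduct (γ : Fin θ → BiForm K W.Biproduct)
    (γγ : Fin θ → Fin θ → BiForm K W.Biproduct) (τ : L.graph.ConnectedComponent)
    (α : BiForm K W.Biproduct) : Prop :=
  ∃ p p' : BiForm K W.Biproduct,
    IsProductOver {ij : Fin θ × Fin θ | ij.1 < ij.2 ∧ ij.1 ∈ τ.supp ∧ ij.2 ∈ τ.supp}
      (fun ij => γγ ij.1 ij.2) p ∧
    IsProductOver τ.supp γ p' ∧ α = p * p'

end LiftingScalars

end QuantumLinearSpace

end

/-! Write `A` for the biproduct. The product `α` turns out to be the 2-cocycle of an explicit Galois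
object of `A`.

Replace the factors `1 - gᵢ^{rᵢ}` and `1 - gᵢ gⱼ` in the relations of the lifting by `1`. The
algebra with `xᵢ^{rᵢ} = aᵢ` and `xᵢ xⱼ = χⱼ(gᵢ) xⱼ xᵢ + a_{ij}` acts on `A`: `x_k` acts by `genOp
k`, which is left multiplication by `x_k` plus lowering terms built from skew derivations `∂ᵢ`, `i ≤
k`. The constants in the relations come from the `q`-Weyl relation `∂ᵢ xᵢ = 1 + q xᵢ ∂ᵢ`
(`genOp_mul_genOp`, `genOp_pow_r`). In an ordered monomial the lowering terms contribute nothing, so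
evaluation at `1` sends ordered monomials to themselves (`listMono_genOp_apply`). This transports
the product of the Galois object to a second associative product `∘` on `A` (`circ`). By colinearity
`a ∘ b = σ(a₁, b₁) a₂ b₂` with `σ(a, b) = ε(a ∘ b)` (`circ_repr`), and associativity of `∘` is the
cocycle identity for `σ`.

The cocycle `σ` factors one scalar at a time. Adding a scalar changes a single `genOp j`, and the
`q`-binomial formula (for `a_{ji}`) or the expansion `add_smul_qDividedPow_pow` (for `aᵢ`) shows
that `σ` is multiplied on the left by `γ_{ij}` or `γᵢ` (`sigma_eq_gammaPairForm_mul`,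
`sigma_eq_gammaForm_mul`). For `γᵢ` the vertex `i` must not be linked yet, so within a component the
`γᵢ` stand to the right of the `γ_{ij}`; no other order matters. Starting from zero scalars, where
`σ = 1`, one gets that `α_τ` is the `σ` of the scalars of `τ` and that `α` is the `σ` of all
scalars. Each factor is `1` plus a nilpotent form, which gives invertibility.

For the isomorphism with the lifting `B`, the map `ρ(t) 1 ↦ [t₁] ε(ρ(t₂) 1)` is well defined because
`t ↦ [t₁] ⊗ ρ(t₂)` again satisfies the Galois relations. It is a coalgebra map, multiplicative for
the twist, and onto since its image contains the generators. Injectivity needs no basis of `B`: the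
opposite Galois object gives a functional on `A` whose hit operator kills the kernel, is the
identity on `K[Γ]` and commutes with all `∂ᵢ`; a `∂`-stable subspace meeting `K[Γ]` trivially is
zero (`eq_bot_of_der_stable`). -/

open scoped TensorProduct

noncomputable section

/-! ### Right colinear operators and convolution on `A ⊗ A` -/

section Colinear

open Coalgebra

variable {K A E : Type*} [Field K] [Ring A] [Bialgebra K A] [Ring E] [Algebra K E]

/-- The right colinear operator `a ↦ f(a₁) a₂` attached to a functional `f`. -/
def leftHit (f : A →ₗ[K] K) : Module.End K A :=
  (TensorProduct.lid K A).toLinearMap ∘ₗ f.rTensor A ∘ₗ comul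

theorem leftHit_repr (f : A →ₗ[K] K) {ι : Type*} {a : A} (R : Repr K a ι) :
    leftHit f a = ∑ i ∈ R.index, f (R.left i) • R.right i := by
  simp [leftHit, ← R.eq]

/-- Coassociativity: both sides send `a` to `f(a₁) a₂ ⊗ a₃`. -/
theorem comul_comp_leftHit (f : A →ₗ[K] K) :
    comul ∘ₗ leftHit f = (leftHit f).rTensor A ∘ₗ comul := by
  have h1 : comul (R := K) ∘ₗ leftHit f =
      ((TensorProduct.lid K (A ⊗[K] A)).toLinearMap ∘ₗ f.rTensor (A ⊗[K] A)) ∘ₗ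
        (comul (R := K) (A := A)).lTensor A ∘ₗ comul := by
    have : comul (R := K) ∘ₗ (TensorProduct.lid K A).toLinearMap ∘ₗ f.rTensor A =
        ((TensorProduct.lid K (A ⊗[K] A)).toLinearMap ∘ₗ f.rTensor (A ⊗[K] A)) ∘ₗ
        (comul (R := K) (A := A)).lTensor A := by
      ext a b
      simp
    exact congrArg (· ∘ₗ comul (R := K)) this
  rw [h1, ← coassoc, ← LinearMap.comp_assoc, ← LinearMap.comp_assoc]
  congr 1
  rw [leftHit, LinearMap.rTensor_comp, LinearMap.rTensor_comp, ← LinearMap.comp_assoc]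
  congr 1
  ext a b c
  simp [TensorProduct.smul_tmul']

/-- The convolution product of maps on `A ⊗ A`, evaluated at `a ⊗ b`. -/
theorem convMul_tmul {a b : A} {ι κ : Type*} (Ra : Repr K a ι) (Rb : Repr K b κ)
    (γ τ : WithConv (A ⊗[K] A →ₗ[K] E)) :
    (γ * τ) (a ⊗ₜ b) = ∑ i ∈ Ra.index, ∑ j ∈ Rb.index,
      γ (Ra.left i ⊗ₜ Rb.left j) * τ (Ra.right i ⊗ₜ Rb.right j) := by
  rw [LinearMap.convMul_apply, TensorProduct.comul_tmul, ← Ra.eq, ← Rb.eq]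
  simp only [TensorProduct.sum_tmul, TensorProduct.tmul_sum, map_sum]
  rw [Finset.sum_comm]
  simp

theorem BiForm.ext {γ τ : BiForm K A} (h : ∀ a b : A, γ (a ⊗ₜ b) = τ (a ⊗ₜ b)) : γ = τ := by
  apply WithConv.ofConv_injective
  exact TensorProduct.ext' h

theorem BiForm.one_tmul (a b : A) :
    (1 : BiForm K A) (a ⊗ₜ b) = counit (R := K) a * counit (R := K) b := by
  simp [mul_comm]

/-- The form `a ⊗ b ↦ f(a) ε(b)`. -/
def leftForm (f : A →ₗ[K] K) : BiForm K A :=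
  WithConv.toConv (LinearMap.mul' K K ∘ₗ TensorProduct.map f counit)

/-- The form `a ⊗ b ↦ ε(a) f(b)`. -/
def rightForm (f : A →ₗ[K] K) : BiForm K A :=
  WithConv.toConv (LinearMap.mul' K K ∘ₗ TensorProduct.map counit f)

/-- A form that sees only one tensor factacts by precomposition with the hit operator on that
factor. This turns convolution products into products of operators. -/
theorem leftForm_mul (f : A →ₗ[K] K) (τ : BiForm K A) (a b : A) :
    (leftForm f * τ) (a ⊗ₜ b) = τ (leftHit f a ⊗ₜ b) := by
  rw [convMul_tmul (ℛ K a) (ℛ K b), leftHit_repr f (ℛ K a)]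
  have hb := sum_counit_smul (ℛ K b)
  conv_rhs => rw [← hb]
  simp [TensorProduct.sum_tmul, TensorProduct.tmul_sum, leftForm, ← TensorProduct.smul_tmul',
    mul_assoc, TensorProduct.tmul_smul, Finset.mul_sum]
  rw [Finset.sum_comm]
  simp only [mul_left_comm]

theorem rightForm_mul (f : A →ₗ[K] K) (τ : BiForm K A) (a b : A) :
    (rightForm f * τ) (a ⊗ₜ b) = τ (a ⊗ₜ leftHit f b) := by
  rw [convMul_tmul (ℛ K a) (ℛ K b), leftHit_repr f (ℛ K b)]
  have ha := sum_counit_smul (ℛ K a)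
  conv_rhs => rw [← ha]
  simp [TensorProduct.sum_tmul, TensorProduct.tmul_sum, rightForm, ← TensorProduct.smul_tmul',
    mul_assoc, TensorProduct.tmul_smul, Finset.mul_sum]
  rw [Finset.sum_comm]
  simp only [mul_left_comm]

theorem leftForm_pow_mul (f : A →ₗ[K] K) (m : ℕ) (τ : BiForm K A) (a b : A) :
    (leftForm f ^ m * τ) (a ⊗ₜ b) = τ ((leftHit f ^ m) a ⊗ₜ b) := by
  induction m generalizing a with
  | zero => simp
  | succ m ih => rw [pow_succ', mul_assoc, leftForm_mul, ih, pow_succ, Module.End.mul_apply]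

theorem rightForm_pow_mul (f : A →ₗ[K] K) (m : ℕ) (τ : BiForm K A) (a b : A) :
    (rightForm f ^ m * τ) (a ⊗ₜ b) = τ (a ⊗ₜ (leftHit f ^ m) b) := by
  induction m generalizing b with
  | zero => simp
  | succ m ih => rw [pow_succ', mul_assoc, rightForm_mul, ih, pow_succ, Module.End.mul_apply]

theorem commute_leftForm_rightForm (f f' : A →ₗ[K] K) :
    Commute (leftForm f) (rightForm f') := by
  refine BiForm.ext fun a b => ?_
  rw [leftForm_mul, ← mul_one (rightForm f'), rightForm_mul, mul_one,
    ← mul_one (rightForm f' * leftForm f), mul_assoc, rightForm_mul, leftForm_mul]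

theorem isNilpotent_leftForm {f : A →ₗ[K] K} {m : ℕ} (h : leftHit f ^ m = 0) :
    IsNilpotent (leftForm f) := by
  refine ⟨m, BiForm.ext fun a b => ?_⟩
  rw [← mul_one (leftForm f ^ m), leftForm_pow_mul, h]
  simp

end Colinear

namespace QuantumLinearSpace

open Coalgebra

variable {K Γ : Type*} [Field K] [CommGroup Γ] {θ : ℕ} (W : QuantumLinearSpace K Γ θ)

/-! ### Induction on `T(W) # K[Γ]` and its quotients -/

/-- The algebra is generated by `Γ` and the `xᵢ`. Identities are checked along left multiplication
by generators, where hit operators obey simple Leibniz rules. -/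
theorem tensorBos_left_induction (p : Submodule K W.TensorBos) (h1 : 1 ∈ p)
    (hg : ∀ h, ∀ t ∈ p, W.tensorGrp h * t ∈ p) (hx : ∀ i, ∀ t ∈ p, W.tensorX i * t ∈ p)
    (t : W.TensorBos) : t ∈ p := by
  have key : ∀ s : FreeAlgebra K (Γ ⊕ Fin θ), ∀ u ∈ p, W.tensorMk s * u ∈ p := by
    intro s
    induction s using FreeAlgebra.induction with
    | grade0 c =>
      intro u hu
      rw [AlgHom.commutes, ← Algebra.smul_def]
      exact p.smul_mem c hu
    | grade1 s =>
      intro u hu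
      cases s with
      | inl h => exact hg h u hu
      | inr i => exact hx i u hu
    | mul a b ha hb =>
      intro u hu
      rw [map_mul, mul_assoc]
      exact ha _ (hb _ hu)
    | add a b ha hb =>
      intro u hu
      rw [map_add, add_mul]
      exact add_mem (ha _ hu) (hb _ hu)
  obtain ⟨s, rfl⟩ : ∃ s, W.tensorMk s = t := RingQuot.mkAlgHom_surjective K W.TensorRel t
  simpa using key s 1 h1

/-- The projection of `T(W) # K[Γ]` onto `B(W) # K[Γ]`. -/
def proj : W.TensorBos →ₐ[K] W.Biproduct := Ideal.Quotient.mkₐ K W.nicholsIdeal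

/-- The element `h ∈ Γ` of `B(W) # K[Γ]`. -/
def grp (h : Γ) : W.Biproduct := W.proj (W.tensorGrp h)

theorem proj_surjective : Function.Surjective W.proj := Ideal.Quotient.mk_surjective

theorem proj_grp (h : Γ) : W.proj (W.tensorGrp h) = W.grp h := rfl

theorem proj_X (i : Fin θ) : W.proj (W.tensorX i) = W.x i := rfl

theorem grp_one : W.grp 1 = 1 := by rw [grp, tensorGrp_one, map_one]

theorem grp_mul (h k : Γ) : W.grp (h * k) = W.grp h * W.grp k := by
  rw [grp, tensorGrp_mul, map_mul, proj_grp, proj_grp]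

theorem grp_mul_x (h : Γ) (i : Fin θ) :
    W.grp h * W.x i = (W.χ i h : K) • (W.x i * W.grp h) := by
  rw [← proj_grp, ← proj_X, ← map_mul, tensorGrp_mul_X, map_smul, map_mul]

theorem incl_single (h : Γ) (c : K) : W.incl (MonoidAlgebra.single h c) = c • W.grp h := by
  rw [incl, MonoidAlgebra.lift_single]
  rfl

theorem comul_proj (t : W.TensorBos) : comul (R := K) (W.proj t) =
    TensorProduct.map W.proj.toLinearMap W.proj.toLinearMap (comul t) := rfl

theorem comul_grp (h : Γ) : comul (R := K) (W.grp h) = W.grp h ⊗ₜ W.grp h := by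
  have h1 : comul (R := K) (W.tensorGrp h) = W.tensorGrp h ⊗ₜ W.tensorGrp h := W.tensorComul_grp h
  rw [grp, comul_proj, h1]
  rfl

theorem comul_x (i : Fin θ) :
    comul (R := K) (W.x i) = W.x i ⊗ₜ 1 + W.grp (W.g i) ⊗ₜ W.x i := by
  have h1 : comul (R := K) (W.tensorX i) = W.tensorX i ⊗ₜ 1 + W.tensorGrp (W.g i) ⊗ₜ W.tensorX i :=
    W.tensorComul_X i
  rw [← proj_X, comul_proj, h1, map_add, TensorProduct.map_tmul, TensorProduct.map_tmul]
  simp [proj_X, proj_grp]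

theorem counit_grp (h : Γ) : counit (R := K) (W.grp h) = 1 := W.tensorCounit_grp h

theorem counit_x (i : Fin θ) : counit (R := K) (W.x i) = 0 := W.tensorCounit_X i

theorem left_induction (p : Submodule K W.Biproduct) (h1 : 1 ∈ p)
    (hg : ∀ h, ∀ t ∈ p, W.grp h * t ∈ p) (hx : ∀ i, ∀ t ∈ p, W.x i * t ∈ p)
    (t : W.Biproduct) : t ∈ p := by
  obtain ⟨t, rfl⟩ := W.proj_surjective t
  refine W.tensorBos_left_induction (p.comap W.proj.toLinearMap) ?_ ?_ ?_ t
  · simpa using h1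
  · intro h t ht
    simpa [proj_grp] using hg h _ ht
  · intro h t ht
    simpa [proj_X] using hx h _ ht

theorem linearMap_ext_left {M : Type*} [AddCommGroup M] [Module K M]
    {F F' : W.Biproduct →ₗ[K] M} (h1 : F 1 = F' 1)
    (hg : ∀ h a, F a = F' a → F (W.grp h * a) = F' (W.grp h * a))
    (hx : ∀ i a, F a = F' a → F (W.x i * a) = F' (W.x i * a)) : F = F' :=
  LinearMap.ext fun a => W.left_induction (LinearMap.eqLocus F F') h1 hg hx a

/-! ### Skew derivations -/

/-- The two-sided ideal `⊕_{n ≥ 2} Wⁿ # K[Γ]`. -/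
def degGeTwoIdeal : Ideal W.TensorBos where
  carrier := W.degGeTwo
  zero_mem' := W.degGeTwo.zero_mem
  add_mem' := W.degGeTwo.add_mem
  smul_mem' := by
    intro c t ht
    induction ht using Submodule.span_induction with
    | mem t ht =>
      obtain ⟨a, b, d, i, j, rfl⟩ := ht
      exact Submodule.subset_span ⟨c * a, b, d, i, j, by simp only [smul_eq_mul, mul_assoc]⟩
    | zero => simp
    | add t u _ _ ht hu => rw [smul_add]; exact W.degGeTwo.add_mem ht hu
    | smul k t _ ht => rw [smul_comm]; exact W.degGeTwo.smul_mem k ht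

instance : W.degGeTwoIdeal.IsTwoSided := by
  constructor
  intro t c ht
  change t ∈ W.degGeTwo at ht
  change t * c ∈ W.degGeTwo
  induction ht using Submodule.span_induction with
  | mem t ht =>
    obtain ⟨a, b, d, i, j, rfl⟩ := ht
    exact Submodule.subset_span ⟨a, b, d * c, i, j, by simp only [mul_assoc]⟩
  | zero => simp
  | add t u _ _ ht hu => rw [add_mul]; exact W.degGeTwo.add_mem ht hu
  | smul k t _ ht => rw [smul_mul_assoc]; exact W.degGeTwo.smul_mem k ht

theorem nicholsIdeal_le : W.nicholsIdeal ≤ W.degGeTwoIdeal :=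
  iSup_le fun I _ ht => I.2.2.2 ht

/-- A linear map on `T(W) # K[Γ]` that vanishes in degrees at least two, as a map on
`B(W) # K[Γ]`. -/
def descend {M : Type*} [AddCommGroup M] [Module K M] (f : W.TensorBos →ₗ[K] M)
    (hf : ∀ (a b c : W.TensorBos) (i j : Fin θ), f (a * W.tensorX i * b * W.tensorX j * c) = 0) :
    W.Biproduct →ₗ[K] M :=
  (W.nicholsIdeal.restrictScalars K).liftQ f fun t ht => by
    have h : W.degGeTwo ≤ LinearMap.ker f := by
      refine Submodule.span_le.2 ?_
      rintro _ ⟨a, b, c, i, j, rfl⟩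
      exact hf a b c i j
    exact h (W.nicholsIdeal_le ht)

theorem descend_proj {M : Type*} [AddCommGroup M] [Module K M] (f : W.TensorBos →ₗ[K] M)
    (hf) (t : W.TensorBos) : W.descend f hf (W.proj t) = f t := rfl

/-- The representation of `T(W) # K[Γ]` by upper triangular matrices with the characters
`ψ`, `ψ'` on the diagonal, and `xᵢ` for the only nonzero variable. -/
def triangular (i : Fin θ) (ψ ψ' : Γ →* Kˣ) (h : ∀ h, (ψ h : K) = W.χ i h * ψ' h) :
    W.TensorBos →ₐ[K] Matrix (Fin 2) (Fin 2) K :=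
  W.tensorLift (fun h => !![(ψ h : K), 0; 0, (ψ' h : K)])
    (fun k => !![0, if k = i then 1 else 0; 0, 0])
    (by simp [Matrix.one_fin_two]) (by simp) (by
      intro d k
      by_cases hk : k = i
      · subst hk; simp [h]
      · simp [hk])

theorem triangular_grp (i : Fin θ) (ψ ψ' : Γ →* Kˣ) (h) (d : Γ) :
    W.triangular i ψ ψ' h (W.tensorGrp d) = !![(ψ d : K), 0; 0, (ψ' d : K)] :=
  W.tensorLift_grp _ _ _ _ _ d

theorem triangular_X (i : Fin θ) (ψ ψ' : Γ →* Kˣ) (h) (k : Fin θ) :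
    W.triangular i ψ ψ' h (W.tensorX k) = !![0, if k = i then 1 else 0; 0, 0] :=
  W.tensorLift_X _ _ _ _ _ k

/-- The `(ψ, ψ')`-skew derivation dual to `xᵢ`. -/
def tensorSkew (i : Fin θ) (ψ ψ' : Γ →* Kˣ) (h : ∀ h, (ψ h : K) = W.χ i h * ψ' h) :
    W.TensorBos →ₗ[K] K :=
  Matrix.entryLinearMap K K 0 1 ∘ₗ (W.triangular i ψ ψ' h).toLinearMap

theorem triangular_one_zero (i : Fin θ) (ψ ψ' : Γ →* Kˣ) (h) (t : W.TensorBos) :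
    W.triangular i ψ ψ' h t 1 0 = 0 := by
  refine W.tensorBos_left_induction (LinearMap.ker
    (Matrix.entryLinearMap K K 1 0 ∘ₗ (W.triangular i ψ ψ' h).toLinearMap)) ?_ ?_ ?_ t
  · simp
  · intro d t ht
    have ht : W.triangular i ψ ψ' h t 1 0 = 0 := ht
    simp [triangular_grp, Matrix.vecMul, dotProduct, ht]
  · intro k t ht
    have ht : W.triangular i ψ ψ' h t 1 0 = 0 := ht
    simp [triangular_X, Matrix.vecMul, dotProduct]

/-- The `(ψ, ψ')`-skew derivation of `B(W) # K[Γ]` dual to `xᵢ`. -/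
def skew (i : Fin θ) (ψ ψ' : Γ →* Kˣ) (h : ∀ h, (ψ h : K) = W.χ i h * ψ' h) :
    W.Biproduct →ₗ[K] K :=
  W.descend (W.tensorSkew i ψ ψ' h) fun a b c k l => by
    -- Two strictly upper triangular `2 × 2` matrices with an upper triangular one between them have
    -- product zero.
    have : W.triangular i ψ ψ' h (W.tensorX k * (b * W.tensorX l)) = 0 := by
      rw [map_mul, map_mul, triangular_X, triangular_X]
      ext s t
      fin_cases s <;> fin_cases t <;> simp [Matrix.mul_apply, triangular_one_zero]
    have h2 : W.triangular i ψ ψ' h (a * W.tensorX k * b * W.tensorX l * c) = 0 := by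
      rw [show a * W.tensorX k * b * W.tensorX l * c = a * (W.tensorX k * (b * W.tensorX l)) * c by
        simp only [mul_assoc], map_mul, map_mul, this, mul_zero, zero_mul]
    simp [tensorSkew, h2]

/-- The character `ψ` of `Γ`, extended to `T(W) # K[Γ]` by `xᵢ ↦ 0`. -/
def tensorChar (ψ : Γ →* Kˣ) : W.TensorBos →ₐ[K] K :=
  W.tensorLift (fun h => (ψ h : K)) (fun _ => 0) (by simp) (by simp) (by simp)

theorem tensorChar_grp (ψ : Γ →* Kˣ) (h : Γ) : W.tensorChar ψ (W.tensorGrp h) = ψ h :=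
  W.tensorLift_grp _ _ _ _ _ h

theorem tensorChar_X (ψ : Γ →* Kˣ) (i : Fin θ) : W.tensorChar ψ (W.tensorX i) = 0 :=
  W.tensorLift_X _ _ _ _ _ i

theorem triangular_one_one (i : Fin θ) (ψ ψ' : Γ →* Kˣ) (h) (t : W.TensorBos) :
    W.triangular i ψ ψ' h t 1 1 = W.tensorChar ψ' t := by
  refine W.tensorBos_left_induction (LinearMap.eqLocus
    (Matrix.entryLinearMap K K 1 1 ∘ₗ (W.triangular i ψ ψ' h).toLinearMap)
    (W.tensorChar ψ').toLinearMap) ?_ ?_ ?_ t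
  · simp
  · intro d t ht
    have ht : W.triangular i ψ ψ' h t 1 1 = W.tensorChar ψ' t := ht
    simp [triangular_grp, tensorChar_grp, Matrix.vecMul, dotProduct, ht]
  · intro k t ht
    simp [triangular_X, tensorChar_X, Matrix.vecMul, dotProduct]

/-- The character `ψ` of `Γ`, extended to `B(W) # K[Γ]` by `xᵢ ↦ 0`. -/
def char (ψ : Γ →* Kˣ) : W.Biproduct →ₗ[K] K :=
  W.descend (W.tensorChar ψ).toLinearMap fun a b c k l => by simp [tensorChar_X]

theorem char_grp_mul (ψ : Γ →* Kˣ) (h : Γ) (a : W.Biproduct) :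
    W.char ψ (W.grp h * a) = ψ h * W.char ψ a := by
  obtain ⟨t, rfl⟩ := W.proj_surjective a
  rw [← proj_grp, ← map_mul, char, descend_proj, descend_proj]
  simp [tensorChar_grp]

theorem char_x_mul (ψ : Γ →* Kˣ) (i : Fin θ) (a : W.Biproduct) :
    W.char ψ (W.x i * a) = 0 := by
  obtain ⟨t, rfl⟩ := W.proj_surjective a
  rw [← proj_X, ← map_mul, char, descend_proj]
  simp [tensorChar_X]

theorem char_one (ψ : Γ →* Kˣ) : W.char ψ 1 = 1 := by
  rw [← map_one W.proj, char, descend_proj]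
  simp

theorem skew_grp_mul (i : Fin θ) (ψ ψ' : Γ →* Kˣ) (h) (d : Γ) (a : W.Biproduct) :
    W.skew i ψ ψ' h (W.grp d * a) = ψ d * W.skew i ψ ψ' h a := by
  obtain ⟨t, rfl⟩ := W.proj_surjective a
  rw [← proj_grp, ← map_mul, skew, descend_proj, descend_proj]
  simp [tensorSkew, triangular_grp, Matrix.vecMul, dotProduct]

theorem skew_x_mul (i : Fin θ) (ψ ψ' : Γ →* Kˣ) (h) (k : Fin θ) (a : W.Biproduct) :
    W.skew i ψ ψ' h (W.x k * a) = if k = i then W.char ψ' a else 0 := by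
  obtain ⟨t, rfl⟩ := W.proj_surjective a
  rw [← proj_X, ← map_mul, skew, descend_proj, char, descend_proj]
  simp [tensorSkew, triangular_X, Matrix.vecMul, dotProduct, triangular_one_one]

theorem skew_one (i : Fin θ) (ψ ψ' : Γ →* Kˣ) (h) : W.skew i ψ ψ' h 1 = 0 := by
  rw [← map_one W.proj, skew, descend_proj]
  simp [tensorSkew]

theorem leftHit_grp_mul (f : W.Biproduct →ₗ[K] K) (ψ : Γ →* Kˣ)
    (hf : ∀ h a, f (W.grp h * a) = ψ h * f a) (h : Γ) (a : W.Biproduct) :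
    leftHit f (W.grp h * a) = (ψ h : K) • (W.grp h * leftHit f a) := by
  have e : comul (R := K) (W.grp h * a) = ∑ i ∈ (ℛ K a).index,
      (W.grp h * (ℛ K a).left i) ⊗ₜ (W.grp h * (ℛ K a).right i) := by
    rw [Bialgebra.comul_mul, comul_grp, ← (ℛ K a).eq, Finset.mul_sum]
    simp
  rw [leftHit_repr f (ℛ K a), leftHit, LinearMap.comp_apply, LinearMap.comp_apply, e]
  simp [hf, Finset.mul_sum, Finset.smul_sum, mul_smul]

/-- The skew Leibniz rule, read off from `Δ(x_k a) = x_k a₁ ⊗ a₂ + g_k a₁ ⊗ x_k a₂`. -/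
theorem leftHit_x_mul (f f' : W.Biproduct →ₗ[K] K) (ψ : Γ →* Kˣ) (k : Fin θ)
    (hf : ∀ h a, f (W.grp h * a) = ψ h * f a) (hx : ∀ a, f (W.x k * a) = f' a) (a : W.Biproduct) :
    leftHit f (W.x k * a) = leftHit f' a + (ψ (W.g k) : K) • (W.x k * leftHit f a) := by
  have e : comul (R := K) (W.x k * a) = ∑ i ∈ (ℛ K a).index,
      ((W.x k * (ℛ K a).left i) ⊗ₜ[K] (ℛ K a).right i +
        (W.grp (W.g k) * (ℛ K a).left i) ⊗ₜ (W.x k * (ℛ K a).right i)) := by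
    rw [Bialgebra.comul_mul, comul_x, ← (ℛ K a).eq, Finset.mul_sum]
    simp [add_mul]
  rw [leftHit_repr f (ℛ K a), leftHit_repr f' (ℛ K a), leftHit, LinearMap.comp_apply,
    LinearMap.comp_apply, e]
  simp [hf, hx, Finset.mul_sum, Finset.smul_sum, mul_smul, Finset.sum_add_distrib]

theorem leftHit_one (f : W.Biproduct →ₗ[K] K) : leftHit f 1 = f 1 • 1 := by
  simp [leftHit, Algebra.TensorProduct.one_def]

/-- The operator `a ↦ ψ(a₁) a₂` of a character `ψ`. -/
def scale (ψ : Γ →* Kˣ) : Module.End K W.Biproduct := leftHit (W.char ψ)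

theorem scale_one (ψ : Γ →* Kˣ) : W.scale ψ 1 = 1 := by
  rw [scale, leftHit_one, char_one, one_smul]

theorem scale_grp_mul (ψ : Γ →* Kˣ) (h : Γ) (a : W.Biproduct) :
    W.scale ψ (W.grp h * a) = (ψ h : K) • (W.grp h * W.scale ψ a) :=
  W.leftHit_grp_mul _ ψ (W.char_grp_mul ψ) h a

theorem scale_x_mul (ψ : Γ →* Kˣ) (k : Fin θ) (a : W.Biproduct) :
    W.scale ψ (W.x k * a) = (ψ (W.g k) : K) • (W.x k * W.scale ψ a) := by
  rw [scale, W.leftHit_x_mul _ 0 ψ k (W.char_grp_mul ψ) (by simp [char_x_mul])]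
  simp [leftHit]

theorem scale_trivial : W.scale 1 = LinearMap.id := by
  refine W.linearMap_ext_left ?_ ?_ ?_
  · rw [scale_one]; rfl
  · intro h a ha
    rw [scale_grp_mul, ha]; simp
  · intro h a ha
    rw [scale_x_mul, ha]; simp

/-- The operator `a ↦ ξ(a₁) a₂` of the skew derivation `ξ` dual to `xᵢ`. -/
def skewOp (i : Fin θ) (ψ ψ' : Γ →* Kˣ) (h : ∀ h, (ψ h : K) = W.χ i h * ψ' h) :
    Module.End K W.Biproduct := leftHit (W.skew i ψ ψ' h)

theorem skewOp_one (i : Fin θ) (ψ ψ' : Γ →* Kˣ) (h) : W.skewOp i ψ ψ' h 1 = 0 := by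
  rw [skewOp, leftHit_one, skew_one, zero_smul]

theorem skewOp_grp_mul (i : Fin θ) (ψ ψ' : Γ →* Kˣ) (h) (d : Γ) (a : W.Biproduct) :
    W.skewOp i ψ ψ' h (W.grp d * a) = (ψ d : K) • (W.grp d * W.skewOp i ψ ψ' h a) :=
  W.leftHit_grp_mul _ ψ (W.skew_grp_mul i ψ ψ' h) d a

theorem skewOp_x_mul_self (i : Fin θ) (ψ ψ' : Γ →* Kˣ) (h) (a : W.Biproduct) :
    W.skewOp i ψ ψ' h (W.x i * a) =
      W.scale ψ' a + (ψ (W.g i) : K) • (W.x i * W.skewOp i ψ ψ' h a) :=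
  W.leftHit_x_mul _ _ ψ i (W.skew_grp_mul i ψ ψ' h) (by simp [skew_x_mul]) a

theorem skewOp_x_mul_of_ne (i : Fin θ) (ψ ψ' : Γ →* Kˣ) (h) {k : Fin θ} (hk : k ≠ i)
    (a : W.Biproduct) :
    W.skewOp i ψ ψ' h (W.x k * a) = (ψ (W.g k) : K) • (W.x k * W.skewOp i ψ ψ' h a) := by
  rw [skewOp, W.leftHit_x_mul _ 0 ψ k (W.skew_grp_mul i ψ ψ' h) (by simp [skew_x_mul, hk])]
  simp [leftHit]

/-- The skew derivation `∂ᵢ` of `B(W) # K[Γ]`, with `∂ᵢ(ab) = ∂ᵢ(a) b + χᵢ(a₁) a₂ ∂ᵢ(b)`. -/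
def der (i : Fin θ) : Module.End K W.Biproduct := W.skewOp i (W.χ i) 1 (by simp)

/-- The skew derivation `∂'ᵢ` of `B(W) # K[Γ]`, with `∂'ᵢ(ab) = ∂'ᵢ(a) χᵢ⁻¹(b₁) b₂ + a ∂'ᵢ(b)`. -/
def coder (i : Fin θ) : Module.End K W.Biproduct := W.skewOp i 1 (W.χ i)⁻¹ (by simp)

theorem der_one (i : Fin θ) : W.der i 1 = 0 := W.skewOp_one _ _ _ _

theorem der_grp_mul (i : Fin θ) (h : Γ) (a : W.Biproduct) :
    W.der i (W.grp h * a) = (W.χ i h : K) • (W.grp h * W.der i a) := W.skewOp_grp_mul _ _ _ _ _ _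

theorem der_x_mul (i k : Fin θ) (a : W.Biproduct) :
    W.der i (W.x k * a) =
      (if k = i then a else 0) + (W.χ i (W.g k) : K) • (W.x k * W.der i a) := by
  split_ifs with hk
  · subst hk
    rw [der, skewOp_x_mul_self, scale_trivial]; rfl
  · rw [der, skewOp_x_mul_of_ne _ _ _ _ _ hk, zero_add]

/-- Both sides obey the same recursion under left multiplication by generators. The condition
`χ_l(gᵢ) χᵢ(g_l) = 1` is what matches the terms created by `x_l`. -/
theorem der_mul_der {i l : Fin θ} (h : i ≠ l) :
    W.der i * W.der l = (W.χ l (W.g i) : K) • (W.der l * W.der i) := by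
  have hc : (W.χ l (W.g i) : K) * (W.χ i (W.g l) : K) = 1 := by
    rw [← Units.val_mul, W.qls_one l i h.symm, Units.val_one]
  refine W.linearMap_ext_left ?_ ?_ ?_
  · simp [der_one]
  · intro d a ha
    simp only [Module.End.mul_apply, LinearMap.smul_apply, der_grp_mul, map_smul] at ha ⊢
    rw [ha]
    simp only [smul_smul, mul_smul_comm]
    congr 1
    ring
  · intro k a ha
    simp only [Module.End.mul_apply, LinearMap.smul_apply, der_x_mul, map_smul, map_add,
      smul_add] at ha ⊢
    rw [ha]
    simp only [smul_smul, mul_smul_comm]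
    by_cases h1 : k = l
    · subst h1
      simp only [if_true, h.symm, if_false, smul_zero, zero_add, hc, one_smul, map_zero]
      congr 2
      ring
    · by_cases h2 : k = i
      · subst h2
        simp only [if_true, h1, if_false, smul_zero, zero_add, map_zero]
      · simp only [h1, h2, if_false, smul_zero, map_zero, zero_add]
        congr 1
        ring

end QuantumLinearSpace

/-- The ordered monomial `∏_{i ∈ l} Xᵢ^{nᵢ}`. -/
def listMono {ι E : Type*} [Monoid E] (X : ι → E) (n : ι → ℕ) (l : List ι) : E :=
  (l.map fun i => X i ^ n i).prod

theorem listMono_nil {ι E : Type*} [Monoid E] (X : ι → E) (n : ι → ℕ) :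
    listMono X n [] = 1 := rfl

theorem listMono_cons {ι E : Type*} [Monoid E] (X : ι → E) (n : ι → ℕ) (i : ι) (l : List ι) :
    listMono X n (i :: l) = X i ^ n i * listMono X n l := by
  simp [listMono]

theorem map_listMono {ι E E' F : Type*} [Monoid E] [Monoid E'] [FunLike F E E']
    [MonoidHomClass F E E'] (f : F) (X : ι → E) (n : ι → ℕ) (l : List ι) :
    f (listMono X n l) = listMono (fun i => f (X i)) n l := by
  induction l with
  | nil => simp [listMono_nil]
  | cons i l ih => rw [listMono_cons, listMono_cons, map_mul, map_pow, ih]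

namespace QuantumLinearSpace

open Coalgebra

variable {K Γ : Type*} [Field K] [CommGroup Γ] {θ : ℕ} (W : QuantumLinearSpace K Γ θ)

/-! ### Spanning by ordered monomials -/

section Span

variable {E : Type*} [Ring E] [Algebra K E] (f : W.TensorBos →ₐ[K] E)

/-- The image of the word `w` in the variables `xᵢ`. -/
def wordProd (w : List (Fin θ)) : E := (w.map fun i => f (W.tensorX i)).prod

/-- The span of the elements `w h`, with `w` a word of length less than `d`, and `h ∈ Γ`. -/
def wordSpan (d : ℕ) : Submodule K E :=
  Submodule.span K {e | ∃ (w : List (Fin θ)) (h : Γ), w.length < d ∧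
    e = W.wordProd f w * f (W.tensorGrp h)}

/-- The span of the group-like elements. -/
def grpSpan : Submodule K E := Submodule.span K (Set.range fun h => f (W.tensorGrp h))

/-- The span of the monomials `x₁^{n₁} ⋯ x_θ^{n_θ} h`, `nᵢ < rᵢ`. -/
def monoSpan : Submodule K E :=
  Submodule.span K {e | ∃ (n : Fin θ → ℕ) (h : Γ), (∀ i, n i < W.r i) ∧
    e = listMono (fun i => f (W.tensorX i)) n (List.finRange θ) * f (W.tensorGrp h)}

theorem wordProd_cons (i : Fin θ) (w : List (Fin θ)) :
    W.wordProd f (i :: w) = f (W.tensorX i) * W.wordProd f w := by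
  simp [wordProd]

theorem wordSpan_mono {d e : ℕ} (h : d ≤ e) : W.wordSpan f d ≤ W.wordSpan f e :=
  Submodule.span_mono fun _ ⟨w, k, hw, he⟩ => ⟨w, k, hw.trans_le h, he⟩

theorem wordProd_mul_grp_mem (w : List (Fin θ)) (h : Γ) :
    W.wordProd f w * f (W.tensorGrp h) ∈ W.wordSpan f (w.length + 1) :=
  Submodule.subset_span ⟨w, h, Nat.lt_succ_self _, rfl⟩

theorem grp_mul_wordProd (h : Γ) (w : List (Fin θ)) :
    ∃ c : K, f (W.tensorGrp h) * W.wordProd f w = c • (W.wordProd f w * f (W.tensorGrp h)) := by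
  induction w with
  | nil => exact ⟨1, by simp [wordProd]⟩
  | cons i w ih =>
    obtain ⟨c, hc⟩ := ih
    refine ⟨W.χ i h * c, ?_⟩
    rw [wordProd_cons, ← mul_assoc, ← map_mul, tensorGrp_mul_X, map_smul, map_mul,
      smul_mul_assoc, mul_assoc, hc, mul_smul_comm, smul_smul, mul_assoc]

theorem X_mul_wordSpan {d : ℕ} (i : Fin θ) {e : E} (he : e ∈ W.wordSpan f d) :
    f (W.tensorX i) * e ∈ W.wordSpan f (d + 1) := by
  induction he using Submodule.span_induction with
  | mem e he =>
    obtain ⟨w, h, hw, rfl⟩ := he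
    exact Submodule.subset_span ⟨i :: w, h, by simpa using hw, by rw [wordProd_cons, mul_assoc]⟩
  | zero => simp
  | add a b _ _ ha hb => rw [mul_add]; exact add_mem ha hb
  | smul c a _ ha => rw [mul_smul_comm]; exact Submodule.smul_mem _ c ha

theorem grp_mul_wordSpan {d : ℕ} (h : Γ) {e : E} (he : e ∈ W.wordSpan f d) :
    f (W.tensorGrp h) * e ∈ W.wordSpan f d := by
  induction he using Submodule.span_induction with
  | mem e he =>
    obtain ⟨w, k, hw, rfl⟩ := he
    obtain ⟨c, hc⟩ := W.grp_mul_wordProd f h w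
    rw [← mul_assoc, hc, smul_mul_assoc, mul_assoc, ← map_mul, ← tensorGrp_mul]
    exact Submodule.smul_mem _ c (Submodule.subset_span ⟨w, h * k, hw, rfl⟩)
  | zero => simp
  | add a b _ _ ha hb => rw [mul_add]; exact add_mem ha hb
  | smul c a _ ha => rw [mul_smul_comm]; exact Submodule.smul_mem _ c ha

theorem wordSpan_mul_grp {d : ℕ} (h : Γ) {e : E} (he : e ∈ W.wordSpan f d) :
    e * f (W.tensorGrp h) ∈ W.wordSpan f d := by
  induction he using Submodule.span_induction with
  | mem e he =>
    obtain ⟨w, k, hw, rfl⟩ := he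
    rw [mul_assoc, ← map_mul, ← tensorGrp_mul]
    exact Submodule.subset_span ⟨w, k * h, hw, rfl⟩
  | zero => simp
  | add a b _ _ ha hb => rw [add_mul]; exact add_mem ha hb
  | smul c a _ ha => rw [smul_mul_assoc]; exact Submodule.smul_mem _ c ha

theorem wordProd_mem (w : List (Fin θ)) : W.wordProd f w ∈ W.wordSpan f (w.length + 1) := by
  have := W.wordProd_mul_grp_mem f w 1
  rwa [tensorGrp_one, map_one, mul_one] at this

theorem grpSpan_mul_wordProd {e : E} (he : e ∈ W.grpSpan f) (w : List (Fin θ)) :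
    e * W.wordProd f w ∈ W.wordSpan f (w.length + 1) := by
  induction he using Submodule.span_induction with
  | mem e he =>
    obtain ⟨h, rfl⟩ := he
    exact W.grp_mul_wordSpan f h (W.wordProd_mem f w)
  | zero => simp
  | add a b _ _ ha hb => rw [add_mul]; exact add_mem ha hb
  | smul c a _ ha => rw [smul_mul_assoc]; exact Submodule.smul_mem _ c ha

/-- Exchanging two neighbouring letters costs a scalar and an error in `K[Γ]` times a word that is
two letters shorter. -/
theorem wordProd_perm
    (hcomm : ∀ i j, i ≠ j → f (W.tensorX i) * f (W.tensorX j) -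
      (W.χ j (W.g i) : K) • (f (W.tensorX j) * f (W.tensorX i)) ∈ W.grpSpan f)
    {w w' : List (Fin θ)} (h : w.Perm w') :
    ∃ c : K, W.wordProd f w - c • W.wordProd f w' ∈ W.wordSpan f w.length := by
  induction h with
  | nil => exact ⟨1, by simp⟩
  | cons i _ ih =>
    obtain ⟨c, hc⟩ := ih
    refine ⟨c, ?_⟩
    rw [wordProd_cons, wordProd_cons, ← mul_smul_comm, ← mul_sub]
    exact W.X_mul_wordSpan f i hc
  | swap i j l =>
    by_cases hij : j = i
    · subst hij
      exact ⟨1, by simp⟩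
    · refine ⟨W.χ i (W.g j), ?_⟩
      simp only [wordProd_cons]
      rw [← mul_assoc, ← mul_assoc, ← smul_mul_assoc, ← sub_mul]
      exact W.wordSpan_mono f (by simp) (W.grpSpan_mul_wordProd f (hcomm j i hij) l)
  | trans h₁ _ ih₁ ih₂ =>
    obtain ⟨c, hc⟩ := ih₁
    obtain ⟨d, hd⟩ := ih₂
    refine ⟨c * d, ?_⟩
    rw [← h₁.length_eq] at hd
    have := add_mem hc (Submodule.smul_mem _ c hd)
    rwa [smul_sub, smul_smul, sub_add_sub_cancel] at this

theorem wordProd_flatMap (n : Fin θ → ℕ) (l : List (Fin θ)) :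
    W.wordProd f (l.flatMap fun i => List.replicate (n i) i) =
      listMono (fun i => f (W.tensorX i)) n l := by
  induction l with
  | nil => simp [wordProd, listMono_nil]
  | cons i l ih =>
    rw [listMono_cons, ← ih]
    simp [wordProd]

theorem perm_flatMap_count (w : List (Fin θ)) :
    w.Perm ((List.finRange θ).flatMap fun i => List.replicate (w.count i) i) := by
  rw [List.perm_iff_count]
  intro a
  rw [List.count_flatMap]
  have := Fin.sum_univ_def (fun i => if i = a then w.count i else 0)
  rw [Finset.sum_ite_eq' Finset.univ a (fun i => w.count i)] at this
  simp only [Finset.mem_univ, if_true] at this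
  rw [this]
  congr 2
  funext i
  simp [List.count_replicate]

/-- Induction on word length. Only the shape of the relations matters: their right-hand sides lie in
`K[Γ]`. The lemma therefore serves both `A` and the Galois objects. -/
theorem map_mem_monoSpan
    (hcomm : ∀ i j, i ≠ j → f (W.tensorX i) * f (W.tensorX j) -
      (W.χ j (W.g i) : K) • (f (W.tensorX j) * f (W.tensorX i)) ∈ W.grpSpan f)
    (hpow : ∀ i, f (W.tensorX i) ^ W.r i ∈ W.grpSpan f) (t : W.TensorBos) :
    f t ∈ W.monoSpan f := by
  have key : ∀ d, W.wordSpan f d ≤ W.monoSpan f := by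
    intro d
    induction d with
    | zero => exact Submodule.span_le.2 fun _ ⟨w, h, hw, _⟩ => absurd hw (Nat.not_lt_zero _)
    | succ d ih =>
      refine Submodule.span_le.2 ?_
      rintro _ ⟨w, h, hw, rfl⟩
      have hlow : W.wordSpan f w.length ≤ W.monoSpan f :=
        (W.wordSpan_mono f (by omega)).trans ih
      by_cases hn : ∀ i, w.count i < W.r i
      · obtain ⟨c, hc⟩ := W.wordProd_perm f hcomm (perm_flatMap_count w)
        have h1 := hlow (W.wordSpan_mul_grp f h hc)
        rw [wordProd_flatMap, sub_mul, smul_mul_assoc] at h1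
        have h2 : c • (listMono (fun i => f (W.tensorX i)) (fun i => w.count i) (List.finRange θ) *
            f (W.tensorGrp h)) ∈ W.monoSpan f :=
          Submodule.smul_mem _ c (Submodule.subset_span ⟨_, h, hn, rfl⟩)
        simpa using add_mem h1 h2
      -- Some letter occurs at least `rᵢ` times. Collected in front, `rᵢ` copies of it are absorbed
      -- into `K[Γ]`, and the word becomes shorter.
      · push Not at hn
        obtain ⟨i, hi⟩ := hn
        obtain ⟨w₂, hw₂⟩ := (List.replicate_sublist_iff.2 hi).exists_perm_append
        obtain ⟨c, hc⟩ := W.wordProd_perm f hcomm hw₂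
        have hlen := hw₂.length_eq
        rw [List.length_append, List.length_replicate] at hlen
        have h1 : W.wordProd f (List.replicate (W.r i) i ++ w₂) =
            f (W.tensorX i) ^ W.r i * W.wordProd f w₂ := by
          simp [wordProd]
        have h2 : W.wordProd f w ∈ W.wordSpan f w.length := by
          have h3 := W.wordSpan_mono f (by have := W.one_lt_r i; omega : w₂.length + 1 ≤ w.length)
            (W.grpSpan_mul_wordProd f (hpow i) w₂)
          rw [h1] at hc
          simpa using add_mem hc (Submodule.smul_mem _ c h3)
        exact hlow (W.wordSpan_mul_grp f h h2)
  have all : f t ∈ ⨆ d, W.wordSpan f d := by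
    have hdir : Directed (· ≤ ·) (W.wordSpan f) :=
      Monotone.directed_le fun _ _ h => W.wordSpan_mono f h
    refine W.tensorBos_left_induction ((⨆ d, W.wordSpan f d).comap f.toLinearMap) ?_ ?_ ?_ t
    · refine (le_iSup (W.wordSpan f) 1) ?_
      have := W.wordProd_mem f []
      simpa [wordProd] using this
    · intro h t ht
      obtain ⟨d, hd⟩ := (Submodule.mem_iSup_of_directed _ hdir).1 ht
      refine (le_iSup (W.wordSpan f) d) ?_
      rw [AlgHom.toLinearMap_apply, map_mul]
      exact W.grp_mul_wordSpan f h hd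
    · intro i t ht
      obtain ⟨d, hd⟩ := (Submodule.mem_iSup_of_directed _ hdir).1 ht
      refine (le_iSup (W.wordSpan f) (d + 1)) ?_
      rw [AlgHom.toLinearMap_apply, map_mul]
      exact W.X_mul_wordSpan f i hd
  exact iSup_le key all

end Span

/-! ### The relations of `B(W) # K[Γ]` -/

/-- The zero scalars. -/
def zeroScalars : W.LiftingScalars where
  a _ := 0
  aa _ _ := 0
  aa_swap := by simp
  of_a_ne_zero := by simp
  of_aa_ne_zero := by simp

/-- The elements `xᵢ^{rᵢ}` and the `q`-commutators are skew primitive of degree at least two, so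
they generate one of the biideals whose supremum is the Nichols ideal. -/
theorem zeroScalars_ideal_le : W.zeroScalars.ideal ≤ W.nicholsIdeal := by
  refine le_iSup (fun I : W.nicholsBiideals => I.1) ⟨W.zeroScalars.ideal, ?_, ?_, ?_⟩
  · infer_instance
  · infer_instance
  · intro t ht
    have ht : t ∈ W.zeroScalars.ideal := ht
    have : Ideal.Quotient.mkₐ K W.degGeTwoIdeal t = 0 := by
      refine W.zeroScalars.map_eq_zero _ ?_ ht
      intro s hs
      refine Ideal.Quotient.eq_zero_iff_mem.2 ?_
      rcases hs with ⟨i, rfl⟩ | ⟨i, j, _, rfl⟩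
      · refine Submodule.subset_span ⟨1, 1, W.tensorX i ^ (W.r i - 2), i, i, ?_⟩
        have h2 : W.r i = W.r i - 2 + 2 := by have := W.one_lt_r i; omega
        rw [one_mul, mul_one, ← pow_two, ← pow_add, add_comm, ← h2]
        simp [zeroScalars]
      · have h : ∀ k l, W.tensorX k * W.tensorX l ∈ W.degGeTwo := fun k l =>
          Submodule.subset_span ⟨1, 1, 1, k, l, by simp⟩
        change _ ∈ W.degGeTwo
        simpa [zeroScalars] using sub_mem (h i j) (W.degGeTwo.smul_mem _ (h j i))
    exact Ideal.Quotient.eq_zero_iff_mem.1 this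

theorem proj_relator {t : W.TensorBos} (ht : t ∈ W.zeroScalars.relators) : W.proj t = 0 :=
  Ideal.Quotient.eq_zero_iff_mem.2 (W.zeroScalars_ideal_le (W.zeroScalars.relators_subset ht))

theorem x_pow_r (i : Fin θ) : W.x i ^ W.r i = 0 := by
  have := W.proj_relator (Or.inl ⟨i, rfl⟩)
  simpa [zeroScalars, proj_X] using this

theorem x_mul_x {i j : Fin θ} (h : i ≠ j) :
    W.x i * W.x j = (W.χ j (W.g i) : K) • (W.x j * W.x i) := by
  have := W.proj_relator (Or.inr ⟨i, j, h, rfl⟩)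
  simpa [zeroScalars, proj_X, sub_eq_zero] using this

/-- The monomial `∏_{i ∈ l} xᵢ^{nᵢ} h`. -/
def pbw (n : Fin θ → ℕ) (l : List (Fin θ)) (h : Γ) : W.Biproduct :=
  listMono W.x n l * W.grp h

theorem pbw_nil (n : Fin θ → ℕ) (h : Γ) : W.pbw n [] h = W.grp h := by
  rw [pbw, listMono_nil, one_mul]

theorem pbw_cons (n : Fin θ → ℕ) (i : Fin θ) (l : List (Fin θ)) (h : Γ) :
    W.pbw n (i :: l) h = W.x i ^ n i * W.pbw n l h := by
  rw [pbw, listMono_cons, mul_assoc, pbw]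

theorem mono_eq_pbw (n : Fin θ → ℕ) : W.mono n = W.pbw n (List.finRange θ) 1 := by
  rw [pbw, grp_one, mul_one, listMono, mono, List.ofFn_eq_map]

theorem span_pbw : Submodule.span K {a | ∃ (n : Fin θ → ℕ) (h : Γ), (∀ i, n i < W.r i) ∧
    a = W.pbw n (List.finRange θ) h} = ⊤ := by
  refine eq_top_iff.2 fun a _ => ?_
  obtain ⟨t, rfl⟩ := W.proj_surjective a
  refine W.map_mem_monoSpan W.proj ?_ ?_ t
  · intro i j h
    rw [proj_X, proj_X, W.x_mul_x h, sub_self]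
    exact zero_mem _
  · intro i
    rw [proj_X, x_pow_r]
    exact zero_mem _

theorem linearMap_ext_pbw {M : Type*} [AddCommGroup M] [Module K M]
    {F F' : W.Biproduct →ₗ[K] M}
    (h : ∀ (n : Fin θ → ℕ) (h : Γ), (∀ i, n i < W.r i) →
      F (W.pbw n (List.finRange θ) h) = F' (W.pbw n (List.finRange θ) h)) : F = F' :=
  LinearMap.ext_on W.span_pbw (by rintro _ ⟨n, d, hn, rfl⟩; exact h n d hn)

end QuantumLinearSpace

/-! ### Lowering operators -/

theorem qNum_ne_zero {K : Type*} [Field K] {q : K} {r m : ℕ} (hq : IsPrimitiveRoot q r)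
    (h0 : 0 < m) (hm : m < r) : qNum q m ≠ 0 := by
  intro hz
  have := geom_sum_mul q m
  rw [show ∑ i ∈ Finset.range m, q ^ i = qNum q m from rfl, hz, zero_mul] at this
  exact hq.pow_ne_one_of_pos_of_lt h0.ne' hm (sub_eq_zero.1 this.symm)

theorem qFact_ne_zero {K : Type*} [Field K] {q : K} {r m : ℕ} (hq : IsPrimitiveRoot q r)
    (hm : m < r) : qFact q m ≠ 0 :=
  Finset.prod_ne_zero_iff.2 fun k hk =>
    qNum_ne_zero hq (by omega) (by have := Finset.mem_range.1 hk; omega)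

theorem qFact_zero {K : Type*} [Field K] (q : K) : qFact q 0 = 1 := by simp [qFact]

section Lowering

variable {K A : Type*} [Field K] [Ring A] [Algebra K A] {F : Module.End K A} {x y : A} {p c : K}

theorem lowering_pow_eq_zero
    (hF : ∀ n, F (x ^ (n + 1) * y) = (qNum p (n + 1) * c) • (x ^ n * y)) (h0 : F y = 0)
    {m n : ℕ} (h : n < m) : (F ^ m) (x ^ n * y) = 0 := by
  induction m generalizing n with
  | zero => omega
  | succ m ih =>
    rw [pow_succ, Module.End.mul_apply]
    cases n with
    | zero => simp [h0]
    | succ n => rw [hF, map_smul, ih (by omega), smul_zero]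

/-- `F` acts on powers of `x` like a `q`-derivative, so its iterates produce quotients of
`q`-factorials. -/
theorem lowering_pow_apply
    (hF : ∀ n, F (x ^ (n + 1) * y) = (qNum p (n + 1) * c) • (x ^ n * y)) (m : ℕ) {k : ℕ}
    (hk : qFact p k ≠ 0) :
    (F ^ m) (x ^ (k + m) * y) = (qFact p (k + m) / qFact p k * c ^ m) • (x ^ k * y) := by
  induction m with
  | zero => simp [hk]
  | succ m ih =>
    rw [pow_succ, Module.End.mul_apply, ← add_assoc, hF, map_smul, ih, smul_smul, qFact_succ]
    congr 1
    ring

end Lowering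

namespace QuantumLinearSpace

open Coalgebra

variable {K Γ : Type*} [Field K] [CommGroup Γ] {θ : ℕ} (W : QuantumLinearSpace K Γ θ)

/-- The degree of `∏_{i ∈ l} xᵢ^{nᵢ} h`. -/
def pbwDeg (n : Fin θ → ℕ) (l : List (Fin θ)) (h : Γ) : Γ := listMono W.g n l * h

theorem pbwDeg_nil (n : Fin θ → ℕ) (h : Γ) : W.pbwDeg n [] h = h := by
  rw [pbwDeg, listMono_nil, one_mul]

theorem pbwDeg_cons (n : Fin θ → ℕ) (i : Fin θ) (l : List (Fin θ)) (h : Γ) :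
    W.pbwDeg n (i :: l) h = W.g i ^ n i * W.pbwDeg n l h := by
  rw [pbwDeg, listMono_cons, mul_assoc, pbwDeg]

theorem scale_x_pow_mul (ψ : Γ →* Kˣ) (k : Fin θ) (n : ℕ) (a : W.Biproduct) :
    W.scale ψ (W.x k ^ n * a) = (ψ (W.g k) : K) ^ n • (W.x k ^ n * W.scale ψ a) := by
  induction n with
  | zero => simp
  | succ n ih => rw [pow_succ', mul_assoc, scale_x_mul, ih, mul_smul_comm, smul_smul, ← mul_assoc,
      pow_succ']

theorem scale_grp (ψ : Γ →* Kˣ) (h : Γ) : W.scale ψ (W.grp h) = (ψ h : K) • W.grp h := by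
  rw [← mul_one (W.grp h), scale_grp_mul, scale_one]

theorem scale_pbw (ψ : Γ →* Kˣ) (n : Fin θ → ℕ) (l : List (Fin θ)) (h : Γ) :
    W.scale ψ (W.pbw n l h) = (ψ (W.pbwDeg n l h) : K) • W.pbw n l h := by
  induction l with
  | nil => rw [pbw_nil, pbwDeg_nil, scale_grp]
  | cons i l ih =>
    rw [pbw_cons, pbwDeg_cons, scale_x_pow_mul, ih, mul_smul_comm, smul_smul]
    simp

theorem counit_pbw (n : Fin θ → ℕ) (l : List (Fin θ)) (h : Γ) :
    counit (R := K) (W.pbw n l h) = if ∀ k ∈ l, n k = 0 then 1 else 0 := by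
  induction l with
  | nil => simp [pbw_nil, counit_grp]
  | cons i l ih =>
    rw [pbw_cons, Bialgebra.counit_mul, ih, Bialgebra.counit_pow, counit_x]
    by_cases hi : n i = 0 <;> simp [hi]

/-! ### Skew derivations on ordered monomials. -/

section SkewOp

variable {W} {i : Fin θ} {ψ ψ' : Γ →* Kˣ} {h : ∀ h, (ψ h : K) = W.χ i h * ψ' h}

theorem skewOp_grp (d : Γ) : W.skewOp i ψ ψ' h (W.grp d) = 0 := by
  rw [← mul_one (W.grp d), skewOp_grp_mul, skewOp_one, mul_zero, smul_zero]

theorem skewOp_x_pow_mul_of_ne {k : Fin θ} (hk : k ≠ i) (n : ℕ) (a : W.Biproduct) :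
    W.skewOp i ψ ψ' h (W.x k ^ n * a) =
      (ψ (W.g k) : K) ^ n • (W.x k ^ n * W.skewOp i ψ ψ' h a) := by
  induction n with
  | zero => simp
  | succ n ih => rw [pow_succ', mul_assoc, skewOp_x_mul_of_ne _ _ _ _ _ hk, ih, mul_smul_comm,
      smul_smul, ← mul_assoc, pow_succ']

theorem skewOp_pow_x_pow_mul_of_ne {k : Fin θ} (hk : k ≠ i) (m n : ℕ) (a : W.Biproduct) :
    (W.skewOp i ψ ψ' h ^ m) (W.x k ^ n * a) =
      ((ψ (W.g k) : K) ^ n) ^ m • (W.x k ^ n * (W.skewOp i ψ ψ' h ^ m) a) := by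
  induction m with
  | zero => simp
  | succ m ih =>
    rw [pow_succ', Module.End.mul_apply, ih, map_smul, skewOp_x_pow_mul_of_ne hk, smul_smul,
      Module.End.mul_apply, pow_succ]

theorem skewOp_pbw_of_notMem {l : List (Fin θ)} (hl : i ∉ l) (n : Fin θ → ℕ) (d : Γ) :
    W.skewOp i ψ ψ' h (W.pbw n l d) = 0 := by
  induction l with
  | nil => rw [pbw_nil, skewOp_grp]
  | cons k l ih =>
    rw [List.mem_cons, not_or] at hl
    rw [pbw_cons, skewOp_x_pow_mul_of_ne (Ne.symm hl.1), ih hl.2, mul_zero, smul_zero]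

/-- The parameter `p` covers both cases in use: `p = χᵢ(gᵢ)` for `∂ᵢ` and `p = χᵢ(gᵢ)⁻¹` for `∂'ᵢ`.
The vector `y` stands for the part of a monomial to the right of `xᵢ`, an eigenvector of `scale ψ'`.
-/
theorem skewOp_x_pow_succ {p c : K}
    (hp : ∀ n, ∑ k ∈ Finset.range (n + 1), (ψ (W.g i) : K) ^ k * (ψ' (W.g i) : K) ^ (n - k) =
      qNum p (n + 1)) {y : W.Biproduct} (h0 : W.skewOp i ψ ψ' h y = 0) (hc : W.scale ψ' y = c • y)
    (n : ℕ) :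
    W.skewOp i ψ ψ' h (W.x i ^ (n + 1) * y) = (qNum p (n + 1) * c) • (W.x i ^ n * y) := by
  rw [← hp n]
  induction n with
  | zero => simp [skewOp_x_mul_self, h0, hc]
  | succ n ih =>
    rw [pow_succ', mul_assoc, skewOp_x_mul_self, ih, scale_x_pow_mul, hc, mul_smul_comm, smul_smul,
      mul_smul_comm, ← mul_assoc, ← pow_succ', smul_smul, ← add_smul]
    congr 1
    rw [Finset.sum_range_succ' _ (n + 1)]
    have : ∑ k ∈ Finset.range (n + 1), (ψ (W.g i) : K) ^ (k + 1) *
          (ψ' (W.g i) : K) ^ (n + 1 - (k + 1)) =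
        (ψ (W.g i) : K) * ∑ k ∈ Finset.range (n + 1), (ψ (W.g i) : K) ^ k *
          (ψ' (W.g i) : K) ^ (n - k) := by
      rw [Finset.mul_sum]
      refine Finset.sum_congr rfl fun k _ => ?_
      rw [Nat.add_sub_add_right, pow_succ']
      ring
    rw [this]
    simp only [pow_zero, Nat.sub_zero, one_mul]
    ring

variable {p : K}

theorem skewOp_pow_pbw_eq_zero
    (hp : ∀ n, ∑ k ∈ Finset.range (n + 1),
      (ψ (W.g i) : K) ^ k * (ψ' (W.g i) : K) ^ (n - k) = qNum p (n + 1))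
    {l : List (Fin θ)} (hl : l.Nodup) {n : Fin θ → ℕ} {m : ℕ}
    (hn : n i < m) (d : Γ) : (W.skewOp i ψ ψ' h ^ m) (W.pbw n l d) = 0 := by
  induction l with
  | nil =>
    obtain ⟨m, rfl⟩ : ∃ k, m = k + 1 := ⟨m - 1, by omega⟩
    rw [pbw_nil, pow_succ, Module.End.mul_apply, skewOp_grp, map_zero]
  | cons k l ih =>
    rw [List.nodup_cons] at hl
    rw [pbw_cons]
    by_cases hk : k = i
    · subst hk
      exact lowering_pow_eq_zero
        (skewOp_x_pow_succ hp (skewOp_pbw_of_notMem hl.1 n d) (W.scale_pbw ψ' n l d))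
        (skewOp_pbw_of_notMem hl.1 n d) hn
    · rw [skewOp_pow_x_pow_mul_of_ne hk, ih hl.2, mul_zero, smul_zero]

theorem skewOp_pow_r
    (hp : ∀ n, ∑ k ∈ Finset.range (n + 1),
      (ψ (W.g i) : K) ^ k * (ψ' (W.g i) : K) ^ (n - k) = qNum p (n + 1)) :
    W.skewOp i ψ ψ' h ^ W.r i = 0 :=
  W.linearMap_ext_pbw fun _ d hn => skewOp_pow_pbw_eq_zero hp (List.nodup_finRange θ) (hn i) d

/-- The functional `ε ∘ ξᵢ^m` is dual to the pure power `xᵢ^m`, up to a `q`-factorial. Any other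
variable that is left over is killed by `ε`. -/
theorem counit_skewOp_pow_pbw
    (hp : ∀ n, ∑ k ∈ Finset.range (n + 1),
      (ψ (W.g i) : K) ^ k * (ψ' (W.g i) : K) ^ (n - k) = qNum p (n + 1))
    (hpr : IsPrimitiveRoot p (W.r i)) {l : List (Fin θ)} (hl : l.Nodup)
    (hi : i ∈ l) {n : Fin θ → ℕ} (hn : n i < W.r i) (m : ℕ) :
    counit (R := K) ((W.skewOp i ψ ψ' h ^ m) (W.pbw n l 1)) =
      if n i = m ∧ ∀ k ∈ l, k ≠ i → n k = 0 then qFact p m else 0 := by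
  induction l with
  | nil => simp at hi
  | cons k l ih =>
    rw [List.nodup_cons] at hl
    rw [pbw_cons]
    by_cases hk : k = i
    · subst hk
      have hy := skewOp_x_pow_succ hp (skewOp_pbw_of_notMem (h := h) hl.1 n 1)
        (W.scale_pbw ψ' n l 1)
      rcases lt_or_ge (n k) m with hm | hm
      · rw [lowering_pow_eq_zero hy (skewOp_pbw_of_notMem hl.1 n 1) hm, map_zero,
          if_neg (by omega)]
      · obtain ⟨s, hs⟩ : ∃ s, n k = s + m := ⟨n k - m, by omega⟩
        rw [hs, lowering_pow_apply hy m (qFact_ne_zero hpr (by omega)), map_smul,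
          Bialgebra.counit_mul, Bialgebra.counit_pow, counit_x, counit_pbw]
        rcases Nat.eq_zero_or_pos s with rfl | hs0
        · by_cases hz : ∀ j ∈ l, n j = 0
          · have hd : W.pbwDeg n l 1 = 1 := by
              rw [pbwDeg, mul_one, listMono]
              refine List.prod_eq_one ?_
              intro u hu
              obtain ⟨j, hj, rfl⟩ := List.mem_map.1 hu
              rw [hz j hj, pow_zero]
            have hz' : ∀ j ∈ k :: l, j ≠ k → n j = 0 := by
              intro j hj hjk
              exact hz j ((List.mem_cons.1 hj).resolve_left hjk)
            rw [if_pos hz, if_pos ⟨by omega, hz'⟩, hd]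
            simp [qFact_zero]
          · rw [if_neg hz, if_neg]
            · simp
            · rintro ⟨-, hz'⟩
              refine hz fun j hj => hz' j (List.mem_cons_of_mem _ hj) ?_
              rintro rfl
              exact hl.1 hj
        · rw [if_neg (by omega : ¬ (s + m = m ∧ _)), zero_pow hs0.ne']
          simp
    · have hi' : i ∈ l := (List.mem_cons.1 hi).resolve_left (Ne.symm hk)
      rw [skewOp_pow_x_pow_mul_of_ne hk, map_smul, Bialgebra.counit_mul, Bialgebra.counit_pow,
        counit_x, ih hl.2 hi']
      by_cases hz : n k = 0 <;> simp [hz, hk]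

end SkewOp

theorem der_qNum (i : Fin θ) (n : ℕ) : ∑ k ∈ Finset.range (n + 1),
    (W.χ i (W.g i) : K) ^ k * ((1 : Γ →* Kˣ) (W.g i) : K) ^ (n - k) =
      qNum (W.χ i (W.g i) : K) (n + 1) := by
  simp [qNum]

theorem coder_qNum (i : Fin θ) (n : ℕ) : ∑ k ∈ Finset.range (n + 1),
    ((1 : Γ →* Kˣ) (W.g i) : K) ^ k * (((W.χ i)⁻¹ : Γ →* Kˣ) (W.g i) : K) ^ (n - k) =
      qNum ((W.χ i (W.g i) : K)⁻¹) (n + 1) := by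
  have := Finset.sum_range_reflect (fun k => ((W.χ i (W.g i) : K)⁻¹) ^ k) (n + 1)
  simpa [qNum] using this

theorem der_pow_r (i : Fin θ) : W.der i ^ W.r i = 0 := skewOp_pow_r (W.der_qNum i)

theorem coder_pow_r (i : Fin θ) : W.coder i ^ W.r i = 0 := skewOp_pow_r (W.coder_qNum i)

/-! ### Linear independence of the monomials -/

/-- The projection of `B(W) # K[Γ]` onto `K[Γ]`. -/
def toGrp : W.Biproduct →ₗ[K] (Γ →₀ K) :=
  (MonoidAlgebra.coeffLinearEquiv K).toLinearMap ∘ₗ W.descend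
    (W.tensorLift (E := MonoidAlgebra K Γ) (fun h => MonoidAlgebra.single h 1) (fun _ => 0) rfl
      (by simp [MonoidAlgebra.single_mul_single]) (by simp)).toLinearMap
    (fun a b c k l => by simp [tensorLift_X])

theorem toGrp_x_mul (i : Fin θ) (a : W.Biproduct) : W.toGrp (W.x i * a) = 0 := by
  obtain ⟨t, rfl⟩ := W.proj_surjective a
  rw [← proj_X, ← map_mul, toGrp, LinearMap.comp_apply, descend_proj]
  simp [tensorLift_X]

theorem toGrp_grp (h : Γ) : W.toGrp (W.grp h) = Finsupp.single h 1 := by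
  rw [← proj_grp, toGrp, LinearMap.comp_apply, descend_proj]
  simp [tensorLift_grp]

/-- The map `π ∘ ∏_{i ∈ l} ∂ᵢ^{nᵢ}`, where `π` is the projection onto `K[Γ]`. -/
def lower (n : Fin θ → ℕ) : List (Fin θ) → (W.Biproduct →ₗ[K] (Γ →₀ K))
  | [] => W.toGrp
  | i :: l => lower n l ∘ₗ (W.der i ^ n i)

theorem lower_x_mul (n : Fin θ → ℕ) {l : List (Fin θ)} {i : Fin θ} (hi : i ∉ l)
    (a : W.Biproduct) : W.lower n l (W.x i * a) = 0 := by
  induction l generalizing a with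
  | nil => exact W.toGrp_x_mul i a
  | cons k l ih =>
    rw [List.mem_cons, not_or] at hi
    have := skewOp_pow_x_pow_mul_of_ne (W := W) (h := by simp) (ψ := W.χ k) (ψ' := 1) hi.1 (n k) 1 a
    rw [pow_one] at this
    rw [lower, LinearMap.comp_apply, der, this, map_smul, ih hi.2, smul_zero]

theorem lower_pbw (n m : Fin θ → ℕ) (hm : ∀ i, m i < W.r i) {l : List (Fin θ)}
    (hl : l.Nodup) (h : Γ) :
    W.lower n l (W.pbw m l h) = if ∀ k ∈ l, m k = n k then
      (l.map fun k => qFact (W.χ k (W.g k) : K) (n k)).prod • Finsupp.single h 1 else 0 := by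
  induction l with
  | nil => simp [lower, pbw_nil, toGrp_grp]
  | cons i l ih =>
    rw [List.nodup_cons] at hl
    have h0 : W.der i (W.pbw m l h) = 0 := skewOp_pbw_of_notMem hl.1 m h
    have hy := skewOp_x_pow_succ (W.der_qNum i) h0 (c := 1) (by rw [scale_trivial]; simp)
    rw [lower, LinearMap.comp_apply, pbw_cons]
    rcases lt_trichotomy (m i) (n i) with hlt | heq | hgt
    · rw [der, lowering_pow_eq_zero hy h0 hlt, map_zero, if_neg]
      exact fun hk => hlt.ne (hk i (List.mem_cons_self))
    · have := lowering_pow_apply hy (m i) (k := 0) (by simp [qFact_zero])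
      rw [zero_add] at this
      rw [← heq, der, this, map_smul]
      simp only [pow_zero, one_mul, qFact_zero, div_one, one_pow, mul_one]
      rw [ih hl.2]
      by_cases hz : ∀ k ∈ l, m k = n k
      · rw [if_pos hz, if_pos (by simpa [heq] using hz), List.map_cons, List.prod_cons, ← heq,
          smul_smul]
      · rw [if_neg hz, if_neg (by simpa [heq] using hz), smul_zero]
    -- A factor `xᵢ` survives. The remaining derivations pass over it and the projection onto `K[Γ]`
    -- kills it.
    · obtain ⟨s, hs⟩ : ∃ s, m i = (s + 1) + n i := ⟨m i - n i - 1, by omega⟩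
      rw [hs, der, lowering_pow_apply hy (n i)
        (qFact_ne_zero (W.qls_two i) (by have := hm i; omega)), map_smul, pow_succ', mul_assoc,
        W.lower_x_mul _ hl.1, smul_zero, if_neg]
      exact fun hk => hgt.ne' (hk i (List.mem_cons_self))

/-- The maps `lower n`, followed by a coordinate of `K[Γ]`, are dual to the monomials up to products
of `q`-factorials, nonzero because the exponents are below the orders of the roots of unity. -/
theorem linearIndependent_pbw : LinearIndependent K
    (fun s : (∀ i, Fin (W.r i)) × Γ => W.pbw (fun i => s.1 i) (List.finRange θ) s.2) := by
  classical
  rw [linearIndependent_iff']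
  intro S c hc s hs
  have h := congrArg (fun a => W.lower (fun i => s.1 i) (List.finRange θ) a s.2) hc
  simp only [map_sum, map_smul, map_zero, Finsupp.zero_apply, Finsupp.finsetSum_apply,
    Finsupp.smul_apply] at h
  rw [Finset.sum_eq_single s] at h
  · rw [W.lower_pbw _ _ (fun i => (s.1 i).2) (List.nodup_finRange θ), if_pos (fun _ _ => rfl)] at h
    simp only [Finsupp.smul_apply, Finsupp.single_eq_same, smul_eq_mul, mul_one] at h
    refine (mul_eq_zero.1 h).resolve_right (List.prod_ne_zero ?_)
    intro h0
    obtain ⟨k, -, hk⟩ := List.mem_map.1 h0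
    exact qFact_ne_zero (W.qls_two k) (s.1 k).2 hk
  · intro t _ ht
    rw [W.lower_pbw _ _ (fun i => (t.1 i).2) (List.nodup_finRange θ)]
    split_ifs with hk
    · have h1 : t.1 = s.1 := funext fun k => Fin.ext (hk k (List.mem_finRange k))
      have h2 : t.2 ≠ s.2 := fun h2 => ht (Prod.ext h1 h2)
      rw [Finsupp.smul_apply, Finsupp.single_eq_of_ne h2.symm, smul_zero, smul_zero]
    · simp
  · exact fun h => absurd hs h

/-- The basis `x₁^{n₁} ⋯ x_θ^{n_θ} h` of `B(W) # K[Γ]`. -/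
def pbwBasis : Module.Basis ((∀ i, Fin (W.r i)) × Γ) K W.Biproduct :=
  Module.Basis.mk W.linearIndependent_pbw (by
    rw [← W.span_pbw]
    refine Submodule.span_mono ?_
    rintro _ ⟨n, h, hn, rfl⟩
    exact ⟨(fun i => ⟨n i, hn i⟩, h), rfl⟩)

theorem pbwBasis_apply (s : (∀ i, Fin (W.r i)) × Γ) :
    W.pbwBasis s = W.pbw (fun i => s.1 i) (List.finRange θ) s.2 := by
  simp [pbwBasis]

end QuantumLinearSpace

/-! ### `q`-commuting elements -/

/-- `u v = c v u`. -/
def QComm {K E : Type*} [Field K] [Ring E] [Algebra K E] (c : K) (u v : E) : Prop :=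
  u * v = c • (v * u)

namespace QComm

variable {K E : Type*} [Field K] [Ring E] [Algebra K E] {c d : K} {u v w : E}

theorem eq (h : QComm c u v) : u * v = c • (v * u) := h

theorem add_left (h : QComm c u w) (h' : QComm c v w) : QComm c (u + v) w := by
  rw [QComm, add_mul, mul_add, smul_add, h.eq, h'.eq]

theorem add_right (h : QComm c u v) (h' : QComm c u w) : QComm c u (v + w) := by
  rw [QComm, add_mul, mul_add, smul_add, h.eq, h'.eq]

theorem sum_left {ι : Type*} {s : Finset ι} {f : ι → E} (h : ∀ i ∈ s, QComm c (f i) w) :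
    QComm c (∑ i ∈ s, f i) w := by
  rw [QComm, Finset.sum_mul, Finset.mul_sum, Finset.smul_sum]
  exact Finset.sum_congr rfl h

theorem sum_right {ι : Type*} {s : Finset ι} {f : ι → E} (h : ∀ i ∈ s, QComm c w (f i)) :
    QComm c w (∑ i ∈ s, f i) := by
  rw [QComm, Finset.sum_mul, Finset.mul_sum, Finset.smul_sum]
  exact Finset.sum_congr rfl h

/-- The commutation is only required when the scalar is nonzero. The character identities attached
to a lifting scalar are available exactly then. -/
theorem smul_left {a : K} (h : a ≠ 0 → QComm c u v) : QComm c (a • u) v := by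
  by_cases ha : a = 0
  · simp [QComm, ha]
  · rw [QComm, smul_mul_assoc, (h ha).eq, mul_smul_comm, smul_comm]

theorem smul_right {a : K} (h : a ≠ 0 → QComm c u v) : QComm c u (a • v) := by
  by_cases ha : a = 0
  · simp [QComm, ha]
  · rw [QComm, smul_mul_assoc, mul_smul_comm, (h ha).eq, smul_comm]

theorem mul_right (h : QComm c u v) (h' : QComm d u w) : QComm (c * d) u (v * w) := by
  rw [QComm, ← mul_assoc, h.eq, smul_mul_assoc, mul_assoc, h'.eq, mul_smul_comm, smul_smul,
    mul_assoc]

theorem mul_left (h : QComm c u w) (h' : QComm d v w) : QComm (c * d) (u * v) w := by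
  rw [QComm, mul_assoc, h'.eq, mul_smul_comm, ← mul_assoc, h.eq, smul_mul_assoc, smul_smul,
    mul_assoc, mul_comm d]

theorem one_left : QComm (1 : K) 1 u := by simp [QComm]

theorem one_right : QComm (1 : K) u 1 := by simp [QComm]

theorem pow_left (h : QComm c u v) (n : ℕ) : QComm (c ^ n) (u ^ n) v := by
  induction n with
  | zero => simpa using one_left
  | succ n ih => rw [pow_succ, pow_succ]; exact ih.mul_left h

theorem pow_right (h : QComm c u v) (n : ℕ) : QComm (c ^ n) u (v ^ n) := by
  induction n with
  | zero => simpa using one_right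
  | succ n ih => rw [pow_succ, pow_succ]; exact ih.mul_right h

theorem symm (h : QComm c u v) (hc : c ≠ 0) : QComm c⁻¹ v u := by
  rw [QComm, h.eq, smul_smul, inv_mul_cancel₀ hc, one_smul]

theorem congr (h : QComm c u v) (hc : c = d) : QComm d u v := hc ▸ h

end QComm

/-! ### `q`-Weyl relations -/

theorem qNum_eq_zero {K : Type*} [Field K] {q : K} {r : ℕ} (hq : IsPrimitiveRoot q r)
    (hr : 1 < r) : qNum q r = 0 := by
  have := geom_sum_mul q r
  rw [hq.pow_eq_one, sub_self] at this
  exact (mul_eq_zero.1 this).resolve_right (sub_ne_zero.2 (hq.ne_one hr))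

theorem qChoose_self {K : Type*} [Field K] (q : K) (n : ℕ) : qChoose q n n = 1 := by
  induction n with
  | zero => simp [qChoose]
  | succ n ih => simp [qChoose, ih, qChoose_eq_zero q n (n + 1) (by omega)]

theorem qChoose_zero {K : Type*} [Field K] (q : K) (n : ℕ) : qChoose q n 0 = 1 := by
  simp [qChoose]

theorem qChoose_primitive_eq_zero {K : Type*} [Field K] {q : K} {r k : ℕ}
    (hq : IsPrimitiveRoot q r) (h0 : 0 < k) (hk : k < r) : qChoose q r k = 0 := by
  have := qFact_mul_qChoose q r k (r - k) (by omega)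
  have hr : qFact q r = 0 := by
    obtain ⟨m, rfl⟩ : ∃ m, r = m + 1 := ⟨r - 1, by omega⟩
    rw [qFact_succ, qNum_eq_zero hq (by omega), mul_zero]
  rw [hr] at this
  exact (mul_eq_zero.1 this).resolve_left
    (mul_ne_zero (qFact_ne_zero hq hk) (qFact_ne_zero hq (by omega)))

theorem qChoose_eq_div {K : Type*} [Field K] {q : K} {n k : ℕ} (hk : k ≤ n)
    (h : qFact q k ≠ 0) (h' : qFact q (n - k) ≠ 0) :
    qChoose q n k = qFact q n / (qFact q k * qFact q (n - k)) := by
  rw [eq_div_iff (mul_ne_zero h h'), mul_comm, qFact_mul_qChoose q n k (n - k) (by omega)]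

/-- The divided power `d^s / (s)!_q`. -/
def qDividedPow {K E : Type*} [Field K] [Ring E] [Algebra K E] (q : K) (d : E) (s : ℕ) : E :=
  (qFact q s)⁻¹ • d ^ s

section Weyl

variable {K E : Type*} [Field K] [Ring E] [Algebra K E] {q : K} {x d : E} {r : ℕ}

theorem pow_mul_of_weyl (h : d * x = 1 + q • (x * d)) (s : ℕ) :
    d ^ (s + 1) * x = q ^ (s + 1) • (x * d ^ (s + 1)) + qNum q (s + 1) • d ^ s := by
  induction s with
  | zero => simp [h, qNum, add_comm]
  | succ s ih =>
    rw [pow_succ' d (s + 1), mul_assoc, ih, mul_add, mul_smul_comm, mul_smul_comm, ← mul_assoc, h,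
      add_mul, one_mul, smul_mul_assoc, smul_add, smul_smul, mul_assoc, ← pow_succ', ← pow_succ',
      ← pow_succ, add_comm (q ^ (s + 1) • d ^ (s + 1)), add_assoc, ← add_smul]
    congr 2
    rw [qNum, qNum, Finset.sum_range_succ _ (s + 1), add_comm]

theorem qDividedPow_mul_of_weyl (h : d * x = 1 + q • (x * d)) {s : ℕ}
    (hs : qFact q (s + 1) ≠ 0) :
    qDividedPow q d (s + 1) * x =
      q ^ (s + 1) • (x * qDividedPow q d (s + 1)) + qDividedPow q d s := by
  rw [qFact_succ] at hs
  simp only [qDividedPow]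
  rw [smul_mul_assoc, pow_mul_of_weyl h, smul_add, smul_smul, smul_smul, mul_smul_comm, smul_smul,
    qFact_succ]
  congr 2
  · ring
  · have h1 := left_ne_zero_of_mul hs
    have h2 := right_ne_zero_of_mul hs
    field_simp

/-- The expansion stops at first order in `a`: a product of two divided powers that occur has total
degree at least `r` in `d`, hence vanishes. The first-order part is a Pascal recursion for `q⁻¹`. -/
theorem add_smul_qDividedPow_pow (hq : IsPrimitiveRoot q r) (h : d * x = 1 + q • (x * d))
    (hd : d ^ r = 0) (a : K) {n : ℕ} (hn : n ≤ r) :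
    (x + a • qDividedPow q d (r - 1)) ^ n = x ^ n + a • ∑ m ∈ Finset.range n,
      qChoose q⁻¹ n (m + 1) • (x ^ (n - (m + 1)) * qDividedPow q d (r - (m + 1))) := by
  induction n with
  | zero => simp
  | succ n ih =>
    have hq0 : q ≠ 0 := hq.ne_zero (by omega)
    have hz : ∀ m ∈ Finset.range n, qDividedPow q d (r - (m + 1)) * qDividedPow q d (r - 1) = 0 := by
      intro m hm
      have := Finset.mem_range.1 hm
      rw [qDividedPow, qDividedPow, smul_mul_smul_comm, ← pow_add,
        pow_eq_zero_of_le (by omega) hd, smul_zero]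
    have hx : ∀ m ∈ Finset.range n,
        (qChoose q⁻¹ n (m + 1) • (x ^ (n - (m + 1)) * qDividedPow q d (r - (m + 1)))) * x =
          (q⁻¹ ^ (m + 1) * qChoose q⁻¹ n (m + 1)) •
            (x ^ (n - m) * qDividedPow q d (r - (m + 1))) +
          qChoose q⁻¹ n (m + 1) • (x ^ (n - (m + 1)) * qDividedPow q d (r - (m + 1 + 1))) := by
      intro m hm
      have hm := Finset.mem_range.1 hm
      obtain ⟨s, hs⟩ : ∃ s, r - (m + 1) = s + 1 := ⟨r - (m + 1) - 1, by omega⟩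
      have hs' : r - (m + 1 + 1) = s := by omega
      -- Here `s + 1 = r - (m + 1)` and `q^r = 1`; this is where `q⁻¹` enters the binomial
      -- coefficients.
      have hpow : q ^ (s + 1) = q⁻¹ ^ (m + 1) := by
        rw [inv_pow]
        refine eq_inv_of_mul_eq_one_left ?_
        rw [← pow_add, ← hs, Nat.sub_add_cancel (by omega), hq.pow_eq_one]
      rw [hs', hs, smul_mul_assoc, mul_assoc,
        qDividedPow_mul_of_weyl h (qFact_ne_zero hq (by omega)), mul_add, smul_add, hpow,
        mul_smul_comm, smul_smul, ← mul_assoc, ← pow_succ, mul_comm (q⁻¹ ^ (m + 1)),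
        show n - (m + 1) + 1 = n - m by omega]
    have e0 : (∑ m ∈ Finset.range n, qChoose q⁻¹ n (m + 1) •
        (x ^ (n - (m + 1)) * qDividedPow q d (r - (m + 1)))) * qDividedPow q d (r - 1) = 0 := by
      rw [Finset.sum_mul]
      refine Finset.sum_eq_zero fun m hm => ?_
      rw [smul_mul_assoc, mul_assoc, hz m hm, mul_zero, smul_zero]
    rw [pow_succ, ih (by omega), mul_add, add_mul, add_mul, smul_mul_assoc, mul_smul_comm,
      mul_smul_comm, smul_mul_assoc, e0, smul_zero, smul_zero, add_zero, Finset.sum_mul,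
      Finset.sum_congr rfl hx, ← pow_succ, add_assoc, ← smul_add]
    congr 2
    rw [Finset.sum_add_distrib]
    have e1 : ∀ m ∈ Finset.range (n + 1),
        qChoose q⁻¹ (n + 1) (m + 1) •
          (x ^ (n + 1 - (m + 1)) * qDividedPow q d (r - (m + 1))) =
        qChoose q⁻¹ n m • (x ^ (n - m) * qDividedPow q d (r - (m + 1))) +
        (q⁻¹ ^ (m + 1) * qChoose q⁻¹ n (m + 1)) •
          (x ^ (n - m) * qDividedPow q d (r - (m + 1))) := by
      intro m _
      rw [← add_smul, qChoose, Nat.add_sub_add_right]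
    rw [Finset.sum_congr rfl e1, Finset.sum_add_distrib, Finset.sum_range_succ' _ n,
      Finset.sum_range_succ _ n, qChoose_eq_zero q⁻¹ n (n + 1) (by omega), qChoose_zero]
    simp only [mul_zero, zero_smul, add_zero, Nat.sub_zero, zero_add, one_smul]
    abel

/-- At `n = r` the inner binomial coefficients vanish at a primitive root of unity, and the last
term is `a` times the zeroth divided power. -/
theorem add_smul_qDividedPow_pow_self (hq : IsPrimitiveRoot q r) (hr : 1 < r)
    (h : d * x = 1 + q • (x * d)) (hd : d ^ r = 0) (hx : x ^ r = 0) (a : K) :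
    (x + a • qDividedPow q d (r - 1)) ^ r = a • 1 := by
  rw [add_smul_qDividedPow_pow hq h hd a le_rfl, hx, zero_add]
  congr 1
  obtain ⟨s, rfl⟩ : ∃ s, r = s + 1 := ⟨r - 1, by omega⟩
  rw [Finset.sum_range_succ, qChoose_self, Finset.sum_eq_zero]
  · simp [qDividedPow, qFact_zero]
  · intro m hm
    have := Finset.mem_range.1 hm
    rw [qChoose_primitive_eq_zero hq.inv (by omega) (by omega), zero_smul]

/-- Repeated use of the additivity of the `r`-th power for `q`-commuting elements. Commutation with
the same `q` is assumed in both orders. -/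
theorem sum_pow_eq_zero_of_qComm {ι : Type*} (hq : IsPrimitiveRoot q r) (hr : 1 < r)
    (s : Finset ι) (f : ι → E) (hf : ∀ i ∈ s, f i ^ r = 0)
    (hc : ∀ i ∈ s, ∀ j ∈ s, i ≠ j → QComm q (f i) (f j)) : (∑ i ∈ s, f i) ^ r = 0 := by
  classical
  induction s using Finset.induction_on with
  | empty => simp [show r ≠ 0 by omega]
  | insert i s hi ih =>
    rw [Finset.sum_insert hi, add_pow_of_q_comm hq hr, hf i (Finset.mem_insert_self i s),
      ih (fun j hj => hf j (Finset.mem_insert_of_mem hj))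
        (fun j hj k hk => hc j (Finset.mem_insert_of_mem hj) k (Finset.mem_insert_of_mem hk)),
      add_zero]
    refine QComm.sum_left fun j hj => ?_
    refine hc j (Finset.mem_insert_of_mem hj) i (Finset.mem_insert_self i s) ?_
    rintro rfl
    exact hi hj

end Weyl

theorem add_smul_add_neg_smul {K E : Type*} [Field K] [AddCommGroup E] [Module K E] (u v : E)
    (c : K) : u + c • v + -c • v = u := by
  rw [neg_smul, add_neg_cancel_right]

namespace QuantumLinearSpace

open Coalgebra

variable {K Γ : Type*} [Field K] [CommGroup Γ] {θ : ℕ} (W : QuantumLinearSpace K Γ θ)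

/-! ### Linked variables -/

section Link

variable {W} {i j k : Fin θ}

theorem chi_mul_eq_one (h : W.χ i * W.χ j = 1) (d : Γ) :
    (W.χ i d : K) * (W.χ j d : K) = 1 := by
  rw [← Units.val_mul, ← MonoidHom.mul_apply, h]
  simp

theorem qls_one_val (h : i ≠ j) : (W.χ i (W.g j) : K) * (W.χ j (W.g i) : K) = 1 := by
  rw [← Units.val_mul, W.qls_one i j h, Units.val_one]

theorem link_symm (h : W.χ i * W.χ j = 1) : W.χ j * W.χ i = 1 :=
  (mul_comm (W.χ j) (W.χ i)).trans h

/-- If `χᵢ χⱼ = ε`, then `χᵢ(g_k) = χ_k(gⱼ)` for `k ≠ j`. -/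
theorem link_apply (h : W.χ i * W.χ j = 1) (hk : k ≠ j) :
    (W.χ i (W.g k) : K) = W.χ k (W.g j) := by
  have h1 := chi_mul_eq_one h (W.g k)
  have h2 := qls_one_val (W := W) hk
  exact mul_right_cancel₀ (Units.ne_zero (W.χ j (W.g k))) (h1.trans h2.symm)

theorem link_self (hij : i ≠ j) (h : W.χ i * W.χ j = 1) :
    (W.χ j (W.g i) : K) = W.χ j (W.g j) ∧ (W.χ j (W.g j) : K) = (W.χ i (W.g i) : K)⁻¹ := by
  have h1 := link_apply (link_symm h) hij.symm
  have h2 := chi_mul_eq_one h (W.g i)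
  exact ⟨h1.symm, h1.trans (eq_inv_of_mul_eq_one_right h2)⟩

/-- Linked vertices have mutually inverse roots of unity. -/
theorem link_r (hij : i ≠ j) (h : W.χ i * W.χ j = 1) : W.r i = W.r j := by
  have h1 := W.qls_two j
  rw [(link_self hij h).2] at h1
  exact (W.qls_two i).inv.unique h1

/-- Two neighbours `j`, `k` of `i` have the same character, so `χⱼ(g_k) χ_k(gⱼ) = 1` becomes
`χᵢ(gᵢ)^{-2} = 1`. Hence `∂ᵢ² = 0` at a vertex with several links, which removes the obstructions
below. -/
theorem link_r_eq_two (hij : i ≠ j) (hik : i ≠ k) (hjk : j ≠ k) (h : W.χ i * W.χ j = 1)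
    (h' : W.χ i * W.χ k = 1) : W.r i = 2 := by
  have e : W.χ j = W.χ k := mul_left_cancel (h.trans h'.symm)
  have h1 := qls_one_val (W := W) hjk
  have h2 := (link_self hij h).2
  have h3 := (link_self hik h').2
  rw [e, h3, ← e, h2, ← mul_inv, inv_eq_one, ← pow_two] at h1
  have := Nat.le_of_dvd two_pos ((W.qls_two i).dvd_of_pow_eq_one _ h1)
  have := W.one_lt_r i
  omega

/-- This makes `∂ᵢ^{rᵢ-1}` obey the commutation rules of `xᵢ`. -/
theorem chi_pow_pred (h : W.χ i ^ W.r i = 1) (d : Γ) :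
    (W.χ i d : K) ^ (W.r i - 1) = (W.χ i d : K)⁻¹ := by
  refine eq_inv_of_mul_eq_one_left ?_
  rw [← pow_succ, Nat.sub_add_cancel (W.one_lt_r i).le, ← Units.val_pow_eq_pow_val,
    ← MonoidHom.pow_apply, h]
  simp

end Link

/-! ### Operators on `B(W) # K[Γ]` -/

/-- Left multiplication by `xᵢ`. -/
def lx (i : Fin θ) : Module.End K W.Biproduct := LinearMap.mulLeft K (W.x i)

/-- Left multiplication by `h`. -/
def lg (h : Γ) : Module.End K W.Biproduct := LinearMap.mulLeft K (W.grp h)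

theorem lx_apply (i : Fin θ) (a : W.Biproduct) : W.lx i a = W.x i * a := rfl

theorem lg_apply (h : Γ) (a : W.Biproduct) : W.lg h a = W.grp h * a := rfl

theorem lg_one : W.lg 1 = 1 := by
  refine LinearMap.ext fun a => ?_
  simp [lg_apply, grp_one]

theorem lg_mul (h k : Γ) : W.lg (h * k) = W.lg h * W.lg k := by
  refine LinearMap.ext fun a => ?_
  simp [lg_apply, grp_mul, mul_assoc]

theorem lg_qComm_lx (h : Γ) (i : Fin θ) : QComm (W.χ i h : K) (W.lg h) (W.lx i) := by
  refine LinearMap.ext fun a => ?_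
  simp [lg_apply, lx_apply, ← mul_assoc, grp_mul_x]

theorem lx_qComm_lx {i j : Fin θ} (h : i ≠ j) :
    QComm (W.χ j (W.g i) : K) (W.lx i) (W.lx j) := by
  refine LinearMap.ext fun a => ?_
  simp [lx_apply, ← mul_assoc, W.x_mul_x h]

theorem lx_pow_r (i : Fin θ) : W.lx i ^ W.r i = 0 := by
  rw [lx, LinearMap.pow_mulLeft, x_pow_r, LinearMap.mulLeft_zero_eq_zero]

theorem der_qComm_lg (i : Fin θ) (h : Γ) : QComm (W.χ i h : K) (W.der i) (W.lg h) := by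
  refine LinearMap.ext fun a => ?_
  simp [lg_apply, der_grp_mul]

theorem der_mul_lx (i : Fin θ) :
    W.der i * W.lx i = 1 + (W.χ i (W.g i) : K) • (W.lx i * W.der i) := by
  refine LinearMap.ext fun a => ?_
  simp [lx_apply, der_x_mul]

theorem der_qComm_lx {i k : Fin θ} (h : i ≠ k) :
    QComm (W.χ i (W.g k) : K) (W.der i) (W.lx k) := by
  refine LinearMap.ext fun a => ?_
  simp [lx_apply, der_x_mul, h.symm]

theorem der_qComm_der {i l : Fin θ} (h : i ≠ l) :
    QComm (W.χ l (W.g i) : K) (W.der i) (W.der l) := W.der_mul_der h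

/-- The divided power `∂ᵢ^{rᵢ-1} / (rᵢ-1)!`. -/
def topDer (i : Fin θ) : Module.End K W.Biproduct :=
  qDividedPow (W.χ i (W.g i) : K) (W.der i) (W.r i - 1)

/-! ### The operators that generate the Galois object. -/

namespace LiftingScalars

variable {W} (L : W.LiftingScalars)

/-- The scalar `a_{ki}` if `i < k`, and `0` otherwise. -/
def low (k i : Fin θ) : K := if i < k then L.aa k i else 0

theorem lt_of_low {k i : Fin θ} (h : L.low k i ≠ 0) : i < k := by
  by_contra hn
  exact h (if_neg hn)

theorem chi_of_low {k i : Fin θ} (h : L.low k i ≠ 0) : W.χ k * W.χ i = 1 := by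
  have hlt := L.lt_of_low h
  rw [low, if_pos hlt] at h
  exact (L.of_aa_ne_zero k i hlt.ne' h).2

/-- The operators `Σ_{i<k} a_{ki} ∂ᵢ + a_k ∂_k^{r_k-1} / (r_k-1)!`. -/
def lowOp (k : Fin θ) : Module.End K W.Biproduct :=
  ∑ i, L.low k i • W.der i + L.a k • W.topDer k

/-- The operators `x_k + Σ_{i<k} a_{ki} ∂ᵢ + a_k ∂_k^{r_k-1} / (r_k-1)!`. -/
def genOp (k : Fin θ) : Module.End K W.Biproduct := W.lx k + L.lowOp k

/-- Every summand has character `χ_k`: `∂ᵢ` has `χᵢ⁻¹ = χ_k` at a link, and `∂_k^{r_k-1}` has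
`χ_k^{-(r_k-1)} = χ_k` when `a_k ≠ 0`. -/
theorem lg_qComm_genOp (h : Γ) (k : Fin θ) : QComm (W.χ k h : K) (W.lg h) (L.genOp k) := by
  refine (W.lg_qComm_lx h k).add_right ((QComm.sum_right fun i _ => ?_).add_right ?_)
  · refine QComm.smul_right fun hi => ?_
    refine ((W.der_qComm_lg i h).symm (Units.ne_zero _)).congr ?_
    exact inv_eq_of_mul_eq_one_left (chi_mul_eq_one (L.chi_of_low hi) h)
  · refine QComm.smul_right fun hi => QComm.smul_right fun _ => ?_
    refine ((((W.der_qComm_lg k h).pow_left _).symm (pow_ne_zero _ (Units.ne_zero _)))).congr ?_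
    rw [chi_pow_pred (L.of_a_ne_zero k hi).2, inv_inv]

theorem der_pow_qComm_genOp {i k : Fin θ} (hik : i < k) (s : ℕ)
    (hs : L.low k i ≠ 0 → W.der i ^ (s + 1) = 0) :
    QComm ((W.χ i (W.g k) : K) ^ s) (W.der i ^ s) (L.genOp k) := by
  refine ((W.der_qComm_lx hik.ne).pow_left s).add_right
    ((QComm.sum_right fun l _ => ?_).add_right ?_)
  · refine QComm.smul_right fun hl => ?_
    by_cases h : i = l
    -- The summand `∂ᵢ` of `genOp k` commutes with `∂ᵢ^s` with constant `1`, which need not be the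
    -- required one. The relation is saved by the vanishing of `∂ᵢ^{s+1}`.
    · subst h
      rw [QComm, ← pow_succ, ← pow_succ', hs hl, smul_zero]
    · refine ((W.der_qComm_der h).pow_left s).congr ?_
      rw [link_apply (link_symm (L.chi_of_low hl)) hik.ne]
  · refine QComm.smul_right fun hk => QComm.smul_right fun _ => ?_
    refine (((W.der_qComm_der hik.ne).pow_right _).pow_left s).congr ?_
    rw [chi_pow_pred (L.of_a_ne_zero k hk).2]
    congr 1
    exact (eq_inv_of_mul_eq_one_left (qls_one_val hik.ne)).symm

/-- Only the summand `∂ⱼ` meets its own variable `xⱼ`, and the `q`-Weyl relation yields the constant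
`a_{kj}`. -/
theorem lowOp_mul_lx {j k : Fin θ} (h : j < k) :
    L.lowOp k * W.lx j = (W.χ j (W.g k) : K) • (W.lx j * L.lowOp k) + L.aa k j • 1 := by
  have h1 : ∀ i, (L.low k i • W.der i) * W.lx j =
      (W.χ j (W.g k) : K) • (W.lx j * (L.low k i • W.der i)) +
        (if i = j then L.aa k j • 1 else 0) := by
    intro i
    by_cases hi : L.low k i = 0
    · rw [hi]
      split_ifs with hij
      · subst hij
        rw [low, if_pos h] at hi
        simp [hi]
      · simp
    · have hc : (W.χ i (W.g j) : K) = W.χ j (W.g k) :=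
        link_apply (link_symm (L.chi_of_low hi)) h.ne
      split_ifs with hij
      · subst hij
        rw [smul_mul_assoc, der_mul_lx, hc, low, if_pos h, smul_add, mul_smul_comm, smul_smul,
          smul_smul, mul_comm, add_comm]
      · rw [smul_mul_assoc, (W.der_qComm_lx hij).eq, hc, mul_smul_comm, smul_smul, smul_smul,
          mul_comm, add_zero]
  have h2 : QComm (W.χ j (W.g k) : K) (L.a k • W.topDer k) (W.lx j) := by
    refine QComm.smul_left fun hk => QComm.smul_left fun _ => ?_
    refine ((W.der_qComm_lx h.ne').pow_left _).congr ?_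
    rw [chi_pow_pred (L.of_a_ne_zero k hk).2]
    exact (eq_inv_of_mul_eq_one_left (qls_one_val h.ne)).symm
  rw [lowOp, add_mul, Finset.sum_mul, Finset.sum_congr rfl fun i _ => h1 i, h2.eq,
    Finset.sum_add_distrib, Finset.sum_ite_eq' Finset.univ j, if_pos (Finset.mem_univ j), mul_add,
    Finset.mul_sum, smul_add, Finset.smul_sum]
  abel

theorem der_sq_eq_zero {i j k : Fin θ} (hij : i ≠ j) (hik : i ≠ k) (hjk : j ≠ k)
    (h : W.χ i * W.χ j = 1) (h' : W.χ i * W.χ k = 1) : W.der i ^ 2 = 0 := by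
  have := W.der_pow_r i
  rwa [link_r_eq_two hij hik hjk h h'] at this

/-- A clash with the same derivation in `genOp k` is harmless: if `i` is linked to both `j` and `k`
then `∂ᵢ² = 0`, and for the top power of `∂ⱼ` one uses `∂ⱼ^{rⱼ} = 0`. -/
theorem lowOp_qComm_genOp {j k : Fin θ} (h : j < k) :
    QComm (W.χ k (W.g j) : K) (L.lowOp j) (L.genOp k) := by
  refine (QComm.sum_left fun i _ => ?_).add_left ?_
  · refine QComm.smul_left fun hi => ?_
    have hij := L.lt_of_low hi
    have hc := link_symm (L.chi_of_low hi)
    have := L.der_pow_qComm_genOp (hij.trans h) 1 fun hk => der_sq_eq_zero hij.ne (hij.trans h).ne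
      h.ne hc (link_symm (L.chi_of_low hk))
    rw [pow_one, pow_one] at this
    exact this.congr (link_apply hc h.ne')
  · refine QComm.smul_left fun hj => QComm.smul_left fun _ => ?_
    refine (L.der_pow_qComm_genOp h (W.r j - 1) fun _ => ?_).congr ?_
    · rw [Nat.sub_add_cancel (W.one_lt_r j).le, der_pow_r]
    · rw [chi_pow_pred (L.of_a_ne_zero j hj).2]
      exact (eq_inv_of_mul_eq_one_left (qls_one_val h.ne')).symm

/-- Among the products in the expansion only `xⱼ` times `lowOp k` leaves a constant, namely
`-χ_k(gⱼ) a_{kj} = a_{jk}`. -/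
theorem genOp_mul_genOp_of_lt {j k : Fin θ} (h : j < k) :
    L.genOp j * L.genOp k = (W.χ k (W.g j) : K) • (L.genOp k * L.genOp j) + L.aa j k • 1 := by
  have h0 : (W.χ k (W.g j) : K) * (W.χ j (W.g k) : K) = 1 := qls_one_val h.ne'
  have h1 : W.lx j * L.lowOp k =
      (W.χ k (W.g j) : K) • (L.lowOp k * W.lx j) + L.aa j k • 1 := by
    rw [L.lowOp_mul_lx h, smul_add, smul_smul, smul_smul, h0, one_smul,
      L.aa_swap k j h.ne', neg_mul, add_smul_add_neg_smul]
  have hj : L.genOp j = W.lx j + L.lowOp j := rfl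
  have hk : L.genOp k = W.lx k + L.lowOp k := rfl
  have h2 : L.genOp j * L.genOp k =
      W.lx j * W.lx k + W.lx j * L.lowOp k + L.lowOp j * L.genOp k := by
    rw [hj, add_mul]
    nth_rewrite 1 [hk]
    rw [mul_add]
  have h3 : L.genOp k * L.genOp j =
      W.lx k * W.lx j + L.lowOp k * W.lx j + L.genOp k * L.lowOp j := by
    rw [hj, mul_add]
    nth_rewrite 1 [hk]
    rw [add_mul]
  rw [h2, h3, h1, (W.lx_qComm_lx h.ne).eq, (L.lowOp_qComm_genOp h).eq, smul_add, smul_add]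
  abel

theorem genOp_mul_genOp {j k : Fin θ} (h : j ≠ k) :
    L.genOp j * L.genOp k = (W.χ k (W.g j) : K) • (L.genOp k * L.genOp j) + L.aa j k • 1 := by
  rcases lt_or_gt_of_ne h with hlt | hgt
  · exact L.genOp_mul_genOp_of_lt hlt
  · have h0 : (W.χ k (W.g j) : K) * (W.χ j (W.g k) : K) = 1 := qls_one_val h.symm
    rw [L.genOp_mul_genOp_of_lt hgt, smul_add, smul_smul, smul_smul, h0, one_smul,
      L.aa_swap k j h.symm, neg_mul, add_smul_add_neg_smul]

/-- Split `genOp j` into `u = xⱼ + aⱼ ∂ⱼ^{rⱼ-1}/(rⱼ-1)!` and the sum `v` of the `a_{ji} ∂ᵢ`. They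
`q⁻¹`-commute for `q = χⱼ(gⱼ)`, so the `rⱼ`-th power is additive, with `v^{rⱼ} = 0` and `u^{rⱼ} =
aⱼ`. -/
theorem genOp_pow_r (j : Fin θ) : L.genOp j ^ W.r j = L.a j • 1 := by
  have hq := (W.qls_two j).inv
  have hv : (∑ i, L.low j i • W.der i) ^ W.r j = 0 := by
    refine sum_pow_eq_zero_of_qComm hq (W.one_lt_r j) _ _ ?_ ?_
    · intro i _
      by_cases hi : L.low j i = 0
      · rw [hi, zero_smul, zero_pow (by have := W.one_lt_r j; omega)]
      · rw [smul_pow, link_r (L.lt_of_low hi).ne' (L.chi_of_low hi), der_pow_r, smul_zero]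
    · intro i _ l _ hil
      refine QComm.smul_left fun hi => QComm.smul_right fun hl => ?_
      refine (W.der_qComm_der hil).congr ?_
      rw [link_apply (link_symm (L.chi_of_low hl)) (L.lt_of_low hi).ne]
      have := link_self (L.lt_of_low hi).ne' (L.chi_of_low hi)
      have h3 := chi_mul_eq_one (L.chi_of_low hi) (W.g j)
      exact eq_inv_of_mul_eq_one_right h3
  have hu := add_smul_qDividedPow_pow_self (W.qls_two j) (W.one_lt_r j) (W.der_mul_lx j)
    (W.der_pow_r j) (W.lx_pow_r j) (L.a j)
  have hvu : QComm (W.χ j (W.g j) : K)⁻¹ (∑ i, L.low j i • W.der i)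
      (W.lx j + L.a j • W.topDer j) := by
    refine QComm.sum_left fun i _ => QComm.smul_left fun hi => ?_
    have h3 : (W.χ i (W.g j) : K) = (W.χ j (W.g j) : K)⁻¹ :=
      eq_inv_of_mul_eq_one_right (chi_mul_eq_one (L.chi_of_low hi) (W.g j))
    have hne := (L.lt_of_low hi).ne
    rw [← h3]
    refine (W.der_qComm_lx hne).add_right (QComm.smul_right fun hj => QComm.smul_right fun _ => ?_)
    refine ((W.der_qComm_der hne).pow_right _).congr ?_
    rw [chi_pow_pred (L.of_a_ne_zero j hj).2]
    exact (eq_inv_of_mul_eq_one_left (qls_one_val hne)).symm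
  have := add_pow_of_q_comm hq (W.one_lt_r j) _ _ hvu
  rw [hv, add_zero, topDer, hu] at this
  rw [← this, genOp, lowOp, topDer]
  congr 1
  abel

/-- The representation of `T(W) # K[Γ]` on `B(W) # K[Γ]` in which `x_k` acts by
`x_k + Σ_{i<k} a_{ki} ∂ᵢ + a_k ∂_k^{r_k-1} / (r_k-1)!`. -/
def rep : W.TensorBos →ₐ[K] Module.End K W.Biproduct :=
  W.tensorLift W.lg L.genOp W.lg_one W.lg_mul L.lg_qComm_genOp

theorem rep_grp (h : Γ) : L.rep (W.tensorGrp h) = W.lg h := W.tensorLift_grp _ _ _ _ _ h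

theorem rep_X (k : Fin θ) : L.rep (W.tensorX k) = L.genOp k := W.tensorLift_X _ _ _ _ _ k

end LiftingScalars

/-- Right colinear operators on `B(W) # K[Γ]`. -/
def IsColinear (F : Module.End K W.Biproduct) : Prop :=
  ∀ a, comul (R := K) (F a) = TensorProduct.map F LinearMap.id (comul a)

section IsColinear

variable {W} {F F' : Module.End K W.Biproduct}

theorem IsColinear.add (h : W.IsColinear F) (h' : W.IsColinear F') : W.IsColinear (F + F') := by
  intro a
  rw [LinearMap.add_apply, map_add, h a, h' a, TensorProduct.map_add_left, LinearMap.add_apply]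

theorem IsColinear.smul (h : W.IsColinear F) (c : K) : W.IsColinear (c • F) := by
  intro a
  rw [LinearMap.smul_apply, map_smul, h a, TensorProduct.map_smul_left, LinearMap.smul_apply]

theorem IsColinear.sum {ι : Type*} {s : Finset ι} {f : ι → Module.End K W.Biproduct}
    (h : ∀ i ∈ s, W.IsColinear (f i)) : W.IsColinear (∑ i ∈ s, f i) := by
  classical
  induction s using Finset.induction_on with
  | empty => intro a; simp
  | insert i s hi ih =>
    rw [Finset.sum_insert hi]
    exact (h i (Finset.mem_insert_self i s)).add
      (ih fun j hj => h j (Finset.mem_insert_of_mem hj))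

theorem IsColinear.pow (h : W.IsColinear F) (n : ℕ) : W.IsColinear (F ^ n) := by
  induction n with
  | zero => intro a; rw [pow_zero, Module.End.one_eq_id, TensorProduct.map_id]; rfl
  | succ n ih =>
    intro a
    rw [pow_succ', Module.End.mul_apply, h, ih, Module.End.mul_eq_comp,
      ← LinearMap.comp_id (LinearMap.id : W.Biproduct →ₗ[K] W.Biproduct), TensorProduct.map_comp]
    rfl

theorem isColinear_leftHit (f : W.Biproduct →ₗ[K] K) : W.IsColinear (leftHit f) := fun a =>
  LinearMap.congr_fun (comul_comp_leftHit f) a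

theorem isColinear_der (i : Fin θ) : W.IsColinear (W.der i) := isColinear_leftHit _

end IsColinear

theorem der_mul_grp (i : Fin θ) (a : W.Biproduct) (h : Γ) :
    W.der i (a * W.grp h) = W.der i a * W.grp h := by
  refine LinearMap.congr_fun (W.linearMap_ext_left
    (F := W.der i ∘ₗ LinearMap.mulRight K (W.grp h))
    (F' := LinearMap.mulRight K (W.grp h) ∘ₗ W.der i) ?_ ?_ ?_) a
  · simp only [LinearMap.comp_apply, LinearMap.mulRight_apply, one_mul, der_one, zero_mul]
    rw [← mul_one (W.grp h), der_grp_mul, der_one, mul_zero, smul_zero]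
  · intro d a ha
    simp only [LinearMap.comp_apply, LinearMap.mulRight_apply] at ha ⊢
    rw [mul_assoc, der_grp_mul, ha, der_grp_mul, smul_mul_assoc, mul_assoc]
  · intro k a ha
    simp only [LinearMap.comp_apply, LinearMap.mulRight_apply] at ha ⊢
    rw [mul_assoc, der_x_mul, ha, der_x_mul, add_mul, smul_mul_assoc, mul_assoc]
    congr 1
    split_ifs <;> simp

/-- The linear section `x₁^{n₁} ⋯ x_θ^{n_θ} h ↦ x₁^{n₁} ⋯ x_θ^{n_θ} h` of the projection of
`T(W) # K[Γ]` onto `B(W) # K[Γ]`. -/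
def sec : W.Biproduct →ₗ[K] W.TensorBos :=
  W.pbwBasis.constr K fun s =>
    listMono W.tensorX (fun i => s.1 i) (List.finRange θ) * W.tensorGrp s.2

theorem sec_pbw {n : Fin θ → ℕ} (hn : ∀ i, n i < W.r i) (h : Γ) :
    W.sec (W.pbw n (List.finRange θ) h) =
      listMono W.tensorX n (List.finRange θ) * W.tensorGrp h := by
  have := W.pbwBasis_apply (fun i => ⟨n i, hn i⟩, h)
  simp only at this
  rw [← this, sec, Module.Basis.constr_basis]

/-- It is enough to test `H`-bilinearity on `Γ`. -/
theorem isHBilinear_of_grp {γ : BiForm K W.Biproduct}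
    (hγ : ∀ (h h' : Γ) (a b : W.Biproduct),
      γ ((W.grp h * a) ⊗ₜ (b * W.grp h')) = γ (a ⊗ₜ b)) : IsHBilinear W.incl γ := by
  intro h h' a b
  induction h using MonoidAlgebra.induction_linear with
  | zero => simp
  | add u v hu hv =>
    rw [map_add, map_add, add_mul, TensorProduct.add_tmul, add_mul, add_mul, ← hu, ← hv]
    exact map_add γ.ofConv _ _
  | single d c =>
    induction h' using MonoidAlgebra.induction_linear with
    | zero => simp
    | add u v hu hv =>
      rw [map_add, map_add, mul_add, TensorProduct.tmul_add, mul_add, add_mul, ← hu, ← hv]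
      exact map_add γ.ofConv _ _
    | single d' c' =>
      rw [incl_single, incl_single, smul_mul_assoc, mul_smul_comm, TensorProduct.tmul_smul,
        ← TensorProduct.smul_tmul']
      have := hγ d d' a b
      simp only [MonoidAlgebra.counit_single, CommSemiring.counit_apply]
      rw [← this]
      simp only [map_smul, smul_eq_mul]
      ring

/-! ### The Galois object and its cocycle. -/

namespace LiftingScalars

variable {W} (L : W.LiftingScalars)

/-- The relations `xᵢ^{rᵢ} = aᵢ` and `xᵢ xⱼ = χⱼ(gᵢ) xⱼ xᵢ + a_{ij}`. -/
structure IsGaloisRep {E : Type*} [Ring E] [Algebra K E] (f : W.TensorBos →ₐ[K] E) : Prop where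
  pow : ∀ i, f (W.tensorX i) ^ W.r i = L.a i • 1
  comm : ∀ i j, i ≠ j → f (W.tensorX i) * f (W.tensorX j) =
    (W.χ j (W.g i) : K) • (f (W.tensorX j) * f (W.tensorX i)) + L.aa i j • 1

theorem isGaloisRep_rep : L.IsGaloisRep L.rep where
  pow i := by rw [rep_X, genOp_pow_r]
  comm i j h := by rw [rep_X, rep_X, L.genOp_mul_genOp h]

/-- The links in `genOp k` involve only `∂ᵢ` with `i < k`, which kill `x_k^s y`. The top power
`∂_k^{r_k-1}` only meets exponents below `r_k - 1`. -/
theorem genOp_pow_apply {k : Fin θ} {y : W.Biproduct} (hy : ∀ i ≤ k, W.der i y = 0) {m : ℕ}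
    (hm : m < W.r k) : (L.genOp k ^ m) y = W.x k ^ m * y := by
  have hder : ∀ i < k, ∀ s, W.der i (W.x k ^ s * y) = 0 := by
    intro i hi s
    rw [der, skewOp_x_pow_mul_of_ne hi.ne', show W.skewOp i _ _ _ y = 0 from hy i hi.le, mul_zero,
      smul_zero]
  induction m with
  | zero => simp
  | succ m ih =>
    have htop : W.topDer k (W.x k ^ m * y) = 0 := by
      rw [topDer, qDividedPow, LinearMap.smul_apply, der, lowering_pow_eq_zero
        (skewOp_x_pow_succ (W.der_qNum k) (hy k le_rfl) (c := 1) (by rw [scale_trivial]; simp))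
        (hy k le_rfl) (by omega), smul_zero]
    rw [pow_succ', Module.End.mul_apply, ih (by omega), genOp, LinearMap.add_apply, lx_apply,
      lowOp, LinearMap.add_apply, LinearMap.smul_apply, htop, smul_zero, add_zero,
      LinearMap.sum_apply, Finset.sum_eq_zero, add_zero, pow_succ', mul_assoc]
    intro i _
    by_cases hi : L.low k i = 0
    · simp [hi]
    · rw [LinearMap.smul_apply, hder i (L.lt_of_low hi), smul_zero]

/-- A monomial is built from the right, largest index first, so each `genOp k` acts on a vector
killed by all `∂ᵢ` with `i ≤ k`. The condition `i < k` in the lowering terms is made for this. -/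
theorem listMono_genOp_apply {n : Fin θ → ℕ} (hn : ∀ i, n i < W.r i) {l : List (Fin θ)}
    (hl : l.Pairwise (· < ·)) (h : Γ) : (listMono L.genOp n l * W.lg h) 1 = W.pbw n l h := by
  induction l with
  | nil => rw [listMono_nil, one_mul, lg_apply, mul_one, pbw_nil]
  | cons k l ih =>
    rw [List.pairwise_cons] at hl
    rw [listMono_cons, mul_assoc, Module.End.mul_apply, ih hl.2, pbw_cons]
    refine L.genOp_pow_apply (fun i hi => skewOp_pbw_of_notMem (fun hil => ?_) n h) (hn k)
    exact absurd (hl.1 i hil) (not_lt.2 hi)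

theorem rep_listMono (n : Fin θ → ℕ) (l : List (Fin θ)) (h : Γ) :
    L.rep (listMono W.tensorX n l * W.tensorGrp h) = listMono L.genOp n l * W.lg h := by
  rw [map_mul, map_listMono, rep_grp]
  simp only [rep_X]

theorem rep_sec_one (a : W.Biproduct) : L.rep (W.sec a) 1 = a := by
  refine LinearMap.congr_fun (W.linearMap_ext_pbw
    (F := (LinearMap.applyₗ (1 : W.Biproduct)) ∘ₗ L.rep.toLinearMap ∘ₗ W.sec)
    (F' := LinearMap.id) fun n h hn => ?_) a
  simp only [LinearMap.comp_apply, W.sec_pbw hn, AlgHom.toLinearMap_apply, rep_listMono,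
    LinearMap.applyₗ_apply_apply]
  exact L.listMono_genOp_apply hn (List.pairwise_lt_finRange θ) h

/-- The Galois object of the scalars embeds in the operators on `B(W) # K[Γ]`, and there it acts
faithfully on `1`. -/
theorem IsGaloisRep.eq_zero {L : W.LiftingScalars} {E : Type*} [Ring E] [Algebra K E]
    {f : W.TensorBos →ₐ[K] E}
    (hf : L.IsGaloisRep f) {t : W.TensorBos} (ht : L.rep t 1 = 0) : f t = 0 := by
  have hg : ∀ c : K, c • (1 : E × Module.End K W.Biproduct) ∈ W.grpSpan (f.prod L.rep) := by
    intro c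
    refine Submodule.smul_mem _ c (Submodule.subset_span ⟨1, ?_⟩)
    simp only [tensorGrp_one, map_one]
  -- Expanding `(f(t), ρ(t))` in monomials gives common coefficients for both components. The second
  -- one, evaluated at `1`, is an expansion in the PBW basis of `A`, so all coefficients vanish.
  have hmem := W.map_mem_monoSpan (f.prod L.rep) (by
      intro i j hij
      have : f.prod L.rep (W.tensorX i) * f.prod L.rep (W.tensorX j) -
          (W.χ j (W.g i) : K) • (f.prod L.rep (W.tensorX j) * f.prod L.rep (W.tensorX i)) =
          L.aa i j • 1 := by
        rw [sub_eq_iff_eq_add']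
        exact Prod.ext (hf.comm i j hij) (L.isGaloisRep_rep.comm i j hij)
      rw [this]
      exact hg _) (by
      intro i
      have : f.prod L.rep (W.tensorX i) ^ W.r i = L.a i • 1 :=
        Prod.ext (hf.pow i) (L.isGaloisRep_rep.pow i)
      rw [this]
      exact hg _) t
  have hset : W.monoSpan (f.prod L.rep) ≤ Submodule.span K (Set.range fun s :
      (∀ i, Fin (W.r i)) × Γ => f.prod L.rep
        (listMono W.tensorX (fun i => s.1 i) (List.finRange θ) * W.tensorGrp s.2)) := by
    refine Submodule.span_mono ?_
    rintro _ ⟨n, h, hn, rfl⟩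
    refine ⟨(fun i => ⟨n i, hn i⟩, h), ?_⟩
    simp only [map_mul, map_listMono]
  obtain ⟨c, hc⟩ := (Finsupp.mem_span_range_iff_exists_finsupp).1 (hset hmem)
  have h2 : c.sum (fun s e => e • W.pbwBasis s) = 0 := by
    rw [← ht]
    have := congrArg (fun p : E × Module.End K W.Biproduct => p.2 1) hc
    simp only [AlgHom.prod_apply] at this
    rw [← this, Finsupp.sum, Finsupp.sum, Prod.snd_sum, LinearMap.sum_apply]
    refine Finset.sum_congr rfl fun s _ => ?_
    rw [Prod.smul_snd, LinearMap.smul_apply, rep_listMono,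
      L.listMono_genOp_apply (fun i => (s.1 i).2) (List.pairwise_lt_finRange θ), pbwBasis_apply]
  have h3 : c = 0 := linearIndependent_iff.1 W.pbwBasis.linearIndependent c h2
  rw [h3, Finsupp.sum_zero_index] at hc
  exact (congrArg Prod.fst hc).symm

theorem IsGaloisRep.sec_rep {L : W.LiftingScalars} {E : Type*} [Ring E] [Algebra K E]
    {f : W.TensorBos →ₐ[K] E}
    (hf : L.IsGaloisRep f) (t : W.TensorBos) : f (W.sec (L.rep t 1)) = f t := by
  rw [← sub_eq_zero, ← map_sub]
  refine hf.eq_zero ?_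
  rw [map_sub, LinearMap.sub_apply, rep_sec_one, sub_self]

/-- The multiplication of the Galois object, transported to `B(W) # K[Γ]`. -/
def circ : W.Biproduct →ₗ[K] Module.End K W.Biproduct := L.rep.toLinearMap ∘ₗ W.sec

theorem circ_rep (t : W.TensorBos) : L.circ (L.rep t 1) = L.rep t :=
  L.isGaloisRep_rep.sec_rep t

theorem circ_apply_one (a : W.Biproduct) : L.circ a 1 = a := L.rep_sec_one a

theorem circ_one : L.circ 1 = 1 := by
  have := L.circ_rep 1
  rwa [map_one L.rep, Module.End.one_apply] at this

/-- Associativity of the transported product. -/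
theorem circ_circ (a b : W.Biproduct) : L.circ (L.circ a b) = L.circ a * L.circ b := by
  have h : L.circ a b = L.rep (W.sec a * W.sec b) 1 := by
    rw [map_mul, Module.End.mul_apply, rep_sec_one]
    rfl
  rw [h, circ_rep, map_mul]
  rfl

theorem circ_grp_mul (h : Γ) (a : W.Biproduct) : L.circ (W.grp h * a) = W.lg h * L.circ a := by
  have := L.circ_rep (W.tensorGrp h * W.sec a)
  rwa [map_mul, rep_grp, Module.End.mul_apply, rep_sec_one] at this

theorem rep_mul_grp (t : W.TensorBos) (a : W.Biproduct) (h : Γ) :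
    L.rep t (a * W.grp h) = L.rep t a * W.grp h := by
  have hpow : ∀ i n (a : W.Biproduct), (W.der i ^ n) (a * W.grp h) = (W.der i ^ n) a * W.grp h := by
    intro i n
    induction n with
    | zero => simp
    | succ n ih => intro a; rw [pow_succ, Module.End.mul_apply, der_mul_grp, ih,
        Module.End.mul_apply]
  have hgen : ∀ k (a : W.Biproduct), L.genOp k (a * W.grp h) = L.genOp k a * W.grp h := by
    intro k a
    simp only [genOp, lowOp, topDer, qDividedPow, LinearMap.add_apply, LinearMap.sum_apply,
      LinearMap.smul_apply, lx_apply, hpow, der_mul_grp, add_mul, Finset.sum_mul, smul_mul_assoc,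
      mul_assoc]
  let p : Submodule K W.TensorBos :=
    { carrier := {t | ∀ a, L.rep t (a * W.grp h) = L.rep t a * W.grp h}
      zero_mem' := by simp
      add_mem' := by
        intro u v hu hv a
        rw [map_add, LinearMap.add_apply, hu, hv, LinearMap.add_apply, add_mul]
      smul_mem' := by
        intro c u hu a
        rw [map_smul, LinearMap.smul_apply, hu, LinearMap.smul_apply, smul_mul_assoc] }
  refine W.tensorBos_left_induction p ?_ ?_ ?_ t a
  · intro a
    simp
  · intro d t ht a
    rw [map_mul L.rep, Module.End.mul_apply, ht, rep_grp, Module.End.mul_apply, lg_apply,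
      lg_apply, mul_assoc]
  · intro k t ht a
    rw [map_mul L.rep, Module.End.mul_apply, ht, rep_X, hgen, Module.End.mul_apply]

/-- The action of `T(W) # K[Γ]` on `A ⊗ A`, `A = B(W) # K[Γ]`, by `ρ(t₁) ⊗ t₂`. -/
def tensorRep : W.TensorBos →ₐ[K] Module.End K (W.Biproduct ⊗[K] W.Biproduct) :=
  (Module.endTensorEndAlgHom (R := K) (S := K) (A := K)).comp
    ((Algebra.TensorProduct.map L.rep ((Algebra.lmul K W.Biproduct).comp W.proj)).comp
      W.tensorComul)

theorem tensorRep_repr {ι : Type*} {t : W.TensorBos} (R : Repr K t ι) :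
    L.tensorRep t = ∑ i ∈ R.index, TensorProduct.map (L.rep (R.left i))
      (LinearMap.mulLeft K (W.proj (R.right i))) := by
  have h : W.tensorComul t = ∑ i ∈ R.index, R.left i ⊗ₜ R.right i := R.eq.symm
  rw [tensorRep, AlgHom.comp_apply, AlgHom.comp_apply, h, map_sum, map_sum]
  rfl

theorem isColinear_lowOp (k : Fin θ) : W.IsColinear (L.lowOp k) :=
  (IsColinear.sum fun i _ => (isColinear_der i).smul _).add
    (((isColinear_der k).pow _).smul _ |>.smul _)

/-- `x_k` acts on `A` compatibly with `Δ(x_k)`: the lowering part is right colinear and so affects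
only the left tensor factor. -/
theorem comul_rep (t : W.TensorBos) (a : W.Biproduct) :
    comul (R := K) (L.rep t a) = L.tensorRep t (comul a) := by
  have hgrp : ∀ h, L.tensorRep (W.tensorGrp h) = TensorProduct.map (W.lg h) (W.lg h) := by
    intro h
    rw [tensorRep, AlgHom.comp_apply, AlgHom.comp_apply, tensorComul_grp,
      Algebra.TensorProduct.map_tmul, rep_grp]
    rfl
  have hX : ∀ k, L.tensorRep (W.tensorX k) = TensorProduct.map (L.genOp k) LinearMap.id +
      TensorProduct.map (W.lg (W.g k)) (W.lx k) := by
    intro k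
    rw [tensorRep, AlgHom.comp_apply, AlgHom.comp_apply, tensorComul_X, map_add, map_add,
      Algebra.TensorProduct.map_tmul, Algebra.TensorProduct.map_tmul, rep_grp, rep_X, map_one]
    rfl
  have hlg : ∀ h (c : W.Biproduct), comul (R := K) (W.lg h c) =
      TensorProduct.map (W.lg h) (W.lg h) (comul c) := by
    intro h c
    rw [lg_apply, Bialgebra.comul_mul, comul_grp, ← (ℛ K c).eq, Finset.mul_sum, map_sum]
    simp [lg_apply]
  have hlx : ∀ k (c : W.Biproduct), comul (R := K) (W.lx k c) =
      TensorProduct.map (W.lx k) LinearMap.id (comul c) +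
        TensorProduct.map (W.lg (W.g k)) (W.lx k) (comul c) := by
    intro k c
    rw [lx_apply, Bialgebra.comul_mul, comul_x, ← (ℛ K c).eq, Finset.mul_sum, map_sum, map_sum,
      ← Finset.sum_add_distrib]
    simp [lg_apply, lx_apply, add_mul]
  let p : Submodule K W.TensorBos :=
    { carrier := {t | ∀ a, comul (R := K) (L.rep t a) = L.tensorRep t (comul a)}
      zero_mem' := by simp
      add_mem' := by
        intro u v hu hv a
        rw [map_add, LinearMap.add_apply, map_add, hu, hv, map_add, LinearMap.add_apply]
      smul_mem' := by
        intro c u hu a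
        rw [map_smul, LinearMap.smul_apply, map_smul, hu, map_smul, LinearMap.smul_apply] }
  refine W.tensorBos_left_induction p ?_ ?_ ?_ t a
  · intro a
    rw [map_one, map_one]
    rfl
  · intro d t ht a
    rw [map_mul, Module.End.mul_apply, rep_grp, hlg, ht, map_mul, hgrp]
    rfl
  · intro k t ht a
    rw [map_mul, Module.End.mul_apply, rep_X, genOp, LinearMap.add_apply, map_add, hlx,
      L.isColinear_lowOp k, ht, map_mul, hX, genOp, TensorProduct.map_add_left]
    simp only [Module.End.mul_apply, LinearMap.add_apply]
    abel

/-- The form `a ⊗ b ↦ ε(a ∘ b)`, where `∘` is the multiplication of the Galois object. -/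
def sigma : BiForm K W.Biproduct :=
  WithConv.toConv (counit ∘ₗ TensorProduct.lift L.circ)

theorem sigma_tmul (a b : W.Biproduct) : L.sigma (a ⊗ₜ b) = counit (R := K) (L.circ a b) := rfl

/-- By `comul_rep`, `Δ(a ∘ b) = (a₁ ∘ b₁) ⊗ a₂ b₂`; apply `ε` to the left factor. -/
theorem circ_repr {ι κ : Type*} {a b : W.Biproduct} (Ra : Repr K a ι) (Rb : Repr K b κ) :
    L.circ a b = ∑ i ∈ Ra.index, ∑ j ∈ Rb.index,
      L.sigma (Ra.left i ⊗ₜ Rb.left j) • (Ra.right i * Rb.right j) := by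
  let M : W.Biproduct ⊗[K] W.Biproduct →ₗ[K] W.Biproduct :=
    ∑ j ∈ Rb.index, TensorProduct.lid K W.Biproduct ∘ₗ TensorProduct.map
      (counit ∘ₗ LinearMap.applyₗ (Rb.left j) ∘ₗ L.circ) (LinearMap.mulRight K (Rb.right j))
  have hM : ∀ u v, M (u ⊗ₜ v) = ∑ j ∈ Rb.index, L.sigma (u ⊗ₜ Rb.left j) • (v * Rb.right j) := by
    intro u v
    simp [M, LinearMap.sum_apply, sigma_tmul]
  have h1 : M (comul a) = ∑ i ∈ Ra.index, ∑ j ∈ Rb.index,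
      L.sigma (Ra.left i ⊗ₜ Rb.left j) • (Ra.right i * Rb.right j) := by
    rw [← Ra.eq, map_sum]
    exact Finset.sum_congr rfl fun i _ => hM _ _
  rw [← h1]
  have R := ℛ K (W.sec a)
  have ha : comul (R := K) a = ∑ i ∈ R.index, L.rep (R.left i) 1 ⊗ₜ W.proj (R.right i) := by
    conv_lhs => rw [← L.rep_sec_one a]
    rw [comul_rep, L.tensorRep_repr R, Bialgebra.comul_one, Algebra.TensorProduct.one_def,
      LinearMap.sum_apply]
    simp
  have hab : comul (R := K) (L.circ a b) = ∑ i ∈ R.index, ∑ j ∈ Rb.index,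
      L.rep (R.left i) (Rb.left j) ⊗ₜ (W.proj (R.right i) * Rb.right j) := by
    change comul (L.rep (W.sec a) b) = _
    rw [comul_rep, L.tensorRep_repr R, ← Rb.eq, LinearMap.sum_apply]
    refine Finset.sum_congr rfl fun i _ => ?_
    rw [map_sum]
    rfl
  have hc : L.circ a b = TensorProduct.lid K W.Biproduct
      (counit.rTensor W.Biproduct (comul (L.circ a b))) := by
    rw [rTensor_counit_comul]
    simp
  rw [hc, hab, ha, map_sum, map_sum, map_sum]
  refine Finset.sum_congr rfl fun i _ => ?_
  rw [hM, map_sum, map_sum]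
  refine Finset.sum_congr rfl fun j _ => ?_
  rw [sigma_tmul, circ_rep]
  simp

theorem isHBilinear_sigma : IsHBilinear W.incl L.sigma := by
  refine W.isHBilinear_of_grp fun h h' a b => ?_
  have hr : L.circ a (b * W.grp h') = L.circ a b * W.grp h' := L.rep_mul_grp _ _ _
  rw [sigma_tmul, circ_grp_mul, Module.End.mul_apply, hr, lg_apply, Bialgebra.counit_mul,
    Bialgebra.counit_mul, counit_grp, counit_grp, one_mul, mul_one, sigma_tmul]

/-- By `circ_repr` the two sides of the cocycle identity are `ε(x ∘ (y ∘ z))` and `ε((x ∘ y) ∘ z)`.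
-/
theorem isTwoCocycle_sigma (hu : IsUnit L.sigma) : IsTwoCocycle L.sigma where
  isUnit := hu
  cocycle x y z Rx Ry Rz := by
    have h1 : ∑ j ∈ Ry.index, ∑ k ∈ Rz.index, L.sigma (Ry.left j ⊗ₜ Rz.left k) *
        L.sigma (x ⊗ₜ (Ry.right j * Rz.right k)) = L.sigma (x ⊗ₜ L.circ y z) := by
      rw [L.circ_repr Ry Rz]
      simp [TensorProduct.tmul_sum]
    have h2 : ∑ i ∈ Rx.index, ∑ j ∈ Ry.index, L.sigma (Rx.left i ⊗ₜ Ry.left j) *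
        L.sigma ((Rx.right i * Ry.right j) ⊗ₜ z) = L.sigma (L.circ x y ⊗ₜ z) := by
      rw [L.circ_repr Rx Ry]
      simp [TensorProduct.sum_tmul, ← TensorProduct.smul_tmul']
    rw [h1, h2, sigma_tmul, sigma_tmul, circ_circ, Module.End.mul_apply]
  right_one x := by rw [sigma_tmul, circ_apply_one]
  one_left x := by rw [sigma_tmul, circ_one, Module.End.one_apply]

end LiftingScalars

/-! ### The elementary forms -/

/-- The form `a ⊗ b ↦ ε(∂'ⱼ a) ε(b)`. -/
def coderForm (j : Fin θ) : BiForm K W.Biproduct := leftForm (W.skew j 1 (W.χ j)⁻¹ (by simp))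

/-- The form `a ⊗ b ↦ ε(a) ε(∂ᵢ b)`. -/
def derForm (i : Fin θ) : BiForm K W.Biproduct := rightForm (W.skew i (W.χ i) 1 (by simp))

/-- The form `a ⊗ b ↦ Σ_{m < R} c_m ε(∂'ⱼ^m a) ε(∂ᵢ^{v_m} b)`. -/
def elemForm (j i : Fin θ) (R : ℕ) (c : ℕ → K) (v : ℕ → ℕ) : BiForm K W.Biproduct :=
  ∑ m ∈ Finset.range R, c m • (W.coderForm j ^ m * W.derForm i ^ v m)

theorem coderForm_pow_mul_derForm_pow_mul (j i : Fin θ) (m n : ℕ) (τ : BiForm K W.Biproduct)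
    (a b : W.Biproduct) : (W.coderForm j ^ m * W.derForm i ^ n * τ) (a ⊗ₜ b) =
      τ ((W.coder j ^ m) a ⊗ₜ (W.der i ^ n) b) := by
  rw [mul_assoc, coderForm, leftForm_pow_mul, derForm, rightForm_pow_mul]
  rfl

theorem biForm_sum_apply {ι : Type*} (s : Finset ι) (f : ι → BiForm K W.Biproduct)
    (t : W.Biproduct ⊗[K] W.Biproduct) : (∑ m ∈ s, f m) t = ∑ m ∈ s, f m t := by
  classical
  induction s using Finset.induction_on with
  | empty => rfl
  | insert i s hi ih =>
    rw [Finset.sum_insert hi, Finset.sum_insert hi, ← ih]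
    rfl

theorem elemForm_mul_tmul (j i : Fin θ) (R : ℕ) (c : ℕ → K) (v : ℕ → ℕ)
    (τ : BiForm K W.Biproduct) (a b : W.Biproduct) : (W.elemForm j i R c v * τ) (a ⊗ₜ b) =
      ∑ m ∈ Finset.range R, c m * τ ((W.coder j ^ m) a ⊗ₜ (W.der i ^ v m) b) := by
  rw [elemForm, Finset.sum_mul, biForm_sum_apply]
  refine Finset.sum_congr rfl fun m _ => ?_
  rw [smul_mul_assoc, ← coderForm_pow_mul_derForm_pow_mul]
  rfl

theorem elemForm_tmul (j i : Fin θ) (R : ℕ) (c : ℕ → K) (v : ℕ → ℕ) (a b : W.Biproduct) :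
    W.elemForm j i R c v (a ⊗ₜ b) = ∑ m ∈ Finset.range R, c m *
      (counit (R := K) ((W.coder j ^ m) a) * counit (R := K) ((W.der i ^ v m) b)) := by
  rw [← mul_one (W.elemForm j i R c v), elemForm_mul_tmul]
  simp only [BiForm.one_tmul]

/-- The form is `1` plus a multiple of the nilpotent `coderForm j`, which commutes with the
cofactor. -/
theorem isUnit_elemForm (j i : Fin θ) {R : ℕ} (hR : 0 < R) {c : ℕ → K} (hc : c 0 = 1)
    {v : ℕ → ℕ} (hv : v 0 = 0) : IsUnit (W.elemForm j i R c v) := by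
  obtain ⟨R, rfl⟩ : ∃ k, R = k + 1 := ⟨R - 1, by omega⟩
  have hcomm : Commute (W.coderForm j) (∑ m ∈ Finset.range R,
      c (m + 1) • (W.coderForm j ^ m * W.derForm i ^ v (m + 1))) := by
    refine Commute.sum_right _ _ _ fun m _ => Commute.smul_right ?_ _
    exact ((Commute.refl _).pow_right m).mul_right
      ((commute_leftForm_rightForm _ _).pow_right _)
  have hnil : IsNilpotent (W.coderForm j * ∑ m ∈ Finset.range R,
      c (m + 1) • (W.coderForm j ^ m * W.derForm i ^ v (m + 1))) :=
    hcomm.isNilpotent_mul_right (isNilpotent_leftForm (W.coder_pow_r j))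
  have h : W.elemForm j i (R + 1) c v = 1 + W.coderForm j * ∑ m ∈ Finset.range R,
      c (m + 1) • (W.coderForm j ^ m * W.derForm i ^ v (m + 1)) := by
    rw [elemForm, Finset.sum_range_succ', hc, hv, pow_zero, pow_zero, one_smul, mul_one, add_comm,
      Finset.mul_sum]
    congr 1
    refine Finset.sum_congr rfl fun m _ => ?_
    rw [mul_smul_comm, ← mul_assoc, ← pow_succ']
  rw [h]
  exact hnil.isUnit_one_add

theorem coder_pow_grp_mul (j : Fin θ) (m : ℕ) (h : Γ) (a : W.Biproduct) :
    (W.coder j ^ m) (W.grp h * a) = W.grp h * (W.coder j ^ m) a := by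
  induction m generalizing a with
  | zero => simp
  | succ m ih =>
    rw [pow_succ, Module.End.mul_apply, coder, skewOp_grp_mul, ← coder]
    simp [ih, Module.End.mul_apply]

theorem der_pow_mul_grp (i : Fin θ) (m : ℕ) (a : W.Biproduct) (h : Γ) :
    (W.der i ^ m) (a * W.grp h) = (W.der i ^ m) a * W.grp h := by
  induction m generalizing a with
  | zero => simp
  | succ m ih => rw [pow_succ, Module.End.mul_apply, der_mul_grp, ih, Module.End.mul_apply]

/-- `∂'ⱼ` commutes with left multiplication by `Γ` and `∂ᵢ` with right multiplication. This is why
the left argument uses `∂'ⱼ` and the right one `∂ᵢ`. -/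
theorem isHBilinear_elemForm (j i : Fin θ) (R : ℕ) (c : ℕ → K) (v : ℕ → ℕ) :
    IsHBilinear W.incl (W.elemForm j i R c v) := by
  refine W.isHBilinear_of_grp fun h h' a b => ?_
  rw [elemForm_tmul, elemForm_tmul]
  refine Finset.sum_congr rfl fun m _ => ?_
  rw [coder_pow_grp_mul, der_pow_mul_grp, Bialgebra.counit_mul, Bialgebra.counit_mul, counit_grp,
    counit_grp, one_mul, mul_one]

theorem eq_single_iff {i : Fin θ} {n : Fin θ → ℕ} {m : ℕ} :
    n = Pi.single i m ↔ n i = m ∧ ∀ k ∈ List.finRange θ, k ≠ i → n k = 0 := by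
  constructor
  · rintro rfl
    exact ⟨by simp, fun k _ hk => by simp [hk]⟩
  · rintro ⟨h1, h2⟩
    funext k
    by_cases hk : k = i
    · subst hk; rw [h1, Pi.single_eq_same]
    · rw [h2 k (List.mem_finRange k) hk, Pi.single_eq_of_ne hk]

theorem counit_coder_pow_mono (j : Fin θ) {n : Fin θ → ℕ} (hn : ∀ k, n k < W.r k) (m : ℕ) :
    counit (R := K) ((W.coder j ^ m) (W.mono n)) =
      if n = Pi.single j m then qFact (W.χ j (W.g j) : K)⁻¹ m else 0 := by
  rw [mono_eq_pbw, coder, counit_skewOp_pow_pbw (W.coder_qNum j) (W.qls_two j).inv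
    (List.nodup_finRange θ) (List.mem_finRange j) (hn j)]
  simp only [eq_single_iff]

theorem counit_der_pow_mono (i : Fin θ) {n : Fin θ → ℕ} (hn : ∀ k, n k < W.r k) (m : ℕ) :
    counit (R := K) ((W.der i ^ m) (W.mono n)) =
      if n = Pi.single i m then qFact (W.χ i (W.g i) : K) m else 0 := by
  rw [mono_eq_pbw, der, counit_skewOp_pow_pbw (W.der_qNum i) (W.qls_two i)
    (List.nodup_finRange θ) (List.mem_finRange i) (hn i)]
  simp only [eq_single_iff]

theorem mono_single (i : Fin θ) (m : ℕ) : W.mono (Pi.single i m) = W.x i ^ m := by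
  have : ∀ l : List (Fin θ), l.Nodup →
      listMono W.x (Pi.single i m) l = if i ∈ l then W.x i ^ m else 1 := by
    intro l
    induction l with
    | nil => intro _; simp [listMono_nil]
    | cons k l ih =>
      intro hl
      rw [List.nodup_cons] at hl
      rw [listMono_cons, ih hl.2]
      by_cases hk : k = i
      · subst hk; simp [hl.1]
      · simp [hk, Ne.symm hk]
  rw [mono_eq_pbw, pbw, grp_one, mul_one, this _ (List.nodup_finRange θ),
    if_pos (List.mem_finRange i)]

theorem counit_mono (n : Fin θ → ℕ) :
    counit (R := K) (W.mono n) = if n = 0 then 1 else 0 := by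
  rw [mono_eq_pbw, counit_pbw]
  congr 1
  simp [funext_iff]

theorem single_lt {i : Fin θ} {m : ℕ} (hm : m < W.r i) (k : Fin θ) :
    (Pi.single i m : Fin θ → ℕ) k < W.r k := by
  by_cases hk : k = i
  · subst hk; simpa using hm
  · rw [Pi.single_eq_of_ne hk]
    have := W.one_lt_r k
    omega

theorem exists_qComm_grp (n : Fin θ → ℕ) (l : List (Fin θ)) (h : Γ) :
    ∃ c : K, c ≠ 0 ∧ QComm c (W.grp h) (listMono W.x n l) := by
  induction l with
  | nil => exact ⟨1, one_ne_zero, QComm.one_right⟩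
  | cons k l ih =>
    obtain ⟨c, hc, hq⟩ := ih
    refine ⟨(W.χ k h : K) ^ n k * c, mul_ne_zero (pow_ne_zero _ (Units.ne_zero _)) hc, ?_⟩
    rw [listMono_cons]
    exact (QComm.pow_right (W.grp_mul_x h k) _).mul_right hq

/-- `H`-bilinear forms are determined by their values on pairs of monomials. -/
theorem isHBilinear_ext {γ γ' : BiForm K W.Biproduct} (h : IsHBilinear W.incl γ)
    (h' : IsHBilinear W.incl γ')
    (hm : ∀ n n' : Fin θ → ℕ, (∀ k, n k < W.r k) → (∀ k, n' k < W.r k) →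
      γ (W.mono n ⊗ₜ W.mono n') = γ' (W.mono n ⊗ₜ W.mono n')) : γ = γ' := by
  have hgrp : ∀ {δ : BiForm K W.Biproduct}, IsHBilinear W.incl δ → ∀ (d d' : Γ) a b,
      δ ((W.grp d * a) ⊗ₜ (b * W.grp d')) = δ (a ⊗ₜ b) := by
    intro δ hδ d d' a b
    have := hδ (MonoidAlgebra.single d 1) (MonoidAlgebra.single d' 1) a b
    simpa [incl_single] using this
  apply WithConv.ofConv_injective
  refine TensorProduct.ext (W.linearMap_ext_pbw fun n d hn =>
    W.linearMap_ext_pbw fun n' d' hn' => ?_)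
  obtain ⟨c, hc, hq⟩ := W.exists_qComm_grp n (List.finRange θ) d
  have e : W.pbw n (List.finRange θ) d = c⁻¹ • (W.grp d * W.mono n) := by
    rw [mono_eq_pbw, pbw, pbw, grp_one, mul_one, hq.eq, smul_smul, inv_mul_cancel₀ hc, one_smul]
  have e' : W.pbw n' (List.finRange θ) d' = W.mono n' * W.grp d' := by
    rw [mono_eq_pbw, pbw, pbw, grp_one, mul_one]
  have key : γ ((W.grp d * W.mono n) ⊗ₜ (W.mono n' * W.grp d')) =
      γ' ((W.grp d * W.mono n) ⊗ₜ (W.mono n' * W.grp d')) := by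
    rw [hgrp h, hgrp h', hm n n' hn hn']
  rw [e, e']
  simp only [map_smul, LinearMap.smul_apply]
  congr 1

/-! ### Existence and uniqueness of `γᵢ` and `γ_{ij}` -/

/-- The form `γᵢ`, for the scalar `a`. -/
def gammaForm (i : Fin θ) (a : K) :
    BiForm K W.Biproduct :=
  W.elemForm i i (W.r i)
    (fun m => if m = 0 then 1 else
      a * (qFact (W.χ i (W.g i) : K)⁻¹ m * qFact (W.χ i (W.g i) : K) (W.r i - m))⁻¹)
    (fun m => if m = 0 then 0 else W.r i - m)

/-- The form `γ_{ij}`, for the scalar `a`. -/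
def gammaPairForm (i j : Fin θ) (a : K) :
    BiForm K W.Biproduct :=
  W.elemForm j i (W.r i) (fun m => a ^ m / qFact (W.χ i (W.g i) : K) m) (fun m => m)

theorem isUnit_gammaForm (i : Fin θ) (a : K) :
    IsUnit (W.gammaForm i a) :=
  W.isUnit_elemForm i i (by have := W.one_lt_r i; omega) (by simp) (by simp)

theorem isUnit_gammaPairForm (i j : Fin θ) (a : K) :
    IsUnit (W.gammaPairForm i j a) :=
  W.isUnit_elemForm j i (by have := W.one_lt_r i; omega) (by simp [qFact_zero]) rfl

theorem gammaPairForm_zero (i j : Fin θ) : W.gammaPairForm i j 0 = 1 := by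
  refine BiForm.ext fun a b => ?_
  have hr := W.one_lt_r i
  rw [gammaPairForm, elemForm_tmul, Finset.sum_eq_single_of_mem 0 (Finset.mem_range.2 (by omega)),
    BiForm.one_tmul]
  · simp [qFact_zero]
  · intro m _ hm
    rw [zero_pow hm, zero_div, zero_mul]

namespace LiftingScalars

variable {W} (L : W.LiftingScalars)

/-- The coefficients of `gammaForm` divide out the two `q`-factorials by which the iterated
derivations fail to be dual to powers of `xᵢ`. -/
theorem isGamma_gammaForm (i : Fin θ) : L.IsGamma i (W.gammaForm i (L.a i)) where
  bilinear := W.isHBilinear_elemForm _ _ _ _ _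
  apply_pow m h0 hm := by
    have h1 : qFact (W.χ i (W.g i) : K)⁻¹ m ≠ 0 := qFact_ne_zero (W.qls_two i).inv hm
    have h2 : qFact (W.χ i (W.g i) : K) (W.r i - m) ≠ 0 :=
      qFact_ne_zero (W.qls_two i) (by omega)
    rw [← mono_single, ← mono_single, gammaForm, elemForm_tmul,
      Finset.sum_eq_single_of_mem m (Finset.mem_range.2 hm)]
    · rw [W.counit_coder_pow_mono i (W.single_lt hm), W.counit_der_pow_mono i
        (W.single_lt (by omega)), if_neg h0.ne', if_neg h0.ne', if_pos rfl, if_pos rfl,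
        mul_assoc, inv_mul_cancel₀ (mul_ne_zero h1 h2), mul_one]
    · intro k _ hk
      have hne : (Pi.single i m : Fin θ → ℕ) ≠ Pi.single i k := fun h =>
        hk (Pi.single_injective i h).symm
      rw [W.counit_coder_pow_mono i (W.single_lt hm), if_neg hne, zero_mul, mul_zero]
  apply_mono n n' hn hn' hex := by
    have hr := W.one_lt_r i
    rw [gammaForm, elemForm_tmul, Finset.sum_eq_single_of_mem 0 (Finset.mem_range.2 (by omega))]
    · simp
    · intro m hm hm0
      have hm := Finset.mem_range.1 hm
      rw [W.counit_coder_pow_mono i hn, W.counit_der_pow_mono i hn', if_neg hm0, if_neg hm0]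
      by_cases h1 : n = Pi.single i m
      · by_cases h2 : n' = Pi.single i (W.r i - m)
        · exact absurd ⟨m, by omega, hm, h1, h2⟩ hex
        · rw [if_neg h2, mul_zero, mul_zero]
      · rw [if_neg h1, zero_mul, mul_zero]

theorem isGammaPair_gammaPairForm {i j : Fin θ} (hij : i ≠ j) :
    L.IsGammaPair i j (W.gammaPairForm i j (L.aa j i)) where
  bilinear := W.isHBilinear_elemForm _ _ _ _ _
  apply_pow m hm := by
    by_cases ha : L.aa j i = 0
    -- Without a link `rᵢ` and `rⱼ` may differ, and `xⱼ^m` need not be a basis monomial; but then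
    -- the form is trivial.
    · rw [ha, gammaPairForm_zero, BiForm.one_tmul, Bialgebra.counit_pow, Bialgebra.counit_pow,
        counit_x, counit_x]
      rcases Nat.eq_zero_or_pos m with rfl | h0
      · simp [qFact_zero]
      · simp [zero_pow h0.ne']
    · have hc := (L.of_aa_ne_zero j i hij.symm ha).2
      have hr : W.r j = W.r i := link_r hij.symm hc
      -- Both derivations contribute the same `(m)!_q`, and the coefficient divides by only one of
      -- them; hence the value `(m)!_q a_{ji}^m`.
      have hq := (link_self hij.symm hc).2
      rw [← mono_single, ← mono_single, gammaPairForm, elemForm_tmul,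
        Finset.sum_eq_single_of_mem m (Finset.mem_range.2 hm)]
      · rw [W.counit_coder_pow_mono j (W.single_lt (hr ▸ hm)),
          W.counit_der_pow_mono i (W.single_lt hm), if_pos rfl, if_pos rfl, ← hq]
        have := qFact_ne_zero (W.qls_two i) hm
        field_simp
      · intro k _ hk
        rw [W.counit_coder_pow_mono j (W.single_lt (hr ▸ hm)), if_neg, zero_mul, mul_zero]
        intro h
        exact hk (Pi.single_injective j h).symm
  apply_mono n n' hn hn' hex := by
    have hr := W.one_lt_r i
    rw [gammaPairForm, elemForm_tmul, Finset.sum_eq_zero, counit_mono, counit_mono]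
    · by_cases h1 : n = 0
      · by_cases h2 : n' = 0
        · exact absurd ⟨0, by omega, by simpa using h1, by simpa using h2⟩ hex
        · rw [if_neg h2, mul_zero]
      · rw [if_neg h1, zero_mul]
    · intro m hm
      have hm := Finset.mem_range.1 hm
      rw [W.counit_coder_pow_mono j hn, W.counit_der_pow_mono i hn']
      by_cases h1 : n = Pi.single j m
      · by_cases h2 : n' = Pi.single i m
        · exact absurd ⟨m, hm, h1, h2⟩ hex
        · rw [if_neg h2, mul_zero, mul_zero]
      · rw [if_neg h1, zero_mul, mul_zero]

variable {L}

theorem IsGamma.unique {i : Fin θ} {γ γ' : BiForm K W.Biproduct} (h : L.IsGamma i γ)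
    (h' : L.IsGamma i γ') : γ = γ' := by
  refine W.isHBilinear_ext h.bilinear h'.bilinear fun n n' hn hn' => ?_
  by_cases hex : ∃ m, 0 < m ∧ m < W.r i ∧ n = Pi.single i m ∧ n' = Pi.single i (W.r i - m)
  · obtain ⟨m, h0, hm, rfl, rfl⟩ := hex
    rw [mono_single, mono_single, h.apply_pow m h0 hm, h'.apply_pow m h0 hm]
  · rw [h.apply_mono n n' hn hn' hex, h'.apply_mono n n' hn hn' hex]

theorem IsGammaPair.unique {i j : Fin θ} {γ γ' : BiForm K W.Biproduct} (h : L.IsGammaPair i j γ)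
    (h' : L.IsGammaPair i j γ') : γ = γ' := by
  refine W.isHBilinear_ext h.bilinear h'.bilinear fun n n' hn hn' => ?_
  by_cases hex : ∃ m, m < W.r i ∧ n = Pi.single j m ∧ n' = Pi.single i m
  · obtain ⟨m, hm, rfl, rfl⟩ := hex
    rw [mono_single, mono_single, h.apply_pow m hm, h'.apply_pow m hm]
  · rw [h.apply_mono n n' hn hn' hex, h'.apply_mono n n' hn hn' hex]

end LiftingScalars

/-! ### Iterated derivations of ordered monomials. -/

theorem pbw_congr {n n' : Fin θ → ℕ} {l : List (Fin θ)} (h : ∀ k ∈ l, n k = n' k) (d : Γ) :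
    W.pbw n l d = W.pbw n' l d := by
  rw [pbw, pbw, listMono, listMono, List.map_congr_left fun k hk => by rw [h k hk]]

theorem exists_coder_pbw (j : Fin θ) {l : List (Fin θ)} (hl : l.Nodup) (n : Fin θ → ℕ) (h : Γ) :
    ∃ c : K, W.coder j (W.pbw n l h) = c • W.pbw (Function.update n j (n j - 1)) l h := by
  induction l with
  | nil => exact ⟨0, by rw [pbw_nil, zero_smul]; exact skewOp_grp h⟩
  | cons k l ih =>
    rw [List.nodup_cons] at hl
    by_cases hk : k = j
    · subst hk
      have h0 : W.coder k (W.pbw n l h) = 0 := skewOp_pbw_of_notMem hl.1 n h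
      rcases Nat.eq_zero_or_pos (n k) with hn | hn
      · exact ⟨0, by rw [pbw_cons, hn, pow_zero, one_mul, h0, zero_smul]⟩
      · obtain ⟨m, hm⟩ : ∃ m, n k = m + 1 := ⟨n k - 1, by omega⟩
        have h1 := skewOp_x_pow_succ (W.coder_qNum k) h0 (W.scale_pbw _ n l h) m
        have h2 : W.pbw (Function.update n k (n k - 1)) l h = W.pbw n l h := by
          refine W.pbw_congr (fun i hi => Function.update_of_ne ?_ _ _) h
          rintro rfl
          exact hl.1 hi
        refine ⟨qNum (W.χ k (W.g k) : K)⁻¹ (m + 1) * ((W.χ k)⁻¹ (W.pbwDeg n l h) : Kˣ), ?_⟩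
        rw [pbw_cons, pbw_cons, h2, hm, Function.update_self]
        exact h1
    · obtain ⟨c, hc⟩ := ih hl.2
      refine ⟨c, ?_⟩
      rw [pbw_cons, pbw_cons, coder, skewOp_x_pow_mul_of_ne hk, ← coder, hc,
        Function.update_of_ne hk]
      simp

/-- Powers of `∂'ⱼ` only lower the exponent of `xⱼ` in a monomial, so they introduce no new
variable. -/
theorem der_coder_pow_pbw {i j : Fin θ} {l : List (Fin θ)} (hl : l.Nodup) (hi : i ∉ l)
    (n : Fin θ → ℕ) (h : Γ) (s : ℕ) : W.der i ((W.coder j ^ s) (W.pbw n l h)) = 0 := by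
  induction s generalizing n with
  | zero => exact skewOp_pbw_of_notMem hi n h
  | succ s ih =>
    obtain ⟨c, hc⟩ := W.exists_coder_pbw j hl n h
    rw [pow_succ, Module.End.mul_apply, hc, map_smul, map_smul, ih, smul_zero]

theorem coder_pow_x_pow_mul_of_ne {j k : Fin θ} (hk : k ≠ j) (s n : ℕ) (a : W.Biproduct) :
    (W.coder j ^ s) (W.x k ^ n * a) = W.x k ^ n * (W.coder j ^ s) a := by
  rw [coder, skewOp_pow_x_pow_mul_of_ne hk]
  simp

theorem coder_pow_x_pow_mul_pbw {j : Fin θ} {l : List (Fin θ)} (hj : j ∉ l) {m : ℕ}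
    (hm : m < W.r j) {s : ℕ} (hs : s ≤ m) (n : Fin θ → ℕ) (h : Γ) :
    (W.coder j ^ s) (W.x j ^ m * W.pbw n l h) =
      (qFact (W.χ j (W.g j) : K)⁻¹ m / qFact (W.χ j (W.g j) : K)⁻¹ (m - s) *
        (W.χ j (W.pbwDeg n l h) : K)⁻¹ ^ s) • (W.x j ^ (m - s) * W.pbw n l h) := by
  obtain ⟨t, rfl⟩ : ∃ t, m = t + s := ⟨m - s, by omega⟩
  have h0 : W.coder j (W.pbw n l h) = 0 := skewOp_pbw_of_notMem hj n h
  have := lowering_pow_apply (skewOp_x_pow_succ (W.coder_qNum j) h0 (W.scale_pbw _ n l h)) s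
    (qFact_ne_zero (W.qls_two j).inv (show t < W.r j by omega))
  rw [Nat.add_sub_cancel, coder, this]
  simp

theorem coder_pow_x_pow_mul_pbw_eq_zero {j : Fin θ} {l : List (Fin θ)} (hj : j ∉ l) {m s : ℕ}
    (hs : m < s) (n : Fin θ → ℕ) (h : Γ) : (W.coder j ^ s) (W.x j ^ m * W.pbw n l h) = 0 := by
  have h0 : W.coder j (W.pbw n l h) = 0 := skewOp_pbw_of_notMem hj n h
  exact lowering_pow_eq_zero (skewOp_x_pow_succ (W.coder_qNum j) h0 (W.scale_pbw _ n l h)) h0 hs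

theorem gammaForm_zero (i : Fin θ) : W.gammaForm i 0 = 1 := by
  refine BiForm.ext fun a b => ?_
  have hr := W.one_lt_r i
  rw [gammaForm, elemForm_tmul, Finset.sum_eq_single_of_mem 0 (Finset.mem_range.2 (by omega)),
    BiForm.one_tmul]
  · simp
  · intro m _ hm
    rw [if_neg hm, zero_mul, zero_mul]

namespace LiftingScalars

variable {W} (L L' : W.LiftingScalars)

/-! ### Adding one scalar -/

theorem circ_x_pow_mul {k : Fin θ} {z : W.Biproduct} (hz : ∀ i ≤ k, W.der i z = 0) {m : ℕ}
    (hm : m < W.r k) : L.circ (W.x k ^ m * z) = L.genOp k ^ m * L.circ z := by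
  have := L.circ_rep (W.tensorX k ^ m * W.sec z)
  rw [map_mul, map_pow, rep_X, Module.End.mul_apply, rep_sec_one, L.genOp_pow_apply hz hm] at this
  exact this

theorem circ_pbw {n : Fin θ → ℕ} (hn : ∀ i, n i < W.r i) {l : List (Fin θ)}
    (hl : l.Pairwise (· < ·)) (h : Γ) :
    L.circ (W.pbw n l h) = listMono L.genOp n l * W.lg h := by
  rw [← L.listMono_genOp_apply hn hl, ← rep_listMono, circ_rep]

variable {L L'}

theorem circ_pbw_congr {n : Fin θ → ℕ} (hn : ∀ i, n i < W.r i) {l : List (Fin θ)}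
    (hl : l.Pairwise (· < ·)) (hL : ∀ k ∈ l, L'.genOp k = L.genOp k) (h : Γ) :
    L'.circ (W.pbw n l h) = L.circ (W.pbw n l h) := by
  rw [circ_pbw _ hn hl, circ_pbw _ hn hl, listMono, listMono,
    List.map_congr_left fun k hk => by rw [hL k hk]]

theorem sigma_congr (hL : ∀ k, L'.genOp k = L.genOp k) : L'.sigma = L.sigma := by
  have : L'.circ = L.circ := W.linearMap_ext_pbw fun n h hn =>
    circ_pbw_congr hn (List.pairwise_lt_finRange θ) (fun k _ => hL k) h
  rw [sigma, sigma, this]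

/-- Reduction to one variable. In an ordered monomial, the variables after `xⱼ` have the same
`genOp` for both families of scalars, and those before it multiply from the left and commute with
`∂'ⱼ`. So it suffices to treat `xⱼ^m` times a tail. -/
theorem sigma_eq_elemForm_mul {j i : Fin θ} {R : ℕ} {c : ℕ → K} {v : ℕ → ℕ}
    (hgen : ∀ k, k ≠ j → L'.genOp k = L.genOp k)
    (hmain : ∀ (n : Fin θ → ℕ) (l : List (Fin θ)) (h : Γ) (m : ℕ), (∀ k, n k < W.r k) →
      l.Pairwise (· < ·) → (∀ k ∈ l, j < k) → m < W.r j →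
      L'.genOp j ^ m * L.circ (W.pbw n l h) = ∑ s ∈ Finset.range R,
        c s • (L.circ ((W.coder j ^ s) (W.x j ^ m * W.pbw n l h)) * W.der i ^ v s)) :
    L'.sigma = W.elemForm j i R c v * L.sigma := by
  have key : ∀ (l : List (Fin θ)) (n : Fin θ → ℕ) (h : Γ), (∀ k, n k < W.r k) →
      l.Pairwise (· < ·) → L'.circ (W.pbw n l h) = ∑ s ∈ Finset.range R,
        c s • (L.circ ((W.coder j ^ s) (W.pbw n l h)) * W.der i ^ v s) := by
    intro l
    induction l with
    | nil =>
      intro n h hn hl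
      have := hmain n [] h 0 hn hl (by simp) (by have := W.one_lt_r j; omega)
      simp only [pow_zero, one_mul] at this
      rw [← this]
      exact circ_pbw_congr hn hl (by simp) h
    | cons k l ih =>
      intro n h hn hl
      have hl' := hl
      rw [List.pairwise_cons] at hl
      have hder : ∀ i ≤ k, i ∉ l := fun i hi hil => absurd (hl.1 i hil) (not_lt.2 hi)
      rw [pbw_cons, L'.circ_x_pow_mul (fun i hi => skewOp_pbw_of_notMem (hder i hi) n h) (hn k)]
      by_cases hk : k = j
      · subst hk
        rw [circ_pbw_congr hn hl.2 (fun i hi => hgen i (hl.1 i hi).ne') h]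
        exact hmain n l h (n k) hn hl.2 hl.1 (hn k)
      · rw [hgen k hk, ih n h hn hl.2, Finset.mul_sum]
        refine Finset.sum_congr rfl fun s _ => ?_
        rw [W.coder_pow_x_pow_mul_of_ne hk, L.circ_x_pow_mul (fun i hi =>
          W.der_coder_pow_pbw (hl.2.imp ne_of_lt) (hder i hi) n h s) (hn k), mul_smul_comm,
          mul_assoc]
  have hcirc : L'.circ = ∑ s ∈ Finset.range R, c s •
      ((LinearMap.mulRight K (W.der i ^ v s)) ∘ₗ L.circ ∘ₗ (W.coder j ^ s)) := by
    refine W.linearMap_ext_pbw fun n h hn => ?_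
    rw [key _ n h hn (List.pairwise_lt_finRange θ), LinearMap.sum_apply]
    rfl
  refine BiForm.ext fun a b => ?_
  rw [sigma_tmul, hcirc, elemForm_mul_tmul, LinearMap.sum_apply, LinearMap.sum_apply, map_sum]
  refine Finset.sum_congr rfl fun s _ => ?_
  rw [sigma_tmul, ← smul_eq_mul, ← map_smul]
  rfl

theorem der_qComm_circ_pbw {n : Fin θ → ℕ} (hn : ∀ i, n i < W.r i) {i : Fin θ} {l : List (Fin θ)}
    (hl : l.Pairwise (· < ·)) (h : Γ)
    (hc : ∀ k ∈ l, QComm (W.χ i (W.g k) : K) (W.der i) (L.genOp k)) :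
    QComm (W.χ i (W.pbwDeg n l h) : K) (W.der i) (L.circ (W.pbw n l h)) := by
  rw [circ_pbw _ hn hl]
  clear hl
  induction l with
  | nil => simpa [listMono_nil, pbwDeg_nil] using W.der_qComm_lg i h
  | cons k l ih =>
    rw [listMono_cons, pbwDeg_cons, mul_assoc]
    refine (((hc k List.mem_cons_self).pow_right (n k)).mul_right
      (ih fun k' hk' => hc k' (List.mem_cons_of_mem _ hk'))).congr ?_
    simp

theorem genOp_eq_of_low {k : Fin θ} (ha : L'.a k = L.a k) (hlow : ∀ i, L'.low k i = L.low k i) :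
    L'.genOp k = L.genOp k := by
  rw [genOp, genOp, lowOp, lowOp, ha]
  simp only [hlow]

theorem circ_coder_pow {j : Fin θ} {n : Fin θ → ℕ} {l : List (Fin θ)} (hl : ∀ k ∈ l, j < k)
    (h : Γ) {m s : ℕ} (hm : m < W.r j) (hs : s ≤ m) :
    L.circ ((W.coder j ^ s) (W.x j ^ m * W.pbw n l h)) =
      (qFact (W.χ j (W.g j) : K)⁻¹ m / qFact (W.χ j (W.g j) : K)⁻¹ (m - s) *
        (W.χ j (W.pbwDeg n l h) : K)⁻¹ ^ s) • (L.genOp j ^ (m - s) * L.circ (W.pbw n l h)) := by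
  rw [W.coder_pow_x_pow_mul_pbw (fun hj => lt_irrefl _ (hl j hj)) hm hs, map_smul,
    L.circ_x_pow_mul (fun i hi => skewOp_pbw_of_notMem
      (fun hil => absurd (hl i hil) (not_lt.2 hi)) n h) (by omega)]

/-- Adding the scalar `a_{ji}`, `i < j`, multiplies `σ` by `γ_{ij}`. -/
theorem sigma_eq_gammaPairForm_mul {i j : Fin θ} (hij : i < j) (ha : ∀ k, L'.a k = L.a k)
    (hlow : ∀ k l, (k = j → l ≠ i) → L'.low k l = L.low k l) (h0 : L.low j i = 0) :
    L'.sigma = W.gammaPairForm i j (L'.aa j i) * L.sigma := by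
  have hL' : L'.low j i = L'.aa j i := if_pos hij
  by_cases hz : L'.aa j i = 0
  · rw [hz, gammaPairForm_zero, one_mul]
    refine sigma_congr fun k => genOp_eq_of_low (ha k) fun l => ?_
    by_cases h : k = j ∧ l = i
    · rw [h.1, h.2, h0, hL', hz]
    · exact hlow k l fun hk hl => h ⟨hk, hl⟩
  have hgen : ∀ k, k ≠ j → L'.genOp k = L.genOp k := fun k hk =>
    genOp_eq_of_low (ha k) fun l => hlow k l fun h => absurd h hk
  have hgenj : L'.genOp j = L.genOp j + L'.aa j i • W.der i := by
    have e : ∑ l, L'.low j l • W.der l = ∑ l, L.low j l • W.der l + L'.aa j i • W.der i := by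
      rw [← Finset.sum_erase_add _ _ (Finset.mem_univ i),
        ← Finset.sum_erase_add _ (fun l => L.low j l • W.der l) (Finset.mem_univ i), h0,
        hL', zero_smul, add_zero]
      congr 1
      refine Finset.sum_congr rfl fun l hl => ?_
      rw [hlow j l fun _ => Finset.ne_of_mem_erase hl]
    rw [genOp, genOp, lowOp, lowOp, e, ha]
    abel
  have hlink : W.χ j * W.χ i = 1 := (L'.of_aa_ne_zero j i hij.ne' hz).2
  have hself := link_self hij.ne' hlink
  have hr := link_r hij.ne' hlink
  have hcomm : ∀ k, j ≤ k → QComm (W.χ i (W.g k) : K) (W.der i) (L.genOp k) := by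
    intro k hk
    have hik := hij.trans_le hk
    have := L.der_pow_qComm_genOp hik 1 fun hlk => by
      have hjk : j ≠ k := by
        rintro rfl
        exact hlk h0
      exact der_sq_eq_zero hij.ne hik.ne hjk (link_symm hlink) (link_symm (L.chi_of_low hlk))
    rwa [pow_one, pow_one] at this
  refine sigma_eq_elemForm_mul hgen fun n l h m hn hl hlj hm => ?_
  have hq : (W.χ i (W.g i) : K) = (W.χ j (W.g j) : K)⁻¹ := hself.2
  -- The new summand `a_{ji} ∂ᵢ` `q`-commutes with the old `genOp j`, because `j` is not yet linked
  -- to `i` in `L`.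
  have hbin := q_binomial (W.χ i (W.g i) : K) (L.genOp j) (L'.aa j i • W.der i)
    ((QComm.smul_left fun _ => hcomm j le_rfl).congr hself.1) m
  -- Reflecting the sum makes the index the exponent of `∂ᵢ`, as in the form `γ_{ij}`.
  rw [hgenj, hbin, ← Finset.sum_range_reflect, Finset.sum_mul]
  have hsub : Finset.range (m + 1) ⊆ Finset.range (W.r i) :=
    Finset.range_subset_range.2 (by omega)
  rw [← Finset.sum_subset hsub]
  · refine Finset.sum_congr rfl fun s hs => ?_
    have hs := Finset.mem_range.1 hs
    have hd := (der_qComm_circ_pbw (L := L) hn hl h fun k hk => hcomm k (hlj k hk).le).pow_left s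
    -- Moving `∂ᵢ^s` past the tail produces `χᵢ` of its degree to the power `s`; the link identifies
    -- this with the factor produced by `∂'ⱼ^s`.
    have hinv : (W.χ j (W.pbwDeg n l h) : K)⁻¹ = W.χ i (W.pbwDeg n l h) :=
      inv_eq_of_mul_eq_one_right (chi_mul_eq_one hlink _)
    have e1 : m + 1 - 1 - s = m - s := by omega
    have e2 : m - (m - s) = s := by omega
    have f1 := qFact_ne_zero (W.qls_two i) (show m - s < W.r i by omega)
    have f2 := qFact_ne_zero (W.qls_two i) (show s < W.r i by omega)
    rw [circ_coder_pow hlj h hm (by omega), e1, e2, smul_pow, mul_smul_comm, smul_mul_assoc,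
      smul_mul_assoc, mul_assoc, hd.eq, mul_smul_comm, smul_smul, smul_smul, smul_mul_assoc,
      smul_smul, ← mul_assoc, hinv, ← hq, qChoose_eq_div (by omega) f1 (by rwa [e2]), e2]
    congr 1
    field_simp
  -- The form sums over all `s < rᵢ`, but `∂'ⱼ^s` kills `xⱼ^m` times the tail for `s > m`.
  · intro s _ hs
    rw [Finset.mem_range] at hs
    rw [W.coder_pow_x_pow_mul_pbw_eq_zero (fun hj => lt_irrefl _ (hlj j hj)) (by omega), map_zero,
      zero_mul, smul_zero]

/-- Adding the scalar `aᵢ` for an isolated vertex `i` multiplies `σ` by `γᵢ`. -/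
theorem sigma_eq_gammaForm_mul {i : Fin θ} (ha : ∀ k, k ≠ i → L'.a k = L.a k)
    (hlow : ∀ k l, L'.low k l = L.low k l) (h0 : L.a i = 0) (hl1 : ∀ k, L.low i k = 0)
    (hl2 : ∀ k, L.low k i = 0) : L'.sigma = W.gammaForm i (L'.a i) * L.sigma := by
  by_cases hz : L'.a i = 0
  · rw [hz, gammaForm_zero, one_mul]
    refine sigma_congr fun k => genOp_eq_of_low ?_ (hlow k)
    by_cases h : k = i
    · rw [h, h0, hz]
    · exact ha k h
  have hgen : ∀ k, k ≠ i → L'.genOp k = L.genOp k := fun k hk =>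
    genOp_eq_of_low (ha k hk) (hlow k)
  have hgeni : L.genOp i = W.lx i := by simp [genOp, lowOp, hl1, h0]
  have hgeni' : L'.genOp i = W.lx i +
      L'.a i • qDividedPow (W.χ i (W.g i) : K) (W.der i) (W.r i - 1) := by
    simp [genOp, lowOp, hlow, hl1, topDer]
  have hchi : W.χ i ^ W.r i = 1 := (L'.of_a_ne_zero i hz).2
  have hcomm : ∀ k, i < k → QComm (W.χ i (W.g k) : K) (W.der i) (L.genOp k) := by
    intro k hk
    have := L.der_pow_qComm_genOp hk 1 fun hlk => absurd (hl2 k) hlk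
    rwa [pow_one, pow_one] at this
  refine sigma_eq_elemForm_mul hgen fun n l h m hn hl hli hm => ?_
  rw [hgeni', add_smul_qDividedPow_pow (W.qls_two i) (W.der_mul_lx i) (W.der_pow_r i) _ hm.le,
    add_mul, smul_mul_assoc, Finset.sum_mul]
  have hsub : Finset.range (m + 1) ⊆ Finset.range (W.r i) :=
    Finset.range_subset_range.2 (by omega)
  rw [← Finset.sum_subset hsub, Finset.sum_range_succ', add_comm]
  · congr 1
    · rw [Finset.smul_sum]
      refine Finset.sum_congr rfl fun t ht => ?_
      have ht := Finset.mem_range.1 ht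
      have hd := (der_qComm_circ_pbw (L := L) hn hl h fun k hk => hcomm k (hli k hk)).pow_left
        (W.r i - (t + 1))
      -- Again the factor from moving `∂ᵢ^{rᵢ-(t+1)}` past the tail equals the one from `∂'ᵢ^{t+1}`,
      -- now because `χᵢ^{rᵢ} = ε`.
      have hinv : (W.χ i (W.pbwDeg n l h) : K) ^ (W.r i - (t + 1)) =
          (W.χ i (W.pbwDeg n l h) : K)⁻¹ ^ (t + 1) := by
        rw [inv_pow]
        refine eq_inv_of_mul_eq_one_left ?_
        rw [← pow_add, Nat.sub_add_cancel (by omega), ← Units.val_pow_eq_pow_val,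
          ← MonoidHom.pow_apply, hchi]
        simp
      have f1 := qFact_ne_zero (W.qls_two i).inv (show t + 1 < W.r i by omega)
      have f2 := qFact_ne_zero (W.qls_two i).inv (show m - (t + 1) < W.r i by omega)
      rw [circ_coder_pow hli h hm (by omega), if_neg (by omega), if_neg (by omega), qDividedPow,
        hgeni, mul_smul_comm, smul_mul_assoc, smul_mul_assoc, mul_assoc, hd.eq, mul_smul_comm,
        smul_smul, smul_smul, smul_smul, smul_mul_assoc, smul_smul, ← mul_assoc, hinv,
        qChoose_eq_div (by omega) f1 f2]
      congr 1
      rw [mul_inv]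
      field_simp
    · rw [if_pos rfl, if_pos rfl, circ_coder_pow hli h hm (by omega), pow_zero, pow_zero,
        Nat.sub_zero, hgeni, div_self (qFact_ne_zero (W.qls_two i).inv hm)]
      simp
  · intro s _ hs
    rw [Finset.mem_range] at hs
    rw [W.coder_pow_x_pow_mul_pbw_eq_zero (fun hi => lt_irrefl _ (hli i hi)) (by omega), map_zero,
      zero_mul, smul_zero]

end LiftingScalars

end QuantumLinearSpace

/-! ### Left colinear operators. -/

section RightHit

open Coalgebra

variable {K A : Type*} [Field K] [Ring A] [Bialgebra K A]

/-- The left colinear operator `a ↦ a₁ f(a₂)` attached to a functional `f`. -/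
def rightHit (f : A →ₗ[K] K) : Module.End K A :=
  (TensorProduct.rid K A).toLinearMap ∘ₗ f.lTensor A ∘ₗ comul

theorem comul_comp_rightHit (f : A →ₗ[K] K) :
    comul ∘ₗ rightHit f = (rightHit f).lTensor A ∘ₗ comul := by
  have h1 : comul (R := K) ∘ₗ (TensorProduct.rid K A).toLinearMap ∘ₗ f.lTensor A =
      ((TensorProduct.rid K (A ⊗[K] A)).toLinearMap ∘ₗ f.lTensor (A ⊗[K] A)) ∘ₗ
        (comul (R := K) (A := A)).rTensor A := by
    ext a b
    simp
  have h2 : ((TensorProduct.rid K (A ⊗[K] A)).toLinearMap ∘ₗ f.lTensor (A ⊗[K] A)) =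
      (((TensorProduct.rid K A).toLinearMap ∘ₗ f.lTensor A).lTensor A) ∘ₗ
        (TensorProduct.assoc K A A A).toLinearMap := by
    ext a b c
    simp
  have h3 := congrArg (· ∘ₗ comul (R := K)) h1
  simp only [LinearMap.comp_assoc] at h3
  rw [rightHit, h3, ← LinearMap.comp_assoc, h2, LinearMap.comp_assoc, coassoc,
    ← LinearMap.comp_assoc, ← LinearMap.lTensor_comp, LinearMap.comp_assoc]

/-- Coassociativity: both sides are `a₁ f(a₂) ⊗ a₃`. This moves an augmentation from one tensor
factor to the other. -/
theorem rTensor_rightHit_comp_comul (f : A →ₗ[K] K) :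
    (rightHit f).rTensor A ∘ₗ comul = (leftHit f).lTensor A ∘ₗ comul := by
  have h2 : ((TensorProduct.rid K A).toLinearMap ∘ₗ f.lTensor A).rTensor A =
      (((TensorProduct.lid K A).toLinearMap ∘ₗ f.rTensor A).lTensor A) ∘ₗ
        (TensorProduct.assoc K A A A).toLinearMap := by
    ext a b c
    simp [TensorProduct.smul_tmul]
  rw [rightHit, ← LinearMap.comp_assoc, LinearMap.rTensor_comp, h2, LinearMap.comp_assoc,
    LinearMap.comp_assoc, coassoc, ← LinearMap.comp_assoc, ← LinearMap.lTensor_comp]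
  rfl

theorem rightHit_leftHit (f g : A →ₗ[K] K) (a : A) :
    rightHit f (leftHit g a) = leftHit g (rightHit f a) := by
  have h := LinearMap.congr_fun (comul_comp_leftHit g) a
  simp only [LinearMap.comp_apply] at h
  have h2 : ((TensorProduct.rid K A).toLinearMap ∘ₗ f.lTensor A) ∘ₗ (leftHit g).rTensor A =
      leftHit g ∘ₗ (TensorProduct.rid K A).toLinearMap ∘ₗ f.lTensor A := by
    ext a b
    simp
  have h3 := LinearMap.congr_fun h2 (comul a)
  simp only [LinearMap.comp_apply] at h3
  simp only [rightHit, LinearMap.comp_apply]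
  rw [h, h3]

theorem counit_rightHit (f : A →ₗ[K] K) (a : A) : counit (R := K) (rightHit f a) = f a := by
  have h := congrArg (fun t => (TensorProduct.lid K K) (TensorProduct.map LinearMap.id f t))
    (sum_counit_tmul_eq (ℛ K a))
  simp only [map_sum, TensorProduct.map_tmul, LinearMap.id_apply, TensorProduct.lid_tmul,
    one_smul] at h
  rw [← h]
  simp [rightHit, ← (ℛ K a).eq, mul_comm]

theorem rid_map_comul {M : Type*} [AddCommGroup M] [Module K M] (F : A →ₗ[K] M) (f : A →ₗ[K] K)
    (a : A) : TensorProduct.rid K M (TensorProduct.map F f (comul a)) = F (rightHit f a) := by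
  simp [rightHit, ← (ℛ K a).eq]

theorem lid_map_comul {M : Type*} [AddCommGroup M] [Module K M] (F : A →ₗ[K] M) (f : A →ₗ[K] K)
    (a : A) : TensorProduct.lid K M (TensorProduct.map f F (comul a)) = F (leftHit f a) := by
  simp [leftHit, ← (ℛ K a).eq]

/-! ### Twists -/

variable {E : Type*} [Ring E] [Algebra K E]

/-- A form, with values in an algebra. -/
def BiForm.embed (E : Type*) [Ring E] [Algebra K E] (γ : BiForm K A) :
    WithConv (A ⊗[K] A →ₗ[K] E) :=
  WithConv.toConv (Algebra.linearMap K E ∘ₗ γ.ofConv)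

theorem BiForm.embed_tmul (γ : BiForm K A) (a b : A) :
    BiForm.embed E γ (a ⊗ₜ b) = algebraMap K E (γ (a ⊗ₜ b)) := rfl

theorem conv_ext {γ τ : WithConv (A ⊗[K] A →ₗ[K] E)} (h : ∀ a b : A, γ (a ⊗ₜ b) = τ (a ⊗ₜ b)) :
    γ = τ := by
  apply WithConv.ofConv_injective
  exact TensorProduct.ext' h

theorem BiForm.embed_mul_embed_inverse {γ : BiForm K A} (hγ : IsUnit γ) :
    BiForm.embed E γ * BiForm.embed E (Ring.inverse γ) = 1 := by
  refine conv_ext fun a b => ?_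
  have h : (γ * Ring.inverse γ) (a ⊗ₜ b) = (1 : BiForm K A) (a ⊗ₜ b) := by
    rw [Ring.mul_inverse_cancel _ hγ]
  rw [convMul_tmul (ℛ K a) (ℛ K b)] at h
  rw [convMul_tmul (ℛ K a) (ℛ K b)]
  simp only [BiForm.embed_tmul, ← map_mul, ← map_sum, h]
  rw [BiForm.one_tmul]
  simp [mul_comm]

/-- Cancelling `γ⁻¹` on the right, multiplicativity of `φ` on the twist becomes `φ(γ(a₁, b₁) a₂ b₂)
= φ(a₁) φ(b₁) γ(a₂, b₂)`. -/
theorem twistMul_eq_of_convMul {B : Type*} [Ring B] [Algebra K B] {γ : BiForm K A}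
    (hγ : IsUnit γ) (φ : A →ₗ[K] B)
    (h : ∀ a b : A, φ ((BiForm.embed A γ * WithConv.toConv (LinearMap.mul' K A)) (a ⊗ₜ b)) =
      (WithConv.toConv (LinearMap.mul' K B ∘ₗ TensorProduct.map φ φ) * BiForm.embed B γ)
        (a ⊗ₜ b)) (a b : A) : φ (twistMul γ (a ⊗ₜ b)) = φ a * φ b := by
  set C := BiForm.embed A γ * WithConv.toConv (LinearMap.mul' K A) with hC
  set P : WithConv (A ⊗[K] A →ₗ[K] B) :=
    WithConv.toConv (LinearMap.mul' K B ∘ₗ TensorProduct.map φ φ) with hP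
  have h1 : φ (twistMul γ (a ⊗ₜ b)) =
      (WithConv.toConv (φ ∘ₗ C.ofConv) * BiForm.embed B (Ring.inverse γ)) (a ⊗ₜ b) := by
    have : twistMul γ (a ⊗ₜ b) = (C * BiForm.embed A (Ring.inverse γ)) (a ⊗ₜ b) := rfl
    rw [this, convMul_tmul (ℛ K a) (ℛ K b), convMul_tmul (ℛ K a) (ℛ K b)]
    simp only [map_sum, BiForm.embed_tmul, ← Algebra.commutes, ← Algebra.smul_def, map_smul]
    rfl
  have h2 : WithConv.toConv (φ ∘ₗ C.ofConv) = P * BiForm.embed B γ := conv_ext h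
  rw [h1, h2, mul_assoc, BiForm.embed_mul_embed_inverse hγ, mul_one]
  rfl

end RightHit

namespace QuantumLinearSpace

open Coalgebra

variable {K Γ : Type*} [Field K] [CommGroup Γ] {θ : ℕ} (W : QuantumLinearSpace K Γ θ)

/-! ### Algebra maps out of `T(W) # K[Γ]` -/

/-- The algebra map `t ↦ f(t₁) ⊗ f'(t₂)`. -/
def tensorHom {E E' : Type*} [Ring E] [Algebra K E] [Ring E'] [Algebra K E']
    (f : W.TensorBos →ₐ[K] E) (f' : W.TensorBos →ₐ[K] E') : W.TensorBos →ₐ[K] E ⊗[K] E' :=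
  (Algebra.TensorProduct.map f f').comp W.tensorComul

theorem tensorHom_apply {E E' : Type*} [Ring E] [Algebra K E] [Ring E'] [Algebra K E']
    (f : W.TensorBos →ₐ[K] E) (f' : W.TensorBos →ₐ[K] E') (t : W.TensorBos) :
    W.tensorHom f f' t = TensorProduct.map f.toLinearMap f'.toLinearMap (comul t) := rfl

theorem tensorHom_grp {E E' : Type*} [Ring E] [Algebra K E] [Ring E'] [Algebra K E']
    (f : W.TensorBos →ₐ[K] E) (f' : W.TensorBos →ₐ[K] E') (h : Γ) :
    W.tensorHom f f' (W.tensorGrp h) = f (W.tensorGrp h) ⊗ₜ f' (W.tensorGrp h) := by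
  rw [tensorHom, AlgHom.comp_apply, tensorComul_grp, Algebra.TensorProduct.map_tmul]

theorem tensorHom_X {E E' : Type*} [Ring E] [Algebra K E] [Ring E'] [Algebra K E']
    (f : W.TensorBos →ₐ[K] E) (f' : W.TensorBos →ₐ[K] E') (i : Fin θ) :
    W.tensorHom f f' (W.tensorX i) =
      f (W.tensorX i) ⊗ₜ 1 + f (W.tensorGrp (W.g i)) ⊗ₜ f' (W.tensorX i) := by
  rw [tensorHom, AlgHom.comp_apply, tensorComul_X, map_add, Algebra.TensorProduct.map_tmul,
    Algebra.TensorProduct.map_tmul, map_one]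

namespace LiftingScalars

variable {W} (L : W.LiftingScalars)

/-- The relations `xᵢ^{rᵢ} = aᵢ (c + d gᵢ^{rᵢ})` and
`xᵢ xⱼ = χⱼ(gᵢ) xⱼ xᵢ + a_{ij} (c + d gᵢ gⱼ)`. -/
structure IsDeformation (c d : K) {E : Type*} [Ring E] [Algebra K E]
    (f : W.TensorBos →ₐ[K] E) : Prop where
  pow : ∀ i, f (W.tensorX i) ^ W.r i = L.a i • (c • 1 + d • f (W.tensorGrp (W.g i ^ W.r i)))
  comm : ∀ i j, i ≠ j → f (W.tensorX i) * f (W.tensorX j) =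
    (W.χ j (W.g i) : K) • (f (W.tensorX j) * f (W.tensorX i)) +
      L.aa i j • (c • 1 + d • f (W.tensorGrp (W.g i * W.g j)))

variable {L}

theorem isGaloisRep_iff {E : Type*} [Ring E] [Algebra K E] {f : W.TensorBos →ₐ[K] E} :
    L.IsGaloisRep f ↔ L.IsDeformation 1 0 f := by
  constructor
  · intro h
    exact ⟨fun i => by simp [h.pow], fun i j hij => by simp [h.comm i j hij]⟩
  · intro h
    exact ⟨fun i => by simp [h.pow], fun i j hij => by simp [h.comm i j hij]⟩

/-- The defining expressions are skew primitive, so the right-hand sides add up as `(c + d g) ⊗ 1 +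
g ⊗ (c' + d' g)`, and the middle terms cancel when `c' = -d`. The types `(1, 0)`, `(0, -1)`, `(1,
-1)` and `(0, 0)` belong to the Galois object, its opposite, the lifting and `A`. -/
theorem IsDeformation.tensorHom {E E' : Type*} [Ring E] [Algebra K E] [Ring E'] [Algebra K E']
    {f : W.TensorBos →ₐ[K] E} {f' : W.TensorBos →ₐ[K] E'} {c d c' d' : K}
    (h : L.IsDeformation c d f) (h' : L.IsDeformation c' d' f') (hd : c' = -d) :
    L.IsDeformation c d' (W.tensorHom f f') where
  pow i := by
    have hpow := add_pow_of_q_comm (W.qls_two i) (W.one_lt_r i)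
      (f (W.tensorX i) ⊗ₜ[K] (1 : E')) (f (W.tensorGrp (W.g i)) ⊗ₜ[K] f' (W.tensorX i)) (by
        rw [Algebra.TensorProduct.tmul_mul_tmul, Algebra.TensorProduct.tmul_mul_tmul,
          ← map_mul f, tensorGrp_mul_X, mul_one, one_mul, map_smul, map_mul,
          TensorProduct.smul_tmul'])
    rw [tensorHom_X, hpow, Algebra.TensorProduct.tmul_pow, Algebra.TensorProduct.tmul_pow, one_pow,
      h.pow, h'.pow, ← map_pow f, ← grp_pow, tensorHom_grp, hd, Algebra.TensorProduct.one_def]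
    simp only [TensorProduct.add_tmul, TensorProduct.tmul_add, TensorProduct.tmul_smul,
      ← TensorProduct.smul_tmul', smul_add, neg_smul, smul_neg, TensorProduct.tmul_neg]
    abel
  comm i j hij := by
    have hc : (W.χ j (W.g i) : K) * (W.χ i (W.g j) : K) = 1 := qls_one_val hij.symm
    have h1 : ∀ (k : Γ) (l : Fin θ), f (W.tensorGrp k) * f (W.tensorX l) =
        (W.χ l k : K) • (f (W.tensorX l) * f (W.tensorGrp k)) := by
      intro k l
      rw [← map_mul, tensorGrp_mul_X, map_smul, map_mul]
    have h2 : f (W.tensorGrp (W.g i)) * f (W.tensorGrp (W.g j)) =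
        f (W.tensorGrp (W.g i * W.g j)) := by rw [tensorGrp_mul, map_mul]
    have h3 : f (W.tensorGrp (W.g j)) * f (W.tensorGrp (W.g i)) =
        f (W.tensorGrp (W.g i * W.g j)) := by rw [mul_comm, tensorGrp_mul, map_mul]
    simp only [tensorHom_X, tensorHom_grp, mul_add, add_mul, Algebra.TensorProduct.tmul_mul_tmul,
      mul_one, one_mul, h1, h2, h3, h.comm i j hij, h'.comm i j hij, hd,
      Algebra.TensorProduct.one_def, TensorProduct.add_tmul, TensorProduct.tmul_add,
      TensorProduct.tmul_smul, ← TensorProduct.smul_tmul', smul_add, neg_smul, smul_neg,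
      TensorProduct.tmul_neg, smul_smul, hc, one_smul]
    abel

variable (L)

/-- The projection of `T(W) # K[Γ]` onto the lifting. -/
def projLifting : W.TensorBos →ₐ[K] L.Lifting := Ideal.Quotient.mkₐ K L.ideal

theorem projLifting_surjective : Function.Surjective L.projLifting :=
  Ideal.Quotient.mk_surjective

theorem comul_projLifting (t : W.TensorBos) : comul (R := K) (L.projLifting t) =
    TensorProduct.map L.projLifting.toLinearMap L.projLifting.toLinearMap (comul t) := rfl

theorem counit_projLifting (t : W.TensorBos) : counit (R := K) (L.projLifting t) = counit t := rfl

theorem projLifting_eq_zero {t : W.TensorBos} (ht : t ∈ L.relators) : L.projLifting t = 0 :=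
  Ideal.Quotient.eq_zero_iff_mem.2 (L.relators_subset ht)

theorem isDeformation_projLifting : L.IsDeformation 1 (-1) L.projLifting where
  pow i := by
    have := L.projLifting_eq_zero (Or.inl ⟨i, rfl⟩)
    rw [map_sub, sub_eq_zero, map_pow, map_smul, map_sub, map_one] at this
    rw [this, one_smul, neg_one_smul, sub_eq_add_neg]
  comm i j hij := by
    have := L.projLifting_eq_zero (Or.inr ⟨i, j, hij, rfl⟩)
    rw [map_sub, map_sub, sub_sub, sub_eq_zero, map_mul, map_smul, map_mul, map_smul, map_sub,
      map_one] at this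
    rw [this, one_smul, neg_one_smul, sub_eq_add_neg]

theorem IsDeformation.map_eq_zero {L : W.LiftingScalars} {E : Type*} [Ring E] [Algebra K E]
    {f : W.TensorBos →ₐ[K] E} (h : L.IsDeformation 1 (-1) f) {t : W.TensorBos}
    (ht : L.projLifting t = 0) : f t = 0 := by
  refine L.map_eq_zero f ?_ (Ideal.Quotient.eq_zero_iff_mem.1 ht)
  rintro t (⟨i, rfl⟩ | ⟨i, j, hij, rfl⟩)
  · rw [map_sub, map_pow, h.pow, map_smul, map_sub, map_one, one_smul, neg_one_smul,
      ← sub_eq_add_neg, sub_self]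
  · rw [map_sub, map_sub, map_mul, h.comm i j hij, map_smul, map_mul, map_smul, map_sub, map_one,
      one_smul, neg_one_smul, ← sub_eq_add_neg, add_sub_cancel_left, sub_self]

/-! ### The coalgebra map to the lifting -/

/-- The map `t ↦ ρ(t) 1`. -/
def orbit : W.TensorBos →ₗ[K] W.Biproduct :=
  LinearMap.applyₗ (1 : W.Biproduct) ∘ₗ L.rep.toLinearMap

theorem orbit_apply (t : W.TensorBos) : L.orbit t = L.rep t 1 := rfl

theorem orbit_sec (a : W.Biproduct) : L.orbit (W.sec a) = a := L.rep_sec_one a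

/-- The functional `t ↦ ε(ρ(t) 1)`. -/
def augment : W.TensorBos →ₗ[K] K := counit ∘ₗ L.orbit

theorem comul_orbit (t : W.TensorBos) : comul (R := K) (L.orbit t) =
    TensorProduct.map L.orbit W.proj.toLinearMap (comul t) := by
  have R := ℛ K t
  rw [orbit_apply, comul_rep, L.tensorRep_repr R, Bialgebra.comul_one,
    Algebra.TensorProduct.one_def, LinearMap.sum_apply, ← R.eq, map_sum]
  refine Finset.sum_congr rfl fun i _ => ?_
  simp [orbit_apply]

/-- The orbit map is right colinear, hence determined by its composite with `ε`. -/
theorem orbit_eq (t : W.TensorBos) : L.orbit t = W.proj (leftHit L.augment t) := by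
  have h := lid_map_comul W.proj.toLinearMap L.augment t
  rw [AlgHom.toLinearMap_apply] at h
  rw [← h]
  have h2 : L.orbit t = TensorProduct.lid K W.Biproduct
      (counit.rTensor W.Biproduct (comul (L.orbit t))) := by
    rw [rTensor_counit_comul]
    simp
  rw [h2, comul_orbit, augment, LinearMap.rTensor, ← LinearMap.comp_apply (TensorProduct.map _ _),
    ← TensorProduct.map_comp, LinearMap.id_comp]

/-- The coalgebra map from `B(W) # K[Γ]` to the lifting: it sends `ρ(t) 1` to `[t₁] ε(ρ(t₂) 1)`. -/
def toLifting : W.Biproduct →ₗ[K] L.Lifting :=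
  L.projLifting.toLinearMap ∘ₗ rightHit L.augment ∘ₗ W.sec

/-- This is independence of the chosen section: `t ↦ [t₁] ⊗ ρ(t₂)` satisfies the Galois relations,
so it only depends on `ρ(t) 1`. -/
theorem toLifting_orbit (t : W.TensorBos) :
    L.toLifting (L.orbit t) = L.projLifting (rightHit L.augment t) := by
  have hG : L.IsGaloisRep (W.tensorHom L.projLifting L.rep) :=
    isGaloisRep_iff.2 (L.isDeformation_projLifting.tensorHom
      (isGaloisRep_iff.1 L.isGaloisRep_rep) (neg_neg 1).symm)
  have key : ∀ s, L.projLifting (rightHit L.augment s) = TensorProduct.rid K L.Lifting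
      (LinearMap.lTensor L.Lifting (counit ∘ₗ LinearMap.applyₗ (1 : W.Biproduct))
        (W.tensorHom L.projLifting L.rep s)) := by
    intro s
    have h := rid_map_comul L.projLifting.toLinearMap L.augment s
    rw [AlgHom.toLinearMap_apply] at h
    have e : TensorProduct.map L.projLifting.toLinearMap L.augment =
        LinearMap.lTensor L.Lifting (counit ∘ₗ LinearMap.applyₗ (1 : W.Biproduct)) ∘ₗ
          TensorProduct.map L.projLifting.toLinearMap L.rep.toLinearMap := by
      rw [LinearMap.lTensor, ← TensorProduct.map_comp, LinearMap.id_comp]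
      rfl
    rw [← h, tensorHom_apply, e, LinearMap.comp_apply]
  rw [key, ← hG.sec_rep t, ← key]
  rfl

theorem map_toLifting_comul_orbit (t : W.TensorBos) :
    TensorProduct.map L.toLifting LinearMap.id (comul (R := K) (L.orbit t)) =
      TensorProduct.map L.projLifting.toLinearMap L.orbit (comul t) := by
  have h1 : L.toLifting ∘ₗ L.orbit = L.projLifting.toLinearMap ∘ₗ rightHit L.augment :=
    LinearMap.ext L.toLifting_orbit
  have h2 : L.orbit = W.proj.toLinearMap ∘ₗ leftHit L.augment := LinearMap.ext L.orbit_eq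
  have h3 := LinearMap.congr_fun (rTensor_rightHit_comp_comul L.augment) t
  simp only [LinearMap.comp_apply] at h3
  rw [comul_orbit, ← LinearMap.comp_apply (TensorProduct.map _ _), ← TensorProduct.map_comp, h1,
    h2, LinearMap.id_comp]
  have e1 : TensorProduct.map (L.projLifting.toLinearMap ∘ₗ rightHit L.augment)
      W.proj.toLinearMap = TensorProduct.map L.projLifting.toLinearMap W.proj.toLinearMap ∘ₗ
        (rightHit L.augment).rTensor _ := by
    rw [LinearMap.rTensor, ← TensorProduct.map_comp, LinearMap.comp_id]
  have e2 : TensorProduct.map L.projLifting.toLinearMap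
      (W.proj.toLinearMap ∘ₗ leftHit L.augment) =
        TensorProduct.map L.projLifting.toLinearMap W.proj.toLinearMap ∘ₗ
        (leftHit L.augment).lTensor _ := by
    rw [LinearMap.lTensor, ← TensorProduct.map_comp, LinearMap.comp_id]
  rw [e1, e2, LinearMap.comp_apply, LinearMap.comp_apply, h3]

theorem comul_toLifting (a : W.Biproduct) : comul (R := K) (L.toLifting a) =
    TensorProduct.map L.toLifting L.toLifting (comul a) := by
  rw [← L.orbit_sec a]
  set t := W.sec a
  have h1 : L.toLifting ∘ₗ L.orbit = L.projLifting.toLinearMap ∘ₗ rightHit L.augment :=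
    LinearMap.ext L.toLifting_orbit
  have h3 := LinearMap.congr_fun (comul_comp_rightHit L.augment) t
  simp only [LinearMap.comp_apply] at h3
  have e1 : TensorProduct.map L.toLifting L.toLifting = TensorProduct.map LinearMap.id L.toLifting ∘ₗ
      TensorProduct.map L.toLifting LinearMap.id := by
    rw [← TensorProduct.map_comp, LinearMap.comp_id, LinearMap.id_comp]
  have e2 : TensorProduct.map L.projLifting.toLinearMap
      (L.projLifting.toLinearMap ∘ₗ rightHit L.augment) =
        TensorProduct.map L.projLifting.toLinearMap L.projLifting.toLinearMap ∘ₗ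
        (rightHit L.augment).lTensor _ := by
    rw [LinearMap.lTensor, ← TensorProduct.map_comp, LinearMap.comp_id]
  rw [e1, LinearMap.comp_apply, map_toLifting_comul_orbit,
    ← LinearMap.comp_apply (TensorProduct.map _ _), ← TensorProduct.map_comp, h1,
    LinearMap.id_comp, e2, LinearMap.comp_apply, ← h3, toLifting_orbit, comul_projLifting]

theorem counit_toLifting (a : W.Biproduct) :
    counit (R := K) (L.toLifting a) = counit (R := K) a := by
  rw [← L.orbit_sec a, toLifting_orbit, counit_projLifting, counit_rightHit]
  rfl

theorem orbit_grp (h : Γ) : L.orbit (W.tensorGrp h) = W.grp h := by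
  rw [orbit_apply, rep_grp, lg_apply, mul_one]

theorem rightHit_augment_grp (h : Γ) :
    rightHit L.augment (W.tensorGrp h) = W.tensorGrp h := by
  have h1 : comul (R := K) (W.tensorGrp h) = W.tensorGrp h ⊗ₜ W.tensorGrp h := W.tensorComul_grp h
  simp [rightHit, h1, augment, orbit_grp, counit_grp]

theorem toLifting_grp (h : Γ) : L.toLifting (W.grp h) = L.projLifting (W.tensorGrp h) := by
  rw [← L.orbit_grp, toLifting_orbit, rightHit_augment_grp]

theorem toLifting_one : L.toLifting 1 = 1 := by
  rw [← grp_one, toLifting_grp, tensorGrp_one, map_one]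

theorem augment_mul (t s : W.TensorBos) :
    L.augment (t * s) = L.sigma (L.orbit t ⊗ₜ L.orbit s) := by
  rw [sigma_tmul, orbit_apply, circ_rep, augment, LinearMap.comp_apply, orbit_apply, map_mul]
  rfl

/-- For representatives `t`, `s` of `a`, `b` both sides are `[t₁ s₁] ε(ρ(t₂ s₂) 1)`, computed
through `Δ(ts) = Δ(t) Δ(s)`. -/
theorem toLifting_circ {ι κ : Type*} {a b : W.Biproduct} (Ra : Repr K a ι) (Rb : Repr K b κ) :
    L.toLifting (L.circ a b) = ∑ i ∈ Ra.index, ∑ j ∈ Rb.index,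
      L.sigma (Ra.right i ⊗ₜ Rb.right j) • (L.toLifting (Ra.left i) * L.toLifting (Rb.left j)) := by
  let G : (L.Lifting ⊗[K] W.Biproduct) ⊗[K] (L.Lifting ⊗[K] W.Biproduct) →ₗ[K] L.Lifting :=
    (TensorProduct.rid K L.Lifting).toLinearMap ∘ₗ
      TensorProduct.map (LinearMap.mul' K L.Lifting) L.sigma.ofConv ∘ₗ
      (TensorProduct.tensorTensorTensorComm K L.Lifting W.Biproduct L.Lifting
        W.Biproduct).toLinearMap
  have hG : ∀ u c v d, G ((u ⊗ₜ c) ⊗ₜ (v ⊗ₜ d)) = L.sigma (c ⊗ₜ d) • (u * v) := by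
    intro u c v d
    simp [G]
  have h1 : ∑ i ∈ Ra.index, ∑ j ∈ Rb.index,
      L.sigma (Ra.right i ⊗ₜ Rb.right j) • (L.toLifting (Ra.left i) * L.toLifting (Rb.left j)) =
      G (TensorProduct.map L.toLifting LinearMap.id (comul a) ⊗ₜ
        TensorProduct.map L.toLifting LinearMap.id (comul b)) := by
    rw [← Ra.eq, ← Rb.eq]
    simp only [map_sum, TensorProduct.map_tmul, TensorProduct.sum_tmul, TensorProduct.tmul_sum, hG,
      LinearMap.id_apply]
    exact Finset.sum_comm
  rw [h1]
  have hab : L.circ a b = L.orbit (W.sec a * W.sec b) := by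
    rw [orbit_apply, map_mul, Module.End.mul_apply, rep_sec_one]
    rfl
  rw [hab, toLifting_orbit]
  conv_rhs => rw [← L.orbit_sec a, ← L.orbit_sec b]
  rw [map_toLifting_comul_orbit, map_toLifting_comul_orbit]
  set t := W.sec a
  set s := W.sec b
  have h2 := rid_map_comul L.projLifting.toLinearMap L.augment (t * s)
  rw [AlgHom.toLinearMap_apply] at h2
  rw [← h2, Bialgebra.comul_mul, ← (ℛ K t).eq, ← (ℛ K s).eq]
  simp only [map_sum, TensorProduct.map_tmul, TensorProduct.sum_tmul, TensorProduct.tmul_sum, hG,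
    Finset.sum_mul, Finset.mul_sum, Algebra.TensorProduct.tmul_mul_tmul, augment_mul,
    AlgHom.toLinearMap_apply, map_mul, TensorProduct.rid_tmul]

theorem toLifting_twistMul (hu : IsUnit L.sigma) (a b : W.Biproduct) :
    L.toLifting (twistMul L.sigma (a ⊗ₜ b)) = L.toLifting a * L.toLifting b := by
  refine twistMul_eq_of_convMul hu L.toLifting (fun a b => ?_) a b
  have h : (BiForm.embed W.Biproduct L.sigma *
      WithConv.toConv (LinearMap.mul' K W.Biproduct)) (a ⊗ₜ b) = L.circ a b := by
    rw [convMul_tmul (ℛ K a) (ℛ K b), L.circ_repr (ℛ K a) (ℛ K b)]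
    simp only [BiForm.embed_tmul, ← Algebra.smul_def]
    rfl
  rw [h, L.toLifting_circ (ℛ K a) (ℛ K b), convMul_tmul (ℛ K a) (ℛ K b)]
  simp only [BiForm.embed_tmul, ← Algebra.commutes, ← Algebra.smul_def]
  rfl

/-- The image is closed under products by multiplicativity on the twist, so it suffices to reach the
generators. -/
theorem toLifting_surjective (hu : IsUnit L.sigma) : Function.Surjective L.toLifting := by
  intro b
  obtain ⟨t, rfl⟩ := L.projLifting_surjective b
  have hmul : ∀ u ∈ LinearMap.range L.toLifting, ∀ v ∈ LinearMap.range L.toLifting,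
      u * v ∈ LinearMap.range L.toLifting := by
    rintro _ ⟨a, rfl⟩ _ ⟨b, rfl⟩
    exact ⟨_, L.toLifting_twistMul hu a b⟩
  have hgrp : ∀ h, L.projLifting (W.tensorGrp h) ∈ LinearMap.range L.toLifting := fun h =>
    ⟨_, L.toLifting_grp h⟩
  have hX : ∀ i, L.projLifting (W.tensorX i) ∈ LinearMap.range L.toLifting := by
    intro i
    have h1 : comul (R := K) (W.tensorX i) =
        W.tensorX i ⊗ₜ 1 + W.tensorGrp (W.g i) ⊗ₜ W.tensorX i := W.tensorComul_X i
    have h2 : L.augment 1 = 1 := by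
      simp [augment, orbit_apply]
    -- The class of `ρ(xᵢ) 1` maps to `xᵢ` up to a multiple of `gᵢ`, which is already in the image.
    have h3 : rightHit L.augment (W.tensorX i) =
        W.tensorX i + L.augment (W.tensorX i) • W.tensorGrp (W.g i) := by
      simp [rightHit, h1, h2]
    have h4 := L.toLifting_orbit (W.tensorX i)
    rw [h3, map_add, map_smul] at h4
    have h5 := sub_mem (LinearMap.mem_range_self L.toLifting (L.orbit (W.tensorX i)))
      (Submodule.smul_mem _ (L.augment (W.tensorX i)) (hgrp (W.g i)))
    rwa [h4, add_sub_cancel_right] at h5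
  refine W.tensorBos_left_induction
    ((LinearMap.range L.toLifting).comap L.projLifting.toLinearMap) ?_ ?_ ?_ t
  · have := hgrp 1
    rwa [tensorGrp_one] at this
  · intro h t ht
    rw [Submodule.mem_comap, AlgHom.toLinearMap_apply] at ht ⊢
    rw [map_mul]
    exact hmul _ (hgrp h) _ ht
  · intro i t ht
    rw [Submodule.mem_comap, AlgHom.toLinearMap_apply] at ht ⊢
    rw [map_mul]
    exact hmul _ (hX i) _ ht

end LiftingScalars

end QuantumLinearSpace

theorem QComm.mul_pow {K E : Type*} [Field K] [Ring E] [Algebra K E] {q : K} {u v : E}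
    (h : QComm q v u) (n : ℕ) :
    (u * v) ^ n = q ^ (∑ k ∈ Finset.range n, k) • (u ^ n * v ^ n) := by
  induction n with
  | zero => simp
  | succ n ih =>
    have h1 : v ^ n * u = q ^ n • (u * v ^ n) := (h.pow_left n).eq
    rw [pow_succ, ih, smul_mul_assoc, mul_assoc, ← mul_assoc (v ^ n), h1, smul_mul_assoc,
      mul_smul_comm, smul_smul, Finset.sum_range_succ, pow_add, mul_assoc u, ← pow_succ,
      ← mul_assoc, ← pow_succ]

namespace QuantumLinearSpace

open Coalgebra

variable {K Γ : Type*} [Field K] [CommGroup Γ] {θ : ℕ} (W : QuantumLinearSpace K Γ θ)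

/-! ### The derivations detect elements -/

theorem lower_eq_zero {a : W.Biproduct} (ha : ∀ i, W.der i a = 0) {n : Fin θ → ℕ}
    {l : List (Fin θ)} (hn : ∃ k ∈ l, n k ≠ 0) : W.lower n l a = 0 := by
  induction l with
  | nil => simp at hn
  | cons i l ih =>
    rw [lower, LinearMap.comp_apply]
    rcases Nat.eq_zero_or_pos (n i) with h0 | h0
    · obtain ⟨k, hk, hnk⟩ := hn
      rw [h0, pow_zero, Module.End.one_apply]
      refine ih ⟨k, (List.mem_cons.1 hk).resolve_left ?_, hnk⟩
      rintro rfl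
      exact hnk h0
    · obtain ⟨m, hm⟩ : ∃ m, n i = m + 1 := ⟨n i - 1, by omega⟩
      rw [hm, pow_succ, Module.End.mul_apply, ha, map_zero, map_zero]

/-- The functional extracting the coefficient of a monomial of positive degree applies some `∂ᵢ`
first, so that coefficient is zero. -/
theorem mem_span_grp {a : W.Biproduct} (ha : ∀ i, W.der i a = 0) :
    a ∈ Submodule.span K (Set.range W.grp) := by
  classical
  have hc : ∀ s : (∀ i, Fin (W.r i)) × Γ, (∃ k, (s.1 k : ℕ) ≠ 0) → W.pbwBasis.repr a s = 0 := by
    rintro s ⟨k, hk⟩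
    have h := W.lower_eq_zero ha (n := fun i => s.1 i) ⟨k, List.mem_finRange k, hk⟩
    have h2 := congrArg (fun f => f s.2) h
    conv at h2 =>
      lhs
      rw [← W.pbwBasis.linearCombination_repr a]
    simp only [Finsupp.linearCombination_apply, Finsupp.sum, map_sum, map_smul,
      Finsupp.finsetSum_apply, Finsupp.smul_apply, Finsupp.zero_apply] at h2
    by_contra hne
    rw [Finset.sum_eq_single_of_mem s (Finsupp.mem_support_iff.2 hne)] at h2
    · rw [pbwBasis_apply, W.lower_pbw _ _ (fun i => (s.1 i).2) (List.nodup_finRange θ),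
        if_pos (fun _ _ => rfl), Finsupp.smul_apply, Finsupp.single_eq_same, smul_eq_mul,
        smul_eq_mul, mul_one] at h2
      refine (mul_ne_zero hne (List.prod_ne_zero ?_)) h2
      intro h0
      obtain ⟨k, -, hk⟩ := List.mem_map.1 h0
      exact qFact_ne_zero (W.qls_two k) (s.1 k).2 hk
    · intro t _ ht
      rw [pbwBasis_apply, W.lower_pbw _ _ (fun i => (t.1 i).2) (List.nodup_finRange θ)]
      split_ifs with hk
      · have h1 : t.1 = s.1 := funext fun k => Fin.ext (hk k (List.mem_finRange k))
        have h2 : t.2 ≠ s.2 := fun h2 => ht (Prod.ext h1 h2)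
        rw [Finsupp.smul_apply, Finsupp.single_eq_of_ne h2.symm, smul_zero, smul_zero]
      · simp
  rw [← W.pbwBasis.linearCombination_repr a, Finsupp.linearCombination_apply]
  refine Submodule.sum_mem _ fun s hs => Submodule.smul_mem _ _ ?_
  have h0 : ∀ k, (s.1 k : ℕ) = 0 := by
    intro k
    by_contra hk
    exact Finsupp.mem_support_iff.1 hs (hc s ⟨k, hk⟩)
  refine Submodule.subset_span ⟨s.2, ?_⟩
  rw [pbwBasis_apply, pbw, listMono, List.prod_eq_one, one_mul]
  intro u hu
  obtain ⟨k, -, rfl⟩ := List.mem_map.1 hu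
  rw [h0, pow_zero]

/-- A subspace of `B(W) # K[Γ]` that is stable under the derivations, and meets `K[Γ]` trivially,
is zero. -/
theorem eq_bot_of_der_stable {N : Submodule K W.Biproduct} (hN : ∀ i, ∀ a ∈ N, W.der i a ∈ N)
    (h0 : ∀ a ∈ N, a ∈ Submodule.span K (Set.range W.grp) → a = 0) : N = ⊥ := by
  have key : ∀ (l : List (Fin θ)), ∀ a ∈ N, (∀ k, k ∉ l → W.der k a = 0) → a = 0 := by
    intro l
    induction l with
    | nil => exact fun a ha hk => h0 a ha (W.mem_span_grp fun i => hk i (by simp))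
    | cons i l ih =>
      intro a ha hk
      have hpow : ∀ s, (W.der i ^ s) a ∈ N := by
        intro s
        induction s with
        | zero => simpa using ha
        | succ s ihs => rw [pow_succ', Module.End.mul_apply]; exact hN i _ ihs
      -- Since the derivations `q`-commute, `∂ᵢ^s a` is still killed by those outside `i :: l`, and
      -- now by `∂ᵢ` as well. The induction hypothesis applies to it, and one descends from `∂ᵢ^{rᵢ}
      -- = 0`.
      have hstep : ∀ s, (W.der i ^ (s + 1)) a = 0 → (W.der i ^ s) a = 0 := by
        intro s hs
        refine ih _ (hpow s) fun k hkl => ?_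
        by_cases hki : k = i
        · rw [hki, ← Module.End.mul_apply, ← pow_succ', hs]
        · have hq := ((W.der_qComm_der hki).pow_right s).eq
          rw [← Module.End.mul_apply, hq, LinearMap.smul_apply, Module.End.mul_apply,
            hk k (by simp [hki, hkl]), map_zero, smul_zero]
      have hdown : ∀ s, (W.der i ^ s) a = 0 → a = 0 := by
        intro s
        induction s with
        | zero => simp
        | succ s ihs => exact fun hs => ihs (hstep s hs)
      exact hdown (W.r i) (by rw [der_pow_r]; rfl)
  rw [Submodule.eq_bot_iff]
  exact fun a ha => key (List.finRange θ) a ha fun k hk => absurd (List.mem_finRange k) hk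

/-- The quantum linear space with the inverse degrees. -/
def invDeg : QuantumLinearSpace K Γ θ where
  g i := (W.g i)⁻¹
  χ := W.χ
  r := W.r
  one_lt_r := W.one_lt_r
  qls_one i j h := by rw [map_inv, map_inv, ← mul_inv, W.qls_one i j h, inv_one]
  qls_two i := by
    rw [map_inv, Units.val_inv_eq_inv_val]
    exact (W.qls_two i).inv

theorem zeroScalars_rep (t : W.TensorBos) : W.zeroScalars.rep t 1 = W.proj t := by
  have h : W.zeroScalars.rep = (Algebra.lmul K W.Biproduct).comp W.proj := by
    refine W.tensorBos_ext (fun h => ?_) fun i => ?_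
    · rw [LiftingScalars.rep_grp]
      rfl
    · have h1 : ∀ k l, W.zeroScalars.low k l = 0 := fun k l => by
        simp [LiftingScalars.low, zeroScalars]
      have h2 : W.zeroScalars.a i = 0 := rfl
      rw [LiftingScalars.rep_X, LiftingScalars.genOp, LiftingScalars.lowOp, h2]
      simp only [h1, zero_smul, Finset.sum_const_zero, add_zero]
      rfl
  rw [h]
  simp

/-! ### The opposite Galois object and injectivity. -/

namespace LiftingScalars

variable {W} (L : W.LiftingScalars)

/-- The scalars of the opposite Galois object. -/
def invDeg : W.invDeg.LiftingScalars where
  -- The power of `χᵢ(gᵢ)` compensates the one in `(xᵢ gᵢ)^{rᵢ} = χᵢ(gᵢ)^{0+1+⋯+(rᵢ-1)} xᵢ^{rᵢ}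
  -- gᵢ^{rᵢ}`, leaving `-aᵢ gᵢ^{rᵢ}`.
  a i := -((W.χ i (W.g i) : K) ^ (∑ k ∈ Finset.range (W.r i), k))⁻¹ * L.a i
  aa i j := L.aa j i
  aa_swap i j h := by
    have h1 := L.aa_swap j i h.symm
    have h2 : (W.χ i (W.g j)⁻¹ : K) = W.χ j (W.g i) := by
      rw [map_inv, Units.val_inv_eq_inv_val]
      exact inv_eq_of_mul_eq_one_right (qls_one_val h)
    change L.aa i j = -(W.χ i (W.g j)⁻¹ : K) * L.aa j i
    rw [h2, h1]
  of_a_ne_zero i h := by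
    have := L.of_a_ne_zero i (right_ne_zero_of_mul h)
    refine ⟨?_, this.2⟩
    change (W.g i)⁻¹ ^ W.r i ≠ 1
    rw [inv_pow, Ne, inv_eq_one]
    exact this.1
  of_aa_ne_zero i j h ha := by
    have := L.of_aa_ne_zero j i h.symm ha
    refine ⟨?_, link_symm this.2⟩
    change (W.g i)⁻¹ * (W.g j)⁻¹ ≠ 1
    rw [← mul_inv, Ne, inv_eq_one, mul_comm]
    exact this.1

/-- A representation of `T(W) # K[Γ]` with `xᵢ^{rᵢ} = -aᵢ gᵢ^{rᵢ}` and
`xᵢ xⱼ = χⱼ(gᵢ) xⱼ xᵢ - a_{ij} gᵢ gⱼ`. -/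
def coRep : W.TensorBos →ₐ[K] Module.End K W.invDeg.Biproduct :=
  W.tensorLift W.invDeg.lg (fun i => L.invDeg.genOp i * W.invDeg.lg (W.g i)) W.invDeg.lg_one
    W.invDeg.lg_mul (fun h i => by
      have h1 : QComm (W.χ i h : K) (W.invDeg.lg h) (L.invDeg.genOp i) := L.invDeg.lg_qComm_genOp h i
      rw [← mul_assoc, h1.eq, smul_mul_assoc, mul_assoc, mul_assoc, ← lg_mul, ← lg_mul, mul_comm h])

theorem coRep_grp (h : Γ) : L.coRep (W.tensorGrp h) = W.invDeg.lg h :=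
  W.tensorLift_grp _ _ _ _ _ h

theorem coRep_X (i : Fin θ) :
    L.coRep (W.tensorX i) = L.invDeg.genOp i * W.invDeg.lg (W.g i) :=
  W.tensorLift_X _ _ _ _ _ i

theorem isDeformation_coRep : L.IsDeformation 0 (-1) L.coRep where
  pow i := by
    have h1 : QComm (W.χ i (W.g i) : K) (W.invDeg.lg (W.g i)) (L.invDeg.genOp i) :=
      L.invDeg.lg_qComm_genOp _ i
    have h2 : L.invDeg.genOp i ^ W.r i = L.invDeg.a i • 1 := L.invDeg.genOp_pow_r i
    have h3 : W.invDeg.lg (W.g i) ^ W.r i = W.invDeg.lg (W.g i ^ W.r i) := by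
      rw [← coRep_grp L, ← coRep_grp L, ← map_pow, grp_pow]
    have h4 : (W.χ i (W.g i) : K) ^ (∑ k ∈ Finset.range (W.r i), k) ≠ 0 :=
      pow_ne_zero _ (Units.ne_zero _)
    rw [coRep_X, h1.mul_pow, h2, h3, coRep_grp, zero_smul, zero_add, smul_mul_assoc, one_mul,
      smul_smul, smul_smul]
    congr 1
    change _ * (-((W.χ i (W.g i) : K) ^ (∑ k ∈ Finset.range (W.r i), k))⁻¹ * L.a i) = _
    rw [neg_mul, mul_neg, mul_inv_cancel_left₀ h4]
    ring
  comm i j hij := by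
    have h1 : ∀ k l, W.invDeg.lg (W.g k) * L.invDeg.genOp l =
        (W.χ l (W.g k) : K) • (L.invDeg.genOp l * W.invDeg.lg (W.g k)) := fun k l =>
      (L.invDeg.lg_qComm_genOp (W.g k) l).eq
    have h2 : L.invDeg.genOp i * L.invDeg.genOp j =
        (W.χ j (W.g i)⁻¹ : K) • (L.invDeg.genOp j * L.invDeg.genOp i) + L.aa j i • 1 :=
      L.invDeg.genOp_mul_genOp hij
    have h3 : (W.χ j (W.g i) : K) * (W.χ j (W.g i)⁻¹ : K) = 1 := by simp
    have h4 : (W.χ j (W.g i) : K) * (W.χ i (W.g j) : K) = 1 := qls_one_val hij.symm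
    have h5 : ∀ k l, L.coRep (W.tensorX k) * L.coRep (W.tensorX l) = (W.χ l (W.g k) : K) •
        (L.invDeg.genOp k * L.invDeg.genOp l * W.invDeg.lg (W.g k * W.g l)) := by
      intro k l
      rw [coRep_X, coRep_X, mul_assoc, ← mul_assoc (W.invDeg.lg (W.g k)), h1, smul_mul_assoc,
        mul_smul_comm, mul_assoc (L.invDeg.genOp l), ← lg_mul, ← mul_assoc]
    rw [h5, h5, h2, coRep_grp, smul_smul, h4, mul_comm (W.g j), add_mul, smul_add, smul_mul_assoc,
      smul_smul, h3, smul_mul_assoc, one_mul, smul_smul, L.aa_swap j i hij.symm, zero_smul,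
      zero_add, neg_one_smul, smul_neg, neg_mul, neg_smul, neg_neg]

/-- The functional `t ↦ ε(ρ'(t) 1)` of the opposite Galois object. -/
def coAugment : W.TensorBos →ₗ[K] K :=
  counit ∘ₗ LinearMap.applyₗ (1 : W.invDeg.Biproduct) ∘ₗ L.coRep.toLinearMap

/-- The functional on `B(W) # K[Γ]` induced by the convolution product of the augmentations of
the two Galois objects. -/
def comparison : W.Biproduct →ₗ[K] K := L.coAugment ∘ₗ rightHit L.augment ∘ₗ W.sec

/-- The map `t ↦ ρ'(t₁) ⊗ ρ(t₂)` satisfies the relations with zero scalars, so it factors through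
`A`. -/
theorem comparison_proj (t : W.TensorBos) :
    L.comparison (W.proj t) = L.coAugment (rightHit L.augment t) := by
  have hD := L.isDeformation_coRep.tensorHom (isGaloisRep_iff.1 L.isGaloisRep_rep) (neg_neg 1).symm
  have hG : W.zeroScalars.IsGaloisRep (W.tensorHom L.coRep L.rep) :=
    ⟨fun i => by simp [hD.pow, zeroScalars], fun i j hij => by simp [hD.comm i j hij, zeroScalars]⟩
  have key : ∀ s, L.coAugment (rightHit L.augment s) = TensorProduct.rid K K
      (TensorProduct.map (counit ∘ₗ LinearMap.applyₗ (1 : W.invDeg.Biproduct))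
        (counit ∘ₗ LinearMap.applyₗ (1 : W.Biproduct)) (W.tensorHom L.coRep L.rep s)) := by
    intro s
    rw [← rid_map_comul, tensorHom_apply, ← LinearMap.comp_apply (TensorProduct.map _ _)
      (TensorProduct.map _ _), ← TensorProduct.map_comp]
    rfl
  rw [key, ← hG.sec_rep t, ← key, zeroScalars_rep]
  rfl

theorem comparison_grp (h : Γ) : L.comparison (W.grp h) = 1 := by
  rw [← proj_grp, comparison_proj, rightHit_augment_grp, coAugment, LinearMap.comp_apply,
    LinearMap.comp_apply, AlgHom.toLinearMap_apply, coRep_grp]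
  simp [lg_apply, counit_grp]

theorem rightHit_comparison_eq_zero {a : W.Biproduct} (ha : L.toLifting a = 0) :
    rightHit L.comparison a = 0 := by
  have hD := (isGaloisRep_iff.1 L.isGaloisRep_rep).tensorHom L.isDeformation_coRep neg_zero.symm
  -- In the other order, `t ↦ ρ(t₁) ⊗ ρ'(t₂)` satisfies the relations of the lifting, so it vanishes
  -- on a representative of `toLifting a = 0`. Evaluation at `1` and coassociativity turn this into
  -- the vanishing of the hit operator of `comparison` on `a`.
  have h0 : W.tensorHom L.rep L.coRep (rightHit L.augment (W.sec a)) = 0 := hD.map_eq_zero ha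
  have h1 := congrArg (fun u => TensorProduct.rid K W.Biproduct (TensorProduct.map
    (LinearMap.applyₗ (1 : W.Biproduct))
    (counit ∘ₗ LinearMap.applyₗ (1 : W.invDeg.Biproduct)) u)) h0
  simp only [map_zero] at h1
  rw [← h1, tensorHom_apply, ← LinearMap.comp_apply (TensorProduct.map _ _)
    (TensorProduct.map _ _), ← TensorProduct.map_comp]
  have h3 := LinearMap.congr_fun (comul_comp_rightHit L.augment) (W.sec a)
  simp only [LinearMap.comp_apply] at h3
  rw [h3, LinearMap.lTensor, ← LinearMap.comp_apply (TensorProduct.map _ _)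
    (TensorProduct.map _ _), ← TensorProduct.map_comp]
  have h4 : L.comparison ∘ₗ W.proj.toLinearMap = L.coAugment ∘ₗ rightHit L.augment :=
    LinearMap.ext L.comparison_proj
  conv_lhs => rw [← L.orbit_sec a]
  have h5 := rid_map_comul (LinearMap.id : W.Biproduct →ₗ[K] W.Biproduct) L.comparison
    (L.orbit (W.sec a))
  rw [LinearMap.id_apply] at h5
  rw [← h5, comul_orbit, ← LinearMap.comp_apply (TensorProduct.map _ _) (TensorProduct.map _ _),
    ← TensorProduct.map_comp, h4]
  rfl

/-- The kernel lies in that of a left colinear operator. Such an operator commutes with the right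
colinear `∂ᵢ`, and this one is the identity on `K[Γ]`. -/
theorem toLifting_injective : Function.Injective L.toLifting := by
  rw [← LinearMap.ker_eq_bot]
  have hle : LinearMap.ker L.toLifting ≤ LinearMap.ker (rightHit L.comparison) := fun a ha =>
    L.rightHit_comparison_eq_zero ha
  refine le_bot_iff.1 (hle.trans (W.eq_bot_of_der_stable ?_ ?_).le)
  · intro i a ha
    rw [LinearMap.mem_ker] at ha ⊢
    rw [der, skewOp, rightHit_leftHit, ha, map_zero]
  · intro a ha hs
    have hid : Set.EqOn (rightHit L.comparison)
        (LinearMap.id : W.Biproduct →ₗ[K] W.Biproduct)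
        (Submodule.span K (Set.range W.grp) : Set W.Biproduct) := by
      refine LinearMap.eqOn_span' ?_
      rintro _ ⟨h, rfl⟩
      simp [rightHit, comul_grp, comparison_grp]
    exact (hid hs).symm.trans ha

/-- The twist of `B(W) # K[Γ]` by `σ` is the lifting. -/
theorem twistIso_sigma (hu : IsUnit L.sigma) : TwistIso L.sigma L.Lifting := by
  refine ⟨{ LinearEquiv.ofBijective L.toLifting ⟨L.toLifting_injective,
    L.toLifting_surjective hu⟩ with
      counit_comp := LinearMap.ext L.counit_toLifting
      map_comp_comul := LinearMap.ext fun a => (L.comul_toLifting a).symm },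
    L.toLifting_one, L.toLifting_twistMul hu⟩

end LiftingScalars

theorem sigma_zeroScalars : W.zeroScalars.sigma = 1 := by
  refine BiForm.ext fun a b => ?_
  have h1 : W.zeroScalars.circ a b = a * b := by
    have h3 : W.proj (W.sec a * W.sec b) = a * b := by
      rw [map_mul, ← zeroScalars_rep, ← zeroScalars_rep, LiftingScalars.rep_sec_one,
        LiftingScalars.rep_sec_one]
    rw [← h3, ← zeroScalars_rep, map_mul, Module.End.mul_apply, LiftingScalars.rep_sec_one]
    rfl
  rw [LiftingScalars.sigma_tmul, h1, Bialgebra.counit_mul, BiForm.one_tmul]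

namespace LiftingScalars

variable {W} (L : W.LiftingScalars)

/-! ### Products of the forms `γᵢ` and `γ_{ij}` -/

open Classical in
/-- The scalars `aᵢ`, `i ∈ V`, and `a_{ij}`, `a_{ji}`, `(i, j) ∈ P`; the other ones are replaced
by zero. -/
def restrict (V : Set (Fin θ)) (P : Set (Fin θ × Fin θ)) : W.LiftingScalars where
  a i := if i ∈ V then L.a i else 0
  aa i j := if (i, j) ∈ P ∨ (j, i) ∈ P then L.aa i j else 0
  aa_swap i j h := by
    by_cases hm : (i, j) ∈ P ∨ (j, i) ∈ P
    · rw [if_pos hm, if_pos hm.symm, L.aa_swap i j h]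
    · rw [if_neg hm, if_neg fun h' => hm h'.symm, mul_zero]
  of_a_ne_zero i h := L.of_a_ne_zero i fun h0 => h (by simp [h0])
  of_aa_ne_zero i j hij h := L.of_aa_ne_zero i j hij fun h0 => h (by simp [h0])

variable {V : Set (Fin θ)} {P : Set (Fin θ × Fin θ)}

theorem restrict_a_of_mem {i : Fin θ} (hi : i ∈ V) : (L.restrict V P).a i = L.a i := if_pos hi

theorem restrict_a_of_notMem {i : Fin θ} (hi : i ∉ V) : (L.restrict V P).a i = 0 := if_neg hi

theorem low_restrict_of_mem {i k : Fin θ} (hP : ∀ p ∈ P, p.1 < p.2) (h : (i, k) ∈ P) :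
    (L.restrict V P).low k i = L.aa k i := by
  rw [low, if_pos (hP _ h)]
  exact if_pos (Or.inr h)

theorem low_restrict_of_notMem {i k : Fin θ} (hP : ∀ p ∈ P, p.1 < p.2) (h : (i, k) ∉ P) :
    (L.restrict V P).low k i = 0 := by
  rw [low]
  split_ifs with hik
  · refine if_neg ?_
    rintro (h' | h')
    · exact lt_asymm hik (hP _ h')
    · exact h h'
  · rfl

theorem sigma_restrict_empty : (L.restrict ∅ ∅).sigma = 1 := by
  rw [← W.sigma_zeroScalars]
  refine sigma_congr fun k => genOp_eq_of_low (L.restrict_a_of_notMem (by simp)) fun i => ?_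
  rw [L.low_restrict_of_notMem (by simp) (by simp)]
  simp [low, zeroScalars]

theorem sigma_restrict_insert_pair {i j : Fin θ} (hij : i < j) (hP : ∀ p ∈ P, p.1 < p.2)
    (h : (i, j) ∉ P) : (L.restrict V (insert (i, j) P)).sigma =
      W.gammaPairForm i j (L.aa j i) * (L.restrict V P).sigma := by
  have hP' : ∀ p ∈ insert (i, j) P, p.1 < p.2 := by
    rintro p (rfl | hp)
    · exact hij
    · exact hP p hp
  have haa : (L.restrict V (insert (i, j) P)).aa j i = L.aa j i :=
    if_pos (Or.inr (Set.mem_insert _ _))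
  rw [← haa]
  refine sigma_eq_gammaPairForm_mul hij (fun _ => rfl) (fun k l hkl => ?_)
    (L.low_restrict_of_notMem hP h)
  by_cases hm : (l, k) ∈ P
  · rw [L.low_restrict_of_mem hP hm, L.low_restrict_of_mem hP' (Set.mem_insert_of_mem _ hm)]
  · rw [L.low_restrict_of_notMem hP hm, L.low_restrict_of_notMem hP']
    rintro (h' | h')
    · rw [Prod.mk.injEq] at h'
      exact hkl h'.2 h'.1
    · exact hm h'

/-- The vertex must meet no pair of `P`: its scalar is added before its links. -/
theorem sigma_restrict_insert {i : Fin θ} (hi : i ∉ V) (hP : ∀ p ∈ P, p.1 < p.2)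
    (h : ∀ p ∈ P, p.1 ≠ i ∧ p.2 ≠ i) : (L.restrict (insert i V) P).sigma =
      W.gammaForm i (L.a i) * (L.restrict V P).sigma := by
  rw [← L.restrict_a_of_mem (P := P) (Set.mem_insert i V)]
  refine sigma_eq_gammaForm_mul (fun k hk => ?_) (fun _ _ => rfl) (L.restrict_a_of_notMem hi)
    (fun k => L.low_restrict_of_notMem hP fun hk => (h _ hk).2 rfl)
    (fun k => L.low_restrict_of_notMem hP fun hk => (h _ hk).1 rfl)
  by_cases hV : k ∈ V
  · rw [L.restrict_a_of_mem hV, L.restrict_a_of_mem (Set.mem_insert_of_mem _ hV)]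
  · rw [L.restrict_a_of_notMem hV, L.restrict_a_of_notMem]
    rintro (h' | h')
    · exact hk h'
    · exact hV h'

theorem prod_gammaForm_mul_sigma {l : List (Fin θ)} (hl : l.Nodup) (hV : ∀ i ∈ l, i ∉ V)
    (hP : ∀ p ∈ P, p.1 < p.2) (h : ∀ p ∈ P, p.1 ∉ l ∧ p.2 ∉ l) :
    (l.map fun i => W.gammaForm i (L.a i)).prod * (L.restrict V P).sigma =
      (L.restrict ({i | i ∈ l} ∪ V) P).sigma := by
  induction l with
  | nil => simp
  | cons i l ih =>
    rw [List.nodup_cons] at hl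
    have hset : {k | k ∈ i :: l} ∪ V = insert i ({k | k ∈ l} ∪ V) := by
      ext k
      simp [or_assoc]
    rw [List.map_cons, List.prod_cons, mul_assoc,
      ih hl.2 (fun k hk => hV k (List.mem_cons_of_mem _ hk)) fun p hp =>
        ⟨fun hk => (h p hp).1 (List.mem_cons_of_mem _ hk),
          fun hk => (h p hp).2 (List.mem_cons_of_mem _ hk)⟩, hset, L.sigma_restrict_insert _ hP]
    · exact fun p hp => ⟨fun hk => (h p hp).1 (hk ▸ List.mem_cons_self),
        fun hk => (h p hp).2 (hk ▸ List.mem_cons_self)⟩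
    · rintro (hk | hk)
      · exact hl.1 hk
      · exact hV i List.mem_cons_self hk

theorem prod_gammaPairForm_mul_sigma {l : List (Fin θ × Fin θ)} (hl : l.Nodup)
    (hlt : ∀ p ∈ l, p.1 < p.2) (hP : ∀ p ∈ P, p.1 < p.2) (h : ∀ p ∈ l, p ∉ P) :
    (l.map fun p => W.gammaPairForm p.1 p.2 (L.aa p.2 p.1)).prod * (L.restrict V P).sigma =
      (L.restrict V ({p | p ∈ l} ∪ P)).sigma := by
  induction l with
  | nil => simp
  | cons p l ih =>
    rw [List.nodup_cons] at hl
    have hset : {k | k ∈ p :: l} ∪ P = insert (p.1, p.2) ({k | k ∈ l} ∪ P) := by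
      ext k
      simp [or_assoc]
    rw [List.map_cons, List.prod_cons, mul_assoc,
      ih hl.2 (fun k hk => hlt k (List.mem_cons_of_mem _ hk))
        (fun k hk => h k (List.mem_cons_of_mem _ hk)), hset,
      L.sigma_restrict_insert_pair (hlt p List.mem_cons_self)]
    · rintro k (hk | hk)
      · exact hlt k (List.mem_cons_of_mem _ hk)
      · exact hP k hk
    · rintro (hk | hk)
      · exact hl.1 hk
      · exact h p List.mem_cons_self hk

/-- The pairs `i < j` with `i` and `j` in the same connected component, which belongs to `S`. -/
def componentPairs (S : Set L.graph.ConnectedComponent) : Set (Fin θ × Fin θ) :=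
  {p | p.1 < p.2 ∧ L.graph.connectedComponentMk p.1 ∈ S ∧
    L.graph.connectedComponentMk p.2 = L.graph.connectedComponentMk p.1}

/-- The scalars of the connected components in `S`. -/
def restrictTo (S : Set L.graph.ConnectedComponent) : W.LiftingScalars :=
  L.restrict {i | L.graph.connectedComponentMk i ∈ S} (L.componentPairs S)

/-! ### Products over connected components. -/

variable {γ : Fin θ → BiForm K W.Biproduct} {γγ : Fin θ → Fin θ → BiForm K W.Biproduct}

variable {L}

theorem IsComponentProduct.isUnit {τ : L.graph.ConnectedComponent} {α : BiForm K W.Biproduct}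
    (h : L.IsComponentProduct γ γγ τ α) (hγ : ∀ i, L.IsGamma i (γ i))
    (hγγ : ∀ i j, i < j → L.IsGammaPair i j (γγ i j)) : IsUnit α := by
  obtain ⟨p, p', ⟨l, -, hl, rfl⟩, ⟨l', -, -, rfl⟩, rfl⟩ := h
  refine (List.prod_isUnit ?_).mul (List.prod_isUnit ?_)
  · intro m hm
    obtain ⟨q, hq, rfl⟩ := List.mem_map.1 hm
    have hlt := ((hl q).1 hq).1
    rw [(hγγ q.1 q.2 hlt).unique (L.isGammaPair_gammaPairForm hlt.ne)]
    exact W.isUnit_gammaPairForm _ _ _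
  · intro m hm
    obtain ⟨i, -, rfl⟩ := List.mem_map.1 hm
    rw [(hγ i).unique (L.isGamma_gammaForm i)]
    exact W.isUnit_gammaForm _ _

/-- The vertices of `τ` meet no pair in the components of `S`, so their `γᵢ` can be added first, in
any order, and then the `γ_{ij}`. Keeping `S` general allows induction over components; `S = ∅`
gives `α_τ` itself. -/
theorem IsComponentProduct.mul_sigma {τ : L.graph.ConnectedComponent} {α : BiForm K W.Biproduct}
    (h : L.IsComponentProduct γ γγ τ α) (hγ : ∀ i, L.IsGamma i (γ i))
    (hγγ : ∀ i j, i < j → L.IsGammaPair i j (γγ i j)) {S : Set L.graph.ConnectedComponent}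
    (hS : τ ∉ S) : α * (L.restrictTo S).sigma = (L.restrictTo (insert τ S)).sigma := by
  obtain ⟨p, p', ⟨l, hl, hlm, rfl⟩, ⟨l', hl', hlm', rfl⟩, rfl⟩ := h
  have h1 : l.map (fun ij => γγ ij.1 ij.2) =
      l.map fun p => W.gammaPairForm p.1 p.2 (L.aa p.2 p.1) :=
    List.map_congr_left fun q hq => by
      have hlt := ((hlm q).1 hq).1
      exact (hγγ q.1 q.2 hlt).unique (L.isGammaPair_gammaPairForm hlt.ne)
  have h2 : l'.map γ = l'.map fun i => W.gammaForm i (L.a i) :=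
    List.map_congr_left fun i _ => (hγ i).unique (L.isGamma_gammaForm i)
  simp only [SimpleGraph.ConnectedComponent.mem_supp_iff] at hlm'
  simp only [Set.mem_ofPred_eq, SimpleGraph.ConnectedComponent.mem_supp_iff] at hlm
  have hP : ∀ p ∈ L.componentPairs S, p.1 < p.2 := fun p hp => hp.1
  rw [h1, h2, mul_assoc, restrictTo, L.prod_gammaForm_mul_sigma hl' _ hP,
    L.prod_gammaPairForm_mul_sigma hl (fun p hp => ((hlm p).1 hp).1) hP, restrictTo]
  · congr 2
    · ext i
      simp [hlm']
    · ext p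
      simp only [componentPairs, Set.mem_union, Set.mem_ofPred_eq, hlm, Set.mem_insert_iff]
      constructor
      · rintro (⟨h, h', h''⟩ | ⟨h, h', h''⟩)
        · exact ⟨h, Or.inl h', h''.trans h'.symm⟩
        · exact ⟨h, Or.inr h', h''⟩
      · rintro ⟨h, h' | h', h''⟩
        · exact Or.inl ⟨h, h', h''.trans h'⟩
        · exact Or.inr ⟨h, h', h''⟩
  · intro p hp hp'
    exact hS (((hlm p).1 hp).2.1 ▸ hp'.2.1)
  · intro p hp
    rw [hlm', hlm', hp.2.2]
    have : L.graph.connectedComponentMk p.1 ≠ τ := fun h => hS (h ▸ hp.2.1)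
    exact ⟨this, this⟩
  · intro i hi hi'
    exact hS ((hlm' i).1 hi ▸ hi')

variable (L)

theorem sigma_restrictTo_empty : (L.restrictTo ∅).sigma = 1 := by
  rw [← L.sigma_restrict_empty, restrictTo]
  congr 2
  ext p
  simp [componentPairs]

/-- Restricting to pairs within a component loses nothing, since a nonzero `a_{ki}` is an edge. -/
theorem sigma_restrictTo_univ : (L.restrictTo Set.univ).sigma = L.sigma := by
  refine sigma_congr fun k => genOp_eq_of_low (L.restrict_a_of_mem (by simp)) fun i => ?_
  have hP : ∀ p ∈ L.componentPairs Set.univ, p.1 < p.2 := fun p hp => hp.1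
  by_cases hik : i < k
  · by_cases h : (i, k) ∈ L.componentPairs Set.univ
    · rw [restrictTo, L.low_restrict_of_mem hP h, low, if_pos hik]
    · rw [restrictTo, L.low_restrict_of_notMem hP h, low, if_pos hik]
      by_contra hne
      refine h ⟨hik, Set.mem_univ _, ?_⟩
      refine SimpleGraph.ConnectedComponent.connectedComponentMk_eq_of_adj ?_
      rw [graph, SimpleGraph.fromRel_adj]
      exact ⟨hik.ne', Or.inl (Ne.symm hne)⟩
  · rw [low, low, if_neg hik, if_neg hik]

variable {L}

theorem prod_componentProduct {ατ : L.graph.ConnectedComponent → BiForm K W.Biproduct}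
    (h : ∀ τ, L.IsComponentProduct γ γγ τ (ατ τ)) (hγ : ∀ i, L.IsGamma i (γ i))
    (hγγ : ∀ i j, i < j → L.IsGammaPair i j (γγ i j)) {l : List L.graph.ConnectedComponent}
    (hl : l.Nodup) : (l.map ατ).prod = (L.restrictTo {τ | τ ∈ l}).sigma := by
  induction l with
  | nil =>
    have hset : {τ | τ ∈ ([] : List L.graph.ConnectedComponent)} = ∅ := by
      ext
      simp
    rw [hset, sigma_restrictTo_empty, List.map_nil, List.prod_nil]
  | cons τ l ih =>
    rw [List.nodup_cons] at hl
    rw [List.map_cons, List.prod_cons, ih hl.2, (h τ).mul_sigma hγ hγγ hl.1]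
    congr 2
    ext
    simp

theorem isHBilinearCocycle_sigma {L : W.LiftingScalars} (hu : IsUnit L.sigma) :
    IsHBilinearCocycle W.incl L.sigma :=
  ⟨L.isTwoCocycle_sigma hu, L.isHBilinear_sigma⟩

end LiftingScalars

end QuantumLinearSpace

end

/-- The maps `γᵢ` and `γ_{ij}` exist and are unique; for every connected component `τ` the product
`α_τ` is in `Z²_H(A, K)`; the product `α` of the `α_τ` is in `Z²_H(A, K)`, and `A^α ≅ B`. The
products without a given order may be taken in any order. -/
theorem mainTheorem1 {K Γ : Type*} [Field K] [CharZero K] [CommGroup Γ] [Finite Γ] {θ : ℕ}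
    (W : QuantumLinearSpace K Γ θ) (L : W.LiftingScalars) :
    (∀ i, ∃! γ, L.IsGamma i γ) ∧
    (∀ i j, i < j → ∃! γ, L.IsGammaPair i j γ) ∧
    ∀ (γ : Fin θ → BiForm K W.Biproduct) (γγ : Fin θ → Fin θ → BiForm K W.Biproduct),
      (∀ i, L.IsGamma i (γ i)) → (∀ i j, i < j → L.IsGammaPair i j (γγ i j)) →
      ∀ ατ : L.graph.ConnectedComponent → BiForm K W.Biproduct,
        (∀ τ, L.IsComponentProduct γ γγ τ (ατ τ)) →
        (∀ τ, IsHBilinearCocycle W.incl (ατ τ)) ∧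
        ∀ α : BiForm K W.Biproduct, IsProductOver Set.univ ατ α →
          IsHBilinearCocycle W.incl α ∧ TwistIso α L.Lifting := by
  refine ⟨fun i => ⟨_, L.isGamma_gammaForm i, fun γ h => h.unique (L.isGamma_gammaForm i)⟩,
    fun i j hij => ⟨_, L.isGammaPair_gammaPairForm hij.ne,
      fun γ h => h.unique (L.isGammaPair_gammaPairForm hij.ne)⟩, ?_⟩
  intro γ γγ hγ hγγ ατ hα
  have hunit : ∀ τ, IsUnit (ατ τ) := fun τ => (hα τ).isUnit hγ hγγ
  refine ⟨fun τ => ?_, ?_⟩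
  -- Added to zero scalars, the component product is itself the `σ` of the scalars of `τ`.
  · have h := (hα τ).mul_sigma hγ hγγ (Set.notMem_empty τ)
    rw [L.sigma_restrictTo_empty, mul_one] at h
    have hu := hunit τ
    rw [h] at hu ⊢
    exact QuantumLinearSpace.LiftingScalars.isHBilinearCocycle_sigma hu
  · rintro α ⟨l, hl, hlm, rfl⟩
    have hu : IsUnit (l.map ατ).prod := by
      refine List.prod_isUnit fun m hm => ?_
      obtain ⟨τ, -, rfl⟩ := List.mem_map.1 hm
      exact hunit τ
    have hset : {τ | τ ∈ l} = Set.univ := Set.ext hlm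
    have h := QuantumLinearSpace.LiftingScalars.prod_componentProduct hα hγ hγγ hl
    rw [hset, L.sigma_restrictTo_univ] at h
    rw [h] at hu ⊢
    exact ⟨QuantumLinearSpace.LiftingScalars.isHBilinearCocycle_sigma hu, L.twistIso_sigma hu⟩
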